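/- Let $d\ge 1$ be an integer and $\gamma>d$ a real number. Put $d_1=2-\frac d\gamma\in(1,2)$, and let $\omega_{d-1}$ be the surface measure of the unit sphere of $\mathbb R^d$. Let $0<R_1<R_2<\dots$ be the distances from the origin, in increasing order, of the points of a homogeneous Poisson point process in $\mathbb R^d$ of intensity $\lambda=(2\gamma-d)/\omega_{d-1}$. For $r\ge 1$ put $\rho=r^{d/2}$ and $$\overline S^{(r)}=\sum_{k:\,R_k>r}R_k^{-\gamma},\qquad \mu(r)=\mathbb E[\overline S^{(r)}],\qquad \sigma^2(r)=\mathrm{Var}(\overline S^{(r)}),\qquad Y^{(r)}=\frac{\overline S^{(r)}-\mu(r)}{\sigma(r)},\qquad \phi_{Y^{(r)}}(t)=\mathbb E[e^{-tY^{(r)}}].$$ The sum converges almost surely, $\overline S^{(r)}$ has finite mean and finite positive variance, $\phi_{Y^{(r)}}(t)$ is finite for all real $t$, and $Y^{(r)}$ has a (unique) continuous density $f_{Y^{(r)}}$ on $\mathbb R$. For $y>-\mu(r)/\sigma(r)$ the function $\xi'\mapsto e^{-\xi' y}\phi_{Y^{(r)}}(-\xi')$ has a unique minimiser $\xi=\xi(y,r)$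 over $\mathbb R$. Let $\widetilde Y^{(r)}$ be a random variable with density $z\mapsto e^{\xi z}f_{Y^{(r)}}(z)/\phi_{Y^{(r)}}(-\xi)$, and put $$\tilde\kappa_n=d_1\int_0^1 e^{\xi u/\rho}\,u^{n-1-d/\gamma}\,du,\qquad n\ge 2.$$ Then $\widetilde Y^{(r)}$ has mean $y$, variance $\tilde\kappa_2$, and its $n$-th cumulant is $\tilde\kappa_n/\rho^{n-2}$ for all $n\ge 2$. For $k\ge 0$, $1\le j\le k$ and $1\le \ell\le j$ put $$\tilde c_{j,\ell}=\frac1{\ell!}\sum_{\substack{3\le n_1,\dots,n_\ell\le k+2\\ (n_1-2)+\dots+(n_\ell-2)=j}}\frac{\tilde\kappa_{n_1}}{n_1!}\cdots\frac{\tilde\kappa_{n_\ell}}{n_\ell!},\qquad \tilde{\mathfrak n}_k=\frac1{\sqrt{2\pi\tilde\kappa_2}}\left[1+\sum_{j=1}^k\frac{(-1)^j}{\rho^j}\sum_{\ell=1}^j\frac{\tilde c_{j,\ell}}{\tilde\kappa_2^{j/2+\ell}}H_{j+2\ell}(0)\right],$$ where $H_n$ is the $n$-th (probabilists') Hermite polynomial.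 Theorem. There are constants $C_2,C_3,C_4\in(0,\infty)$, depending only on $d$ and $\gamma$, such that for all integers $k\ge 0$, all $r\ge 1$ and all $y>-\mu(r)/\sigma(r)$: (a) if $y\ge 0$ and $r^{d/2}\ge C_4\sqrt k$, then $$f_{Y^{(r)}}(y)=\tilde{\mathfrak n}_k\,e^{-\xi y}\,\phi_{Y^{(r)}}(-\xi)\,[1+\varepsilon_k(r,y)]$$ with $$|\varepsilon_k(r,y)|\le\frac{C_2C_3^k\,k^{k/2}}{(\sqrt{\tilde\kappa_2}\,r^{d/2})^{k+1}}\le\frac{C_2C_3^k\,k^{k/2}}{(r^{d/2})^{k+1}};$$ (b) if $y\le 0$ and $r^{d/2}\ge\max\{C_4\sqrt k,\,k\}$, then the same formula holds with $$|\varepsilon_k(r,y)|\le C_2C_3^k\,k^{k/2}\left(\frac{\tilde\kappa_2^{\frac1{d_1}-\frac12}}{r^{d/2}}\right)^{k+1}\le\frac{C_2C_3^k\,k^{k/2}}{(r^{d/2})^{k+1}}.$$ Here $k^{k/2}=1$ for $k=0$. -/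

import Mathlib

open MeasureTheory ProbabilityTheory Set

namespace ShotNoise

noncomputable section

/-- The number of points of the random set `Φ` that fall in `B`. -/
def count {Ω E : Type*} (Φ : Ω → Set E) (B : Set E) (ω : Ω) : ℕ∞ :=
  (Φ ω ∩ B).encard

/-- The random set of points `Φ` is a homogeneous Poisson point process of intensity `lam`:
the number of points in a Borel set of finite volume is Poisson distributed with mean
`lam` times the volume, and the numbers of points in disjoint Borel sets are independent. -/
structure IsHomogeneousPoisson {Ω : Type*} [MeasurableSpace Ω] (P : Measure Ω) {d : ℕ}
    (Φ : Ω → Set (EuclideanSpace ℝ (Fin d))) (lam : ℝ) : Prop where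
  measurable_count : ∀ B : Set (EuclideanSpace ℝ (Fin d)), MeasurableSet B →
    Measurable (count Φ B)
  law_count : ∀ B : Set (EuclideanSpace ℝ (Fin d)), MeasurableSet B → volume B ≠ ⊤ →
    P.map (count Φ B) =
      (poissonMeasure (lam * volume.real B).toNNReal).map (fun n : ℕ => (n : ℕ∞))
  indep_count : ∀ (n : ℕ) (B : Fin n → Set (EuclideanSpace ℝ (Fin d))),
    (∀ i, MeasurableSet (B i)) → Pairwise (fun i j => Disjoint (B i) (B j)) →
    iIndepFun (fun i => count Φ (B i)) P

/-- The surface measure `ω_{d-1}` of the unit sphere of `ℝ^d`. -/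
def sphereArea (d : ℕ) : ℝ :=
  (volume : Measure (EuclideanSpace ℝ (Fin d))).toSphere.real univ

/-- The normalised intensity `(2γ - d) / ω_{d-1}`. -/
def intensity (d : ℕ) (γ : ℝ) : ℝ :=
  (2 * γ - d) / sphereArea d

/-- `radius Φ k ω` is the distance `R_k` of the `k`-th closest point to the origin
(`k = 1, 2, …`): the least `x ≥ 0` such that at least `k` points are within distance `x`. -/
def radius {Ω : Type*} {d : ℕ} (Φ : Ω → Set (EuclideanSpace ℝ (Fin d))) (k : ℕ) (ω : Ω) : ℝ :=
  sInf {x : ℝ | 0 ≤ x ∧ (k : ℕ∞) ≤ count Φ (Metric.closedBall 0 x) ω}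

/-- The `k`-th summand of the tail shot noise: `R_k ^ (-γ)` if `R_k > r`, and `0` otherwise. -/
def tailTerm {Ω : Type*} {d : ℕ} (Φ : Ω → Set (EuclideanSpace ℝ (Fin d))) (γ r : ℝ) (k : ℕ)
    (ω : Ω) : ℝ :=
  if r < radius Φ k ω then radius Φ k ω ^ (-γ) else 0

/-- The tail shot noise `∑_{k ≥ 1, R_k > r} R_k ^ (-γ)`. -/
def tailNoise {Ω : Type*} {d : ℕ} (Φ : Ω → Set (EuclideanSpace ℝ (Fin d))) (γ r : ℝ)
    (ω : Ω) : ℝ :=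
  ∑' k : ℕ, tailTerm Φ γ r (k + 1) ω

/-- The mean `μ(r)` of the tail shot noise. -/
def noiseMean {Ω : Type*} [MeasurableSpace Ω] (P : Measure Ω) {d : ℕ}
    (Φ : Ω → Set (EuclideanSpace ℝ (Fin d))) (γ r : ℝ) : ℝ :=
  ∫ ω, tailNoise Φ γ r ω ∂P

/-- The standard deviation `σ(r)` of the tail shot noise. -/
def noiseStd {Ω : Type*} [MeasurableSpace Ω] (P : Measure Ω) {d : ℕ}
    (Φ : Ω → Set (EuclideanSpace ℝ (Fin d))) (γ r : ℝ) : ℝ :=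
  Real.sqrt (variance (tailNoise Φ γ r) P)

/-- The normalised tail shot noise `Y^(r)`. -/
def normNoise {Ω : Type*} [MeasurableSpace Ω] (P : Measure Ω) {d : ℕ}
    (Φ : Ω → Set (EuclideanSpace ℝ (Fin d))) (γ r : ℝ) (ω : Ω) : ℝ :=
  (tailNoise Φ γ r ω - noiseMean P Φ γ r) / noiseStd P Φ γ r

/-- The Laplace transform `t ↦ E[exp(-t Y)]` of a random variable `Y`. -/
def laplace {Ω : Type*} [MeasurableSpace Ω] (P : Measure Ω) (Y : Ω → ℝ) (t : ℝ) : ℝ :=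
  ∫ ω, Real.exp (-t * Y ω) ∂P

/-- The Cramér transform with parameter `ξ` of the law of `Y`: the density of the law of `Y` is
multiplied by `exp(ξ z) / E[exp(ξ Y)]`. -/
def tiltedLaw {Ω : Type*} [MeasurableSpace Ω] (P : Measure Ω) (Y : Ω → ℝ) (ξ : ℝ) : Measure ℝ :=
  (P.map Y).tilted (fun z => ξ * z)

/-- `d_1 = 2 - d / γ`. -/
def dOne (d : ℕ) (γ : ℝ) : ℝ :=
  2 - d / γ

/-- `ρ = r ^ (d / 2)`. -/
def rho (d : ℕ) (r : ℝ) : ℝ :=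
  r ^ ((d : ℝ) / 2)

/-- The coefficients `κ̃_n = d_1 ∫_0^1 exp(ξ u / ρ) u ^ (n - 1 - d / γ) du`, `n ≥ 2`. -/
def tkappa (d : ℕ) (γ r ξ : ℝ) (n : ℕ) : ℝ :=
  dOne d γ * ∫ u in (0 : ℝ)..1, Real.exp (ξ * u / rho d r) * u ^ ((n : ℝ) - 1 - d / γ)

/-- The coefficient `c̃_{j,ℓ}` of the Edgeworth expansion of order `k`:
`(1 / ℓ!) ∑ (κ_{n_1} / n_1!) ⋯ (κ_{n_ℓ} / n_ℓ!)` over all `3 ≤ n_1, …, n_ℓ ≤ k + 2` with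
`(n_1 - 2) + ⋯ + (n_ℓ - 2) = j`. -/
def edgeworthCoeff (κ : ℕ → ℝ) (k j l : ℕ) : ℝ :=
  (1 / (l.factorial : ℝ)) *
    ∑ n ∈ (Fintype.piFinset (fun _ : Fin l => Finset.Icc 3 (k + 2))).filter
        (fun n => ∑ i, (n i - 2) = j),
      ∏ i, κ (n i) / ((n i).factorial : ℝ)

/-- The Edgeworth term of order `k` at the mean, as an explicit function of
`κ_2, …, κ_{k+2}` and `ρ`. -/
def edgeworthTerm (κ : ℕ → ℝ) (ρ : ℝ) (k : ℕ) : ℝ :=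
  1 / Real.sqrt (κ 2) * gaussianPDFReal 0 1 0 *
    (1 + ∑ j ∈ Finset.Icc 1 k, (-1) ^ j / ρ ^ j *
      ∑ l ∈ Finset.Icc 1 j, edgeworthCoeff κ k j l / κ 2 ^ ((j : ℝ) / 2 + l) *
        (((Polynomial.hermite (j + 2 * l)).eval 0 : ℤ) : ℝ))

end

end ShotNoise

/-!
Put `α = d / γ`. By Campbell's formula the normalised tail shot noise is infinitely divisible: its
cumulant generating function is `ξ ↦ ρ² ∫₀¹ (exp (ξ u / ρ) - 1 - ξ u / ρ) ν(du)` with the power-law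
Lévy measure `ν(du) = (2 - α) u ^ (-1 - α) du`. Tilting by `exp (ξ z)` only changes `ν` into
`exp (ξ u / ρ) ν(du)`, so that the tilted law has mean `y` exactly when `ξ` is the minimiser, and
its cumulants are the moments `κ̃ₙ / ρ ^ (n - 2)`. Fourier inversion turns the density at `y` into
the integral of the characteristic function of the centred tilted law, that is, of a Gaussian factor
times the exponential of a power series in `1 / ρ`.

For small frequencies this exponential is expanded to order `k`: the polynomial part integrates to
the Hermite values of the Edgeworth term, and Taylor remainders are integrated with
`x ^ k ≤ (k / 2Q) ^ (k / 2) * exp (Q * x ^ 2)`, which is where `k ^ (k / 2)` comes from. For large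
frequencies the characteristic function is exponentially small. All bounds have to be uniform in the
tilt `b = ξ / ρ`: for `b ≥ 0` the cumulant ratios `κ̃ₙ / κ̃₂` are bounded, while for `b → -∞` the
tilted Lévy measure concentrates near `|b|⁻¹`, so that `κ̃₂` decays as `|b| ^ (α - 2)` and
the natural scale is `κ̃₂ ^ (1 / (2 - α) - 1 / 2) / ρ` instead of `1 / (√κ̃₂ ρ)`.
-/

namespace ShotNoise

theorem pow_le_rpow_mul_exp_sq {Q : ℝ} (hQ : 0 < Q) (n : ℕ) {x : ℝ} (hx : 0 ≤ x) :
    x ^ n ≤ (n / (2 * Q)) ^ ((n : ℝ) / 2) * Real.exp (Q * x ^ 2) := by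
  rcases Nat.eq_zero_or_pos n with rfl | hn
  · simp [Real.one_le_exp (by positivity : 0 ≤ Q * x ^ 2)]
  have hsq : x ^ 2 ≤ (n / (2 * Q)) * Real.exp (2 * Q * x ^ 2 / n) := by
    have := Real.add_one_le_exp (2 * Q * x ^ 2 / n)
    calc x ^ 2 = (n / (2 * Q)) * (2 * Q * x ^ 2 / n) := by field_simp
      _ ≤ _ := by gcongr; linarith
  calc x ^ n = (x ^ 2) ^ ((n : ℝ) / 2) := by
        rw [← Real.rpow_natCast x 2, ← Real.rpow_mul hx, ← Real.rpow_natCast]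
        congr 1; push_cast; ring
    _ ≤ ((n / (2 * Q)) * Real.exp (2 * Q * x ^ 2 / n)) ^ ((n : ℝ) / 2) := by gcongr
    _ = _ := by
        rw [Real.mul_rpow (by positivity) (by positivity), ← Real.exp_mul]
        congr 2; field_simp

theorem exists_pow_add_le_exp_sq {Q : ℝ} (hQ : 0 < Q) (m : ℕ) :
    ∃ C D : ℝ, 0 < C ∧ 1 ≤ D ∧ ∀ (k : ℕ) (x : ℝ), 0 ≤ x →
      x ^ (k + m) ≤ C * D ^ k * (k : ℝ) ^ ((k : ℝ) / 2) * Real.exp (Q * x ^ 2) := by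
  have hC : 0 < ((m : ℝ) / (2 * (Q / 2))) ^ ((m : ℝ) / 2) := by
    rcases Nat.eq_zero_or_pos m with rfl | hm
    · simp
    · positivity
  refine ⟨_, max 1 ((1 / Q) ^ (1 / 2 : ℝ)), hC, le_max_left _ _, fun k x hx => ?_⟩
  calc x ^ (k + m) = x ^ k * x ^ m := pow_add x k m
    _ ≤ ((k / (2 * (Q / 2))) ^ ((k : ℝ) / 2) * Real.exp (Q / 2 * x ^ 2)) *
        ((m / (2 * (Q / 2))) ^ ((m : ℝ) / 2) * Real.exp (Q / 2 * x ^ 2)) := by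
        gcongr <;> exact pow_le_rpow_mul_exp_sq (by positivity) _ hx
    _ = (m / (2 * (Q / 2))) ^ ((m : ℝ) / 2) * ((1 / Q) ^ (1 / 2 : ℝ)) ^ k *
        (k : ℝ) ^ ((k : ℝ) / 2) * Real.exp (Q * x ^ 2) := by
        have hexp : Real.exp (Q * x ^ 2) =
            Real.exp (Q / 2 * x ^ 2) * Real.exp (Q / 2 * x ^ 2) := by
          rw [← Real.exp_add]; congr 1; ring
        have hpow : ((k : ℝ) / (2 * (Q / 2))) ^ ((k : ℝ) / 2) =
            ((1 / Q) ^ (1 / 2 : ℝ)) ^ k * (k : ℝ) ^ ((k : ℝ) / 2) := by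
          rw [← Real.rpow_natCast, ← Real.rpow_mul (by positivity), one_div_mul_eq_div,
            ← Real.mul_rpow (by positivity) (by positivity)]
          congr 1; ring
        rw [hexp, hpow]; ring
    _ ≤ _ := by
        gcongr
        exact le_max_right _ _

theorem hasDerivAt_exp_sub_sum (N : ℕ) (z : ℂ) :
    HasDerivAt (fun z : ℂ => Complex.exp z - ∑ n ∈ Finset.range (N + 1), z ^ n / (n.factorial : ℂ))
      (Complex.exp z - ∑ n ∈ Finset.range N, z ^ n / (n.factorial : ℂ)) z := by
  have hsum : HasDerivAt (fun z : ℂ => ∑ n ∈ Finset.range (N + 1), z ^ n / (n.factorial : ℂ))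
      (∑ n ∈ Finset.range (N + 1), (n * z ^ (n - 1)) / (n.factorial : ℂ)) z :=
    HasDerivAt.fun_sum fun n _ => (hasDerivAt_pow n z).div_const _
  refine ((Complex.hasDerivAt_exp z).sub hsum).congr_deriv ?_
  rw [Finset.sum_range_succ']
  simp only [Nat.cast_zero, zero_mul, zero_div, add_zero]
  congr 1
  refine Finset.sum_congr rfl fun n _ => ?_
  have : ((n : ℂ) + 1) ≠ 0 := by exact_mod_cast Nat.succ_ne_zero n
  rw [Nat.factorial_succ, Nat.add_sub_cancel]
  push_cast
  field_simp

theorem norm_exp_sub_sum_le_of_re_nonpos (N : ℕ) {z : ℂ} (hz : z.re ≤ 0) :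
    ‖Complex.exp z - ∑ n ∈ Finset.range N, z ^ n / (n.factorial : ℂ)‖ ≤ ‖z‖ ^ N / N.factorial := by
  induction N generalizing z with
  | zero => simpa [Complex.norm_exp] using hz
  | succ N ih =>
    set R : ℝ → ℂ := fun t => Complex.exp (t * z) -
      ∑ n ∈ Finset.range (N + 1), (t * z) ^ n / (n.factorial : ℂ) with hR
    have hderiv (t : ℝ) : HasDerivAt R
        ((Complex.exp (t * z) - ∑ n ∈ Finset.range N, (t * z) ^ n / (n.factorial : ℂ)) * z) t :=
      (hasDerivAt_exp_sub_sum N (t * z)).comp t (by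
        simpa using (Complex.ofRealCLM.hasDerivAt (x := t)).mul_const z)
    have hbound (t : ℝ) : HasDerivAt
        (fun t : ℝ => t ^ (N + 1) * (‖z‖ ^ (N + 1) / (N + 1).factorial))
        (t ^ N * ‖z‖ ^ N / N.factorial * ‖z‖) t := by
      refine ((hasDerivAt_pow (N + 1) t).mul_const _).congr_deriv ?_
      rw [Nat.factorial_succ, Nat.add_sub_cancel]
      push_cast
      field_simp
      ring
    have hR1 : ‖R 1‖ ≤ 1 ^ (N + 1) * (‖z‖ ^ (N + 1) / (N + 1).factorial) := by
      refine image_norm_le_of_norm_deriv_right_le_deriv_boundary (a := 0) (b := 1)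
        (fun t _ => (hderiv t).continuousAt.continuousWithinAt)
        (fun t _ => (hderiv t).hasDerivWithinAt) ?_ hbound ?_ (right_mem_Icc.2 zero_le_one)
      · simp [hR, Finset.sum_range_succ']
      · intro t ht
        have hre : ((t : ℂ) * z).re ≤ 0 := by
          rw [Complex.re_ofReal_mul]
          exact mul_nonpos_of_nonneg_of_nonpos ht.1 hz
        rw [norm_mul]
        gcongr
        calc _ ≤ ‖(t : ℂ) * z‖ ^ N / N.factorial := ih hre
          _ = _ := by rw [norm_mul, Complex.norm_real, Real.norm_of_nonneg ht.1, mul_pow]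
    simpa [hR] using hR1

/-- The words `n₁ ⋯ n_l` in the letters `3, …, k + 2`, which index the terms of
`(c₃ + ⋯ + c_{k+2}) ^ l`. -/
def words (k l : ℕ) : Finset (Fin l → ℕ) :=
  Fintype.piFinset fun _ => Finset.Icc 3 (k + 2)

/-- The weight of a word, in which the letter `n` counts `n - 2`: the power of `1 / ρ` that the
word contributes to the Edgeworth expansion. -/
def weight {l : ℕ} (n : Fin l → ℕ) : ℕ :=
  ∑ i, (n i - 2)

/-- The part of weight `j` of the exponential series of `c₃ + ⋯ + c_{k+2}`; words longer than `k`
are left out, since their weight exceeds `k`. -/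
noncomputable def wordSum (c : ℕ → ℂ) (k j : ℕ) : ℂ :=
  ∑ l ∈ Finset.range (k + 1), (1 / (l.factorial : ℂ)) *
    ∑ n ∈ words k l with weight n = j, ∏ i, c (n i)

section Words

variable {c : ℕ → ℂ} {β : ℕ → ℝ} {k l : ℕ} {θ : ℝ}

theorem sum_words_prod {R : Type*} [CommSemiring R] (c : ℕ → R) (k l : ℕ) :
    ∑ n ∈ words k l, ∏ i, c (n i) = (∑ n ∈ Finset.Icc 3 (k + 2), c n) ^ l := by
  rw [words, ← Finset.prod_univ_sum, Finset.prod_const, Finset.card_univ, Fintype.card_fin]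

theorem length_le_weight {n : Fin l → ℕ} (hn : n ∈ words k l) : l ≤ weight n := by
  calc l = ∑ _i : Fin l, 1 := by simp
    _ ≤ weight n := Finset.sum_le_sum fun i _ => by
      have := Finset.mem_Icc.1 (Fintype.mem_piFinset.1 hn i)
      omega

theorem norm_prod_word_le (hc : ∀ n ∈ Finset.Icc 3 (k + 2), ‖c n‖ ≤ β n * θ ^ (n - 2))
    {n : Fin l → ℕ} (hn : n ∈ words k l) :
    ‖∏ i, c (n i)‖ ≤ (∏ i, β (n i)) * θ ^ weight n := by
  rw [norm_prod, weight, ← Finset.prod_pow_eq_pow_sum, ← Finset.prod_mul_distrib]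
  exact Finset.prod_le_prod (fun _ _ => norm_nonneg _)
    fun i _ => hc _ (Fintype.mem_piFinset.1 hn i)

theorem norm_sum_words_le (hβ : ∀ n, 0 ≤ β n)
    (hc : ∀ n ∈ Finset.Icc 3 (k + 2), ‖c n‖ ≤ β n * θ ^ (n - 2)) (l : ℕ) {M : ℝ} (hM : 0 ≤ M)
    (p : (Fin l → ℕ) → Prop) [DecidablePred p] (hp : ∀ n, p n → θ ^ weight n ≤ M) :
    ‖(1 / (l.factorial : ℂ)) * ∑ n ∈ words k l with p n, ∏ i, c (n i)‖ ≤
      M * ((∑ n ∈ Finset.Icc 3 (k + 2), β n) ^ l / l.factorial) := by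
  have hprod (n : Fin l → ℕ) : 0 ≤ ∏ i, β (n i) := Finset.prod_nonneg fun i _ => hβ _
  have hsum : ‖∑ n ∈ words k l with p n, ∏ i, c (n i)‖ ≤
      M * (∑ n ∈ Finset.Icc 3 (k + 2), β n) ^ l := by
    calc _ ≤ ∑ n ∈ words k l with p n, M * ∏ i, β (n i) := by
          refine norm_sum_le_of_le _ fun n hn => ?_
          rw [Finset.mem_filter] at hn
          refine (norm_prod_word_le hc hn.1).trans ?_
          rw [mul_comm]
          exact mul_le_mul_of_nonneg_right (hp n hn.2) (hprod n)
      _ ≤ ∑ n ∈ words k l, M * ∏ i, β (n i) :=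
          Finset.sum_le_sum_of_subset_of_nonneg (Finset.filter_subset _ _)
            fun n _ _ => mul_nonneg hM (hprod n)
      _ = _ := by rw [← Finset.mul_sum, sum_words_prod]
  rw [norm_mul, norm_div, norm_one, Complex.norm_natCast]
  calc _ ≤ 1 / (l.factorial : ℝ) * (M * (∑ n ∈ Finset.Icc 3 (k + 2), β n) ^ l) := by gcongr
    _ = _ := by ring

theorem norm_wordSum_le (hβ : ∀ n, 0 ≤ β n) (hθ : 0 ≤ θ)
    (hc : ∀ n ∈ Finset.Icc 3 (k + 2), ‖c n‖ ≤ β n * θ ^ (n - 2)) (j : ℕ) :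
    ‖wordSum c k j‖ ≤ θ ^ j * Real.exp (∑ n ∈ Finset.Icc 3 (k + 2), β n) := by
  calc ‖wordSum c k j‖ ≤ ∑ l ∈ Finset.range (k + 1),
        θ ^ j * ((∑ n ∈ Finset.Icc 3 (k + 2), β n) ^ l / l.factorial) :=
        norm_sum_le_of_le _ fun l _ => norm_sum_words_le hβ hc l (pow_nonneg hθ j) _
          fun n hn => by rw [hn]
    _ ≤ _ := by
        rw [← Finset.mul_sum]
        gcongr
        exact Real.sum_le_exp_of_nonneg (Finset.sum_nonneg fun n _ => hβ n) _

theorem sum_wordSum (c : ℕ → ℂ) (k : ℕ) :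
    ∑ j ∈ Finset.range (k + 1), wordSum c k j =
      ∑ l ∈ Finset.range (k + 1), (1 / (l.factorial : ℂ)) *
        ∑ n ∈ words k l with ¬ k < weight n, ∏ i, c (n i) := by
  simp only [wordSum]
  rw [Finset.sum_comm]
  refine Finset.sum_congr rfl fun l _ => ?_
  rw [← Finset.mul_sum, ← Finset.sum_fiberwise_of_maps_to (g := weight)
    (t := Finset.range (k + 1)) (by intro n hn; grind)]
  congr 1
  refine Finset.sum_congr rfl fun j hj => Finset.sum_congr ?_ fun _ _ => rfl
  ext n
  grind

theorem hasSum_exp_sub_sum_wordSum (c : ℕ → ℂ) (k : ℕ) :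
    HasSum (fun l : ℕ => (1 / (l.factorial : ℂ)) *
        ∑ n ∈ words k l with k < weight n, ∏ i, c (n i))
      (Complex.exp (∑ n ∈ Finset.Icc 3 (k + 2), c n) -
        ∑ j ∈ Finset.range (k + 1), wordSum c k j) := by
  have hlong (l : ℕ) (hl : l ∉ Finset.range (k + 1)) :
      (1 / (l.factorial : ℂ)) * ∑ n ∈ words k l with ¬ k < weight n, ∏ i, c (n i) = 0 := by
    rw [Finset.filter_false_of_mem, Finset.sum_empty, mul_zero]
    intro n hn
    have := length_le_weight hn
    grind
  have hlow := hasSum_sum_of_ne_finset_zero (L := .unconditional ℕ) hlong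
  rw [← sum_wordSum] at hlow
  have hexp := NormedSpace.expSeries_div_hasSum_exp (∑ n ∈ Finset.Icc 3 (k + 2), c n)
  rw [← Complex.exp_eq_exp_ℂ] at hexp
  refine (hexp.sub hlow).congr_fun fun l => ?_
  rw [← sum_words_prod, ← Finset.sum_filter_add_sum_filter_not (words k l) (k < weight ·)]
  ring

theorem norm_exp_sum_sub_sum_wordSum_le (hβ : ∀ n, 0 ≤ β n) (hθ : 0 ≤ θ) (hθ1 : θ ≤ 1)
    (hc : ∀ n ∈ Finset.Icc 3 (k + 2), ‖c n‖ ≤ β n * θ ^ (n - 2)) :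
    ‖Complex.exp (∑ n ∈ Finset.Icc 3 (k + 2), c n) -
        ∑ j ∈ Finset.range (k + 1), wordSum c k j‖ ≤
      θ ^ (k + 1) * Real.exp (∑ n ∈ Finset.Icc 3 (k + 2), β n) := by
  rw [← (hasSum_exp_sub_sum_wordSum c k).tsum_eq]
  have hexp := NormedSpace.expSeries_div_hasSum_exp (∑ n ∈ Finset.Icc 3 (k + 2), β n)
  rw [← Real.exp_eq_exp_ℝ] at hexp
  exact tsum_of_norm_bounded (hexp.mul_left _) fun l =>
    norm_sum_words_le hβ hc l (by positivity) _ fun n hn => pow_le_pow_of_le_one hθ hθ1 hn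

end Words

theorem iteratedDeriv_charFun_gaussianReal_zero (m : ℕ) :
    iteratedDeriv m (charFun (gaussianReal 0 1)) 0 =
      (-1) ^ m * (((Polynomial.hermite m).eval 0 : ℤ) : ℂ) := by
  have hchar : charFun (gaussianReal 0 1) =
      Complex.ofRealCLM ∘ fun t : ℝ => Real.exp (-(t ^ 2 / 2)) := by
    ext t
    simp [charFun_gaussianReal]
  have hsmooth : ContDiffAt ℝ m (fun t : ℝ => Real.exp (-(t ^ 2 / 2))) 0 := by fun_prop
  have hhermite := Polynomial.deriv_gaussian_eq_hermite_mul_gaussian m 0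
  rw [← iteratedDeriv_eq_iterate] at hhermite
  rw [hchar, iteratedDeriv_eq_iteratedFDeriv,
    ContinuousLinearMap.iteratedFDeriv_comp_left _ hsmooth le_rfl,
    ContinuousLinearMap.compContinuousMultilinearMap_coe, Function.comp_apply,
    ← iteratedDeriv_eq_iteratedFDeriv, hhermite]
  simp [Polynomial.aeval_def, Polynomial.eval₂_at_zero, Polynomial.coeff_zero_eq_eval_zero]

theorem integral_I_mul_pow_gaussianReal (m : ℕ) :
    ∫ x : ℝ, (Complex.I * x) ^ m ∂(gaussianReal 0 1) =
      (-1) ^ m * (((Polynomial.hermite m).eval 0 : ℤ) : ℂ) := by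
  have hreal : ∫ x : ℝ, (x : ℂ) ^ m ∂(gaussianReal 0 1) =
      ((∫ x : ℝ, x ^ m ∂(gaussianReal 0 1) : ℝ) : ℂ) := by
    rw [← integral_complex_ofReal]
    simp
  rw [← iteratedDeriv_charFun_gaussianReal_zero,
    iteratedDeriv_charFun_zero (memLp_id_gaussianReal' _ (by simp)), ← hreal]
  simp_rw [mul_pow]
  exact integral_const_mul _ _

theorem integrable_I_mul_pow_gaussianReal (m : ℕ) :
    Integrable (fun x : ℝ => (Complex.I * (x : ℂ)) ^ m) (gaussianReal 0 1) := by
  refine (memLp_id_gaussianReal' (μ := 0) (v := 1) (m : ENNReal)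
    (by simp)).integrable_norm_pow'.mono (by fun_prop) (.of_forall fun x => ?_)
  simp

theorem integrable_gaussianReal_iff {E : Type*} [NormedAddCommGroup E] [NormedSpace ℝ E]
    {f : ℝ → E} {m : ℝ} {v : NNReal} (hv : v ≠ 0) :
    Integrable f (gaussianReal m v) ↔ Integrable (fun x : ℝ => gaussianPDFReal m v x • f x) := by
  rw [gaussianReal_of_var_ne_zero _ hv,
    integrable_withDensity_iff_integrable_smul' (measurable_gaussianPDF _ _)
      (.of_forall fun x => ENNReal.ofReal_lt_top)]
  simp only [toReal_gaussianPDF]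

/-- The Taylor coefficient of order `n` of the cumulant generating function of a variable which
has cumulants `κ_n / ρ ^ (n - 2)` and is then scaled to variance one. -/
noncomputable def scaledCumulant (κ : ℕ → ℝ) (ρ : ℝ) (n : ℕ) : ℝ :=
  κ n / n.factorial / (Real.sqrt (κ 2) ^ n * ρ ^ (n - 2))

/-- The term of order `n` in the Taylor expansion at `0` of the logarithm of the characteristic
function whose cumulants are described in `scaledCumulant`. -/
noncomputable def cumulantTerm (κ : ℕ → ℝ) (ρ x : ℝ) (n : ℕ) : ℂ :=
  (scaledCumulant κ ρ n : ℂ) * (Complex.I * x) ^ n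

/-- The bracket `1 + ∑_j …` in the Edgeworth term, which is its ratio to the value at the mean of
the Gaussian density of variance `κ_2`. -/
noncomputable def edgeworthFactor (κ : ℕ → ℝ) (ρ : ℝ) (k : ℕ) : ℝ :=
  1 + ∑ j ∈ Finset.Icc 1 k, (-1) ^ j / ρ ^ j *
    ∑ l ∈ Finset.Icc 1 j, edgeworthCoeff κ k j l / κ 2 ^ ((j : ℝ) / 2 + l) *
      (((Polynomial.hermite (j + 2 * l)).eval 0 : ℤ) : ℝ)

theorem edgeworthTerm_eq (κ : ℕ → ℝ) (ρ : ℝ) (k : ℕ) :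
    edgeworthTerm κ ρ k =
      1 / (Real.sqrt (κ 2) * Real.sqrt (2 * Real.pi)) * edgeworthFactor κ ρ k := by
  simp [edgeworthTerm, edgeworthFactor, gaussianPDFReal, mul_comm]

theorem edgeworthCoeff_zero_zero (κ : ℕ → ℝ) (k : ℕ) : edgeworthCoeff κ k 0 0 = 1 := by
  simp [edgeworthCoeff]

theorem edgeworthCoeff_zero_right (κ : ℕ → ℝ) (k : ℕ) {j : ℕ} (hj : 0 < j) :
    edgeworthCoeff κ k j 0 = 0 := by
  simp [edgeworthCoeff, hj.ne]

theorem edgeworthCoeff_eq_zero_of_lt (κ : ℕ → ℝ) (k : ℕ) {j l : ℕ} (h : j < l) :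
    edgeworthCoeff κ k j l = 0 := by
  rw [edgeworthCoeff, Finset.filter_false_of_mem, Finset.sum_empty, mul_zero]
  intro n hn
  exact (h.trans_le (length_le_weight hn)).ne'

theorem sum_word_eq_weight_add {k l : ℕ} {n : Fin l → ℕ} (hn : n ∈ words k l) :
    ∑ i, n i = weight n + 2 * l := by
  calc ∑ i, n i = ∑ i, ((n i - 2) + 2) := Finset.sum_congr rfl fun i _ => by
        have := Finset.mem_Icc.1 (Fintype.mem_piFinset.1 hn i)
        omega
    _ = weight n + 2 * l := by simp [Finset.sum_add_distrib, weight, mul_comm]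

theorem prod_cumulantTerm (κ : ℕ → ℝ) (ρ x : ℝ) {k l : ℕ} {n : Fin l → ℕ}
    (hn : n ∈ words k l) :
    ∏ i, cumulantTerm κ ρ x (n i) =
      (((∏ i, κ (n i) / ((n i).factorial : ℝ)) /
        (Real.sqrt (κ 2) ^ (weight n + 2 * l) * ρ ^ weight n) : ℝ) : ℂ) *
        (Complex.I * x) ^ (weight n + 2 * l) := by
  simp only [cumulantTerm, scaledCumulant]
  rw [Finset.prod_mul_distrib, Finset.prod_pow_eq_pow_sum, sum_word_eq_weight_add hn,
    ← Complex.ofReal_prod, Finset.prod_div_distrib, Finset.prod_mul_distrib,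
    Finset.prod_pow_eq_pow_sum, Finset.prod_pow_eq_pow_sum, sum_word_eq_weight_add hn, weight]

theorem wordSum_cumulantTerm (κ : ℕ → ℝ) (ρ x : ℝ) (k j : ℕ) :
    wordSum (cumulantTerm κ ρ x) k j = ∑ l ∈ Finset.range (k + 1),
      ((edgeworthCoeff κ k j l / (Real.sqrt (κ 2) ^ (j + 2 * l) * ρ ^ j) : ℝ) : ℂ) *
        (Complex.I * x) ^ (j + 2 * l) := by
  refine Finset.sum_congr rfl fun l _ => ?_
  have hprod (n : Fin l → ℕ) (hn : n ∈ {n ∈ words k l | weight n = j}) :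
      ∏ i, cumulantTerm κ ρ x (n i) =
        (((∏ i, κ (n i) / ((n i).factorial : ℝ)) /
          (Real.sqrt (κ 2) ^ (j + 2 * l) * ρ ^ j) : ℝ) : ℂ) * (Complex.I * x) ^ (j + 2 * l) := by
    rw [Finset.mem_filter] at hn
    rw [prod_cumulantTerm κ ρ x hn.1, hn.2]
  have hcoeff : edgeworthCoeff κ k j l = 1 / (l.factorial : ℝ) *
      ∑ n ∈ words k l with weight n = j, ∏ i, κ (n i) / ((n i).factorial : ℝ) := rfl
  rw [Finset.sum_congr rfl hprod, ← Finset.sum_mul, ← Complex.ofReal_sum, ← Finset.sum_div,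
    hcoeff, ← mul_assoc]
  congr 1
  push_cast
  ring

theorem integrable_wordSum_cumulantTerm (κ : ℕ → ℝ) (ρ : ℝ) (k j : ℕ) :
    Integrable (fun x => wordSum (cumulantTerm κ ρ x) k j) (gaussianReal 0 1) := by
  simp_rw [wordSum_cumulantTerm]
  exact integrable_finsetSum _ fun l _ => (integrable_I_mul_pow_gaussianReal _).const_mul _

theorem integral_wordSum_cumulantTerm (κ : ℕ → ℝ) (ρ : ℝ) (k j : ℕ) :
    ∫ x, wordSum (cumulantTerm κ ρ x) k j ∂(gaussianReal 0 1) = ((∑ l ∈ Finset.range (k + 1),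
      edgeworthCoeff κ k j l / (Real.sqrt (κ 2) ^ (j + 2 * l) * ρ ^ j) *
        ((-1) ^ j * (((Polynomial.hermite (j + 2 * l)).eval 0 : ℤ) : ℝ)) : ℝ) : ℂ) := by
  simp_rw [wordSum_cumulantTerm]
  rw [integral_finsetSum _ fun l _ => (integrable_I_mul_pow_gaussianReal _).const_mul _]
  push_cast
  refine Finset.sum_congr rfl fun l _ => ?_
  have hsign : (-1 : ℂ) ^ (j + 2 * l) = (-1) ^ j := by rw [pow_add, pow_mul]; simp
  rw [integral_const_mul, integral_I_mul_pow_gaussianReal, hsign]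

theorem integral_wordSum_cumulantTerm_zero (κ : ℕ → ℝ) (ρ : ℝ) (k : ℕ) :
    ∫ x, wordSum (cumulantTerm κ ρ x) k 0 ∂(gaussianReal 0 1) = 1 := by
  rw [integral_wordSum_cumulantTerm, Finset.sum_eq_single 0]
  · simp [edgeworthCoeff_zero_zero]
  · intro l _ hl
    rw [edgeworthCoeff_eq_zero_of_lt κ k (Nat.pos_of_ne_zero hl), zero_div, zero_mul]
  · simp

theorem integral_wordSum_cumulantTerm_of_pos {κ : ℕ → ℝ} (hκ : 0 < κ 2) (ρ : ℝ) {k j : ℕ}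
    (hj : 0 < j) (hjk : j ≤ k) :
    ∫ x, wordSum (cumulantTerm κ ρ x) k j ∂(gaussianReal 0 1) =
      (((-1) ^ j / ρ ^ j *
        ∑ l ∈ Finset.Icc 1 j, edgeworthCoeff κ k j l / κ 2 ^ ((j : ℝ) / 2 + l) *
          (((Polynomial.hermite (j + 2 * l)).eval 0 : ℤ) : ℝ) : ℝ) : ℂ) := by
  rw [integral_wordSum_cumulantTerm]
  congr 1
  rw [Finset.mul_sum, ← Finset.sum_subset (s₁ := Finset.Icc 1 j)]
  · refine Finset.sum_congr rfl fun l _ => ?_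
    have hsqrt : κ 2 ^ ((j : ℝ) / 2 + l) = Real.sqrt (κ 2) ^ (j + 2 * l) := by
      rw [Real.sqrt_eq_rpow, ← Real.rpow_natCast, ← Real.rpow_mul hκ.le]
      congr 1; push_cast; ring
    rw [hsqrt]
    ring
  · intro l hl
    rw [Finset.mem_Icc] at hl
    rw [Finset.mem_range]
    omega
  · intro l _ hl
    rcases Nat.eq_zero_or_pos l with rfl | hl0
    · rw [edgeworthCoeff_zero_right κ k hj, zero_div, zero_mul]
    · rw [Finset.mem_Icc] at hl
      rw [edgeworthCoeff_eq_zero_of_lt κ k (by omega), zero_div, zero_mul]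

theorem ofReal_edgeworthFactor {κ : ℕ → ℝ} (hκ : 0 < κ 2) (ρ : ℝ) (k : ℕ) :
    (edgeworthFactor κ ρ k : ℂ) = 1 + ∑ j ∈ Finset.Icc 1 k,
      ∫ x, wordSum (cumulantTerm κ ρ x) k j ∂(gaussianReal 0 1) := by
  rw [edgeworthFactor, Complex.ofReal_add, Complex.ofReal_one, Complex.ofReal_sum]
  congr 1
  refine Finset.sum_congr rfl fun j hj => ?_
  rw [Finset.mem_Icc] at hj
  rw [integral_wordSum_cumulantTerm_of_pos hκ ρ hj.1 hj.2]

theorem ofReal_edgeworthFactor_eq_integral {κ : ℕ → ℝ} (hκ : 0 < κ 2) (ρ : ℝ) (k : ℕ) :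
    (edgeworthFactor κ ρ k : ℂ) =
      ∫ x, ∑ j ∈ Finset.range (k + 1), wordSum (cumulantTerm κ ρ x) k j ∂(gaussianReal 0 1) := by
  rw [integral_finsetSum _ fun j _ => integrable_wordSum_cumulantTerm κ ρ k j,
    Finset.range_eq_Ico, Finset.sum_eq_sum_Ico_succ_bot k.succ_pos,
    integral_wordSum_cumulantTerm_zero, ofReal_edgeworthFactor hκ]
  rfl

theorem norm_exp_sub_exp_le (a b : ℂ) :
    ‖Complex.exp a - Complex.exp b‖ ≤ ‖a - b‖ * Real.exp (‖b‖ + ‖a - b‖) := by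
  have hexp : ‖Complex.exp (a - b) - 1‖ ≤ ‖a - b‖ * Real.exp ‖a - b‖ := by
    simpa using Complex.norm_exp_sub_sum_le_norm_mul_exp (a - b) 1
  calc ‖Complex.exp a - Complex.exp b‖ = ‖Complex.exp b‖ * ‖Complex.exp (a - b) - 1‖ := by
        rw [← norm_mul, mul_sub, ← Complex.exp_add]; simp
    _ ≤ Real.exp ‖b‖ * (‖a - b‖ * Real.exp ‖a - b‖) := by
        gcongr; exact Complex.norm_exp_le_exp_norm b
    _ = _ := by rw [Real.exp_add]; ring

theorem norm_exp_neg_sq_div_two (x : ℝ) :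
    ‖Complex.exp (-(x : ℂ) ^ 2 / 2)‖ = Real.exp (-x ^ 2 / 2) := by
  rw [Complex.norm_exp]; congr 1; norm_cast

theorem sum_mul_eighth_pow_le (k : ℕ) (x : ℝ) :
    ∑ n ∈ Finset.Icc 3 (k + 2), x ^ 2 * (1 / 8 : ℝ) ^ (n - 2) ≤ x ^ 2 / 7 := by
  have hgeom : ∑ n ∈ Finset.Icc 3 (k + 2), (1 / 8 : ℝ) ^ (n - 2) = 1 / 7 * (1 - (1 / 8) ^ k) := by
    induction k with
    | zero => simp
    | succ k ih =>
      rw [show k + 1 + 2 = (k + 2) + 1 by ring, Finset.sum_Icc_succ_top (by omega), ih,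
        show k + 2 + 1 - 2 = k + 1 by omega]
      ring
  rw [← Finset.mul_sum, hgeom]
  nlinarith [sq_nonneg x, show (0 : ℝ) ≤ x ^ 2 * (1 / 8) ^ k by positivity]

section Edgeworth

variable {κ : ℕ → ℝ} {ρ η : ℝ}

theorem norm_cumulantTerm_le (hκ : ∀ n, 3 ≤ n → |scaledCumulant κ ρ n| ≤ η ^ (n - 2))
    (x : ℝ) (k : ℕ) : ∀ n ∈ Finset.Icc 3 (k + 2),
      ‖cumulantTerm κ ρ x n‖ ≤ (x ^ 2 * (1 / 8) ^ (n - 2)) * (8 * η * |x|) ^ (n - 2) := by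
  intro n hn
  have hn3 := (Finset.mem_Icc.1 hn).1
  calc ‖cumulantTerm κ ρ x n‖ = |scaledCumulant κ ρ n| * |x| ^ n := by simp [cumulantTerm]
    _ ≤ η ^ (n - 2) * |x| ^ n := by gcongr; exact hκ n hn3
    _ = η ^ (n - 2) * |x| ^ ((n - 2) + 2) := by congr 2; omega
    _ = _ := by
      rw [pow_add, sq_abs, mul_assoc (x ^ 2), ← mul_pow,
        show 1 / 8 * (8 * η * |x|) = η * |x| by ring, mul_pow η]
      ring

theorem norm_wordSum_cumulantTerm_le (hη : 0 ≤ η)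
    (hκ : ∀ n, 3 ≤ n → |scaledCumulant κ ρ n| ≤ η ^ (n - 2)) (x : ℝ) (k j : ℕ) :
    ‖wordSum (cumulantTerm κ ρ x) k j‖ ≤ (8 * η * |x|) ^ j * Real.exp (x ^ 2 / 7) := by
  refine (norm_wordSum_le (β := fun n => x ^ 2 * (1 / 8) ^ (n - 2)) (fun n => by positivity)
    (by positivity) (norm_cumulantTerm_le hκ x k) j).trans ?_
  gcongr
  exact sum_mul_eighth_pow_le k x

theorem norm_sum_cumulantTerm_le (hη : 0 ≤ η)
    (hκ : ∀ n, 3 ≤ n → |scaledCumulant κ ρ n| ≤ η ^ (n - 2)) {x : ℝ} (hx : 8 * η * |x| ≤ 1)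
    (k : ℕ) : ‖∑ n ∈ Finset.Icc 3 (k + 2), cumulantTerm κ ρ x n‖ ≤ x ^ 2 / 7 := by
  refine (norm_sum_le_of_le _ (norm_cumulantTerm_le hκ x k)).trans
    (le_trans (Finset.sum_le_sum fun n _ => ?_) (sum_mul_eighth_pow_le k x))
  exact mul_le_of_le_one_right (by positivity) (pow_le_one₀ (by positivity) hx)

theorem norm_exp_sub_exp_le_of_le {g G : ℂ} {x θ : ℝ} {k : ℕ} (hθ : 0 ≤ θ) (hθ1 : θ ≤ 1)
    (hG : ‖G‖ ≤ x ^ 2 / 7) (hg : ‖g - G‖ ≤ x ^ 2 * (θ / 8) ^ (k + 1)) :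
    ‖Complex.exp g - Complex.exp G‖ ≤ 16 * θ ^ (k + 1) * Real.exp (11 / 32 * x ^ 2) := by
  have hpow : ‖g - G‖ ≤ x ^ 2 * θ ^ (k + 1) := hg.trans (by gcongr; linarith)
  have hsmall : ‖g - G‖ ≤ x ^ 2 / 8 := by
    calc ‖g - G‖ ≤ x ^ 2 * (θ / 8) ^ (k + 1) := hg
      _ ≤ x ^ 2 * (θ / 8) := by
        gcongr
        exact pow_le_of_le_one (by positivity) (by linarith) k.succ_ne_zero
      _ ≤ x ^ 2 * (1 / 8) := by gcongr
      _ = x ^ 2 / 8 := by ring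
  have hsq : x ^ 2 ≤ 16 * Real.exp (x ^ 2 / 16) := by
    have := Real.add_one_le_exp (x ^ 2 / 16)
    linarith
  calc ‖Complex.exp g - Complex.exp G‖ ≤ ‖g - G‖ * Real.exp (‖G‖ + ‖g - G‖) :=
        norm_exp_sub_exp_le g G
    _ ≤ (x ^ 2 * θ ^ (k + 1)) * Real.exp (x ^ 2 / 7 + x ^ 2 / 8) := by gcongr
    _ ≤ ((16 * Real.exp (x ^ 2 / 16)) * θ ^ (k + 1)) * Real.exp (x ^ 2 / 7 + x ^ 2 / 8) := by
        gcongr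
    _ = 16 * θ ^ (k + 1) * Real.exp (x ^ 2 / 16 + (x ^ 2 / 7 + x ^ 2 / 8)) := by
        rw [Real.exp_add (x ^ 2 / 16)]; ring
    _ ≤ _ := by
        gcongr
        linarith [sq_nonneg x]

theorem norm_exp_mul_sum_wordSum_le_of_one_le (hη : 0 ≤ η)
    (hκ : ∀ n, 3 ≤ n → |scaledCumulant κ ρ n| ≤ η ^ (n - 2)) {x : ℝ} (hx : 1 ≤ 8 * η * |x|)
    (k : ℕ) :
    ‖Complex.exp (-(x : ℂ) ^ 2 / 2) *
        ∑ j ∈ Finset.range (k + 1), wordSum (cumulantTerm κ ρ x) k j‖ ≤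
      2 ^ k * (8 * η * |x|) ^ (k + 1) * Real.exp (-(5 / 32) * x ^ 2) := by
  have hsum : ‖∑ j ∈ Finset.range (k + 1), wordSum (cumulantTerm κ ρ x) k j‖ ≤
      2 ^ k * ((8 * η * |x|) ^ (k + 1) * Real.exp (x ^ 2 / 7)) := by
    calc _ ≤ ∑ j ∈ Finset.range (k + 1), (8 * η * |x|) ^ (k + 1) * Real.exp (x ^ 2 / 7) := by
          refine norm_sum_le_of_le _ fun j hj =>
            (norm_wordSum_cumulantTerm_le hη hκ x k j).trans ?_
          gcongr
          exact (Finset.mem_range.1 hj).le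
      _ = ((k + 1 : ℕ) : ℝ) * ((8 * η * |x|) ^ (k + 1) * Real.exp (x ^ 2 / 7)) := by
          rw [Finset.sum_const, Finset.card_range, nsmul_eq_mul]
      _ ≤ _ := by
          gcongr
          exact_mod_cast Nat.lt_two_pow_self
  rw [norm_mul, norm_exp_neg_sq_div_two]
  calc _ ≤ Real.exp (-x ^ 2 / 2) * (2 ^ k * ((8 * η * |x|) ^ (k + 1) * Real.exp (x ^ 2 / 7))) := by
        gcongr
    _ = 2 ^ k * (8 * η * |x|) ^ (k + 1) * Real.exp (-x ^ 2 / 2 + x ^ 2 / 7) := by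
        rw [Real.exp_add]; ring
    _ ≤ _ := by
        gcongr
        linarith [sq_nonneg x]

theorem norm_exp_sub_exp_mul_sum_wordSum_le_of_le_one (hη : 0 ≤ η)
    (hκ : ∀ n, 3 ≤ n → |scaledCumulant κ ρ n| ≤ η ^ (n - 2)) {g : ℂ} {x : ℝ}
    (hx : 8 * η * |x| ≤ 1) {k : ℕ}
    (hg : ‖g - ∑ n ∈ Finset.Icc 3 (k + 2), cumulantTerm κ ρ x n‖ ≤
      x ^ 2 * (η * |x|) ^ (k + 1)) :
    ‖Complex.exp (-(x : ℂ) ^ 2 / 2 + g) - Complex.exp (-(x : ℂ) ^ 2 / 2) *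
        ∑ j ∈ Finset.range (k + 1), wordSum (cumulantTerm κ ρ x) k j‖ ≤
      17 * (8 * η * |x|) ^ (k + 1) * Real.exp (-(5 / 32) * x ^ 2) := by
  set θ := 8 * η * |x| with hθ
  set G := ∑ n ∈ Finset.Icc 3 (k + 2), cumulantTerm κ ρ x n
  have hθ0 : 0 ≤ θ := by positivity
  have hword : ‖Complex.exp G - ∑ j ∈ Finset.range (k + 1), wordSum (cumulantTerm κ ρ x) k j‖ ≤
      θ ^ (k + 1) * Real.exp (11 / 32 * x ^ 2) := by
    refine (norm_exp_sum_sub_sum_wordSum_le (β := fun n => x ^ 2 * (1 / 8) ^ (n - 2))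
      (fun n => by positivity) hθ0 hx (norm_cumulantTerm_le hκ x k)).trans ?_
    gcongr
    linarith [sum_mul_eighth_pow_le k x, sq_nonneg x]
  have hexp : ‖Complex.exp g - Complex.exp G‖ ≤
      16 * θ ^ (k + 1) * Real.exp (11 / 32 * x ^ 2) := by
    refine norm_exp_sub_exp_le_of_le hθ0 hx (norm_sum_cumulantTerm_le hη hκ hx k) (hg.trans_eq ?_)
    rw [hθ]
    ring
  calc _ = Real.exp (-x ^ 2 / 2) * ‖(Complex.exp g - Complex.exp G) +
          (Complex.exp G - ∑ j ∈ Finset.range (k + 1), wordSum (cumulantTerm κ ρ x) k j)‖ := by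
        rw [← norm_exp_neg_sq_div_two, ← norm_mul, Complex.exp_add]
        congr 1
        ring
    _ ≤ Real.exp (-x ^ 2 / 2) * (16 * θ ^ (k + 1) * Real.exp (11 / 32 * x ^ 2) +
          θ ^ (k + 1) * Real.exp (11 / 32 * x ^ 2)) := by
        gcongr
        exact norm_add_le_of_le hexp hword
    _ = 17 * θ ^ (k + 1) * Real.exp (-x ^ 2 / 2 + 11 / 32 * x ^ 2) := by
        rw [Real.exp_add]; ring
    _ = _ := by
        congr 2
        ring

theorem norm_exp_sub_exp_mul_sum_wordSum_le (hη : 0 ≤ η)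
    (hκ : ∀ n, 3 ≤ n → |scaledCumulant κ ρ n| ≤ η ^ (n - 2)) {g : ℂ} {x : ℝ} {k : ℕ}
    (hg : ‖g - ∑ n ∈ Finset.Icc 3 (k + 2), cumulantTerm κ ρ x n‖ ≤
      x ^ 2 * (η * |x|) ^ (k + 1)) :
    ‖Complex.exp (-(x : ℂ) ^ 2 / 2 + g) - Complex.exp (-(x : ℂ) ^ 2 / 2) *
        ∑ j ∈ Finset.range (k + 1), wordSum (cumulantTerm κ ρ x) k j‖ ≤
      17 * 2 ^ k * (8 * η * |x|) ^ (k + 1) * Real.exp (-(5 / 32) * x ^ 2) +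
        {x : ℝ | 1 < 8 * η * |x|}.indicator
          (fun _ => ‖Complex.exp (-(x : ℂ) ^ 2 / 2 + g)‖) x := by
  by_cases hx : 1 < 8 * η * |x|
  · rw [indicator_of_mem (show x ∈ {x : ℝ | 1 < 8 * η * |x|} from hx)]
    refine (norm_sub_le _ _).trans ?_
    rw [add_comm]
    gcongr
    refine (norm_exp_mul_sum_wordSum_le_of_one_le hη hκ hx.le k).trans ?_
    gcongr
    exact le_mul_of_one_le_left (by positivity) (by norm_num)
  · rw [indicator_of_notMem (show x ∉ {x : ℝ | 1 < 8 * η * |x|} from hx), add_zero]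
    refine (norm_exp_sub_exp_mul_sum_wordSum_le_of_le_one hη hκ (not_lt.1 hx) hg).trans ?_
    gcongr
    exact le_mul_of_one_le_right (by norm_num) (one_le_pow₀ one_le_two)

end Edgeworth

theorem integrable_exp_mul_sq_gaussianReal {c : ℝ} (hc : c < 1 / 2) :
    Integrable (fun x : ℝ => Real.exp (c * x ^ 2)) (gaussianReal 0 1) := by
  rw [integrable_gaussianReal_iff one_ne_zero]
  refine ((integrable_exp_neg_mul_sq (sub_pos.2 hc)).const_mul (Real.sqrt (2 * Real.pi))⁻¹).congr
    (.of_forall fun x => ?_)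
  simp only [gaussianPDFReal, smul_eq_mul, NNReal.coe_one, mul_one, sub_zero]
  rw [mul_assoc, ← Real.exp_add]
  congr 2
  ring

section Edgeworth

variable {κ : ℕ → ℝ} {ρ η : ℝ}

theorem norm_integral_wordSum_le (hη : 0 ≤ η)
    (hκ : ∀ n, 3 ≤ n → |scaledCumulant κ ρ n| ≤ η ^ (n - 2)) {k j : ℕ} (hj : j ≤ k) :
    ‖∫ x, wordSum (cumulantTerm κ ρ x) k j ∂(gaussianReal 0 1)‖ ≤
      (16 * η * Real.sqrt k) ^ j * ∫ x, Real.exp (3 / 8 * x ^ 2) ∂(gaussianReal 0 1) := by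
  have hconst : ((j : ℝ) / (2 * (1 / 8))) ^ ((j : ℝ) / 2) ≤ (2 * Real.sqrt k) ^ j := by
    calc ((j : ℝ) / (2 * (1 / 8))) ^ ((j : ℝ) / 2)
        ≤ ((2 * Real.sqrt k) ^ 2) ^ ((j : ℝ) / 2) := by
          gcongr
          rw [mul_pow, Real.sq_sqrt (by positivity)]
          have : (j : ℝ) ≤ k := by exact_mod_cast hj
          rw [div_le_iff₀ (by norm_num)]
          linarith
      _ = _ := by
          rw [← Real.rpow_natCast _ 2, ← Real.rpow_mul (by positivity), ← Real.rpow_natCast]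
          congr 1; push_cast; ring
  rw [← integral_const_mul]
  refine norm_integral_le_of_norm_le
    ((integrable_exp_mul_sq_gaussianReal (by norm_num)).const_mul _) (.of_forall fun x => ?_)
  calc _ ≤ (8 * η * |x|) ^ j * Real.exp (x ^ 2 / 7) := norm_wordSum_cumulantTerm_le hη hκ x k j
    _ = (8 * η) ^ j * |x| ^ j * Real.exp (x ^ 2 / 7) := by rw [mul_pow]
    _ ≤ (8 * η) ^ j * ((2 * Real.sqrt k) ^ j * Real.exp (1 / 8 * |x| ^ 2)) *
        Real.exp (x ^ 2 / 7) := by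
        gcongr
        exact (pow_le_rpow_mul_exp_sq (Q := 1 / 8) (by norm_num) j (abs_nonneg x)).trans
          (by gcongr)
    _ = (16 * η * Real.sqrt k) ^ j * Real.exp (1 / 8 * x ^ 2 + x ^ 2 / 7) := by
        rw [Real.exp_add, sq_abs, show 16 * η * Real.sqrt k = 8 * η * (2 * Real.sqrt k) by ring,
          mul_pow (8 * η)]
        ring
    _ ≤ _ := by
        gcongr
        linarith [sq_nonneg x]

theorem exists_abs_edgeworthFactor_sub_one_le :
    ∃ C : ℝ, 0 < C ∧ ∀ (κ : ℕ → ℝ) (ρ η : ℝ), 0 < κ 2 → 0 ≤ η →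
      (∀ n, 3 ≤ n → |scaledCumulant κ ρ n| ≤ η ^ (n - 2)) →
      ∀ k : ℕ, C * η * Real.sqrt k ≤ 1 → |edgeworthFactor κ ρ k - 1| ≤ 1 / 2 := by
  set G := ∫ x, Real.exp (3 / 8 * x ^ 2) ∂(gaussianReal 0 1)
  have hG : 0 < G := integral_exp_pos (integrable_exp_mul_sq_gaussianReal (by norm_num))
  refine ⟨16 * (2 * G + 1), by positivity, fun κ ρ η hκ2 hη hκ k hk => ?_⟩
  set y := 16 * η * Real.sqrt k with hy
  have hy0 : 0 ≤ y := by positivity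
  have hyG : (2 * G + 1) * y ≤ 1 := by rw [hy]; linarith
  have hy1 : y < 1 := by nlinarith [hyG]
  have hfactor : ((edgeworthFactor κ ρ k - 1 : ℝ) : ℂ) = ∑ j ∈ Finset.Icc 1 k,
      ∫ x, wordSum (cumulantTerm κ ρ x) k j ∂(gaussianReal 0 1) := by
    rw [Complex.ofReal_sub, ofReal_edgeworthFactor hκ2, Complex.ofReal_one, add_sub_cancel_left]
  have hgeom : ∑ j ∈ Finset.Icc 1 k, y ^ j ≤ y / (1 - y) := by
    rw [div_eq_mul_inv, ← tsum_geometric_of_lt_one hy0 hy1, ← tsum_mul_left]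
    calc _ = ∑ j ∈ Finset.range k, y * y ^ j := by
          rw [← Finset.Ico_add_one_right_eq_Icc, Finset.sum_Ico_eq_sum_range]
          simp [pow_add]
      _ ≤ _ := ((summable_geometric_of_lt_one hy0 hy1).mul_left y).sum_le_tsum _
          fun i _ => by positivity
  rw [← Real.norm_eq_abs, ← Complex.norm_real, hfactor]
  calc _ ≤ ∑ j ∈ Finset.Icc 1 k, y ^ j * G := norm_sum_le_of_le _ fun j hj =>
        norm_integral_wordSum_le hη hκ (Finset.mem_Icc.1 hj).2
    _ = (∑ j ∈ Finset.Icc 1 k, y ^ j) * G := (Finset.sum_mul ..).symm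
    _ ≤ y / (1 - y) * G := by gcongr
    _ ≤ 1 / 2 := by
        rw [div_mul_eq_mul_div, div_le_iff₀ (by linarith)]
        nlinarith

theorem integrable_exp_mul_sum_wordSum (κ : ℕ → ℝ) (ρ : ℝ) (k : ℕ) :
    Integrable (fun x : ℝ => Complex.exp (-(x : ℂ) ^ 2 / 2) *
      ∑ j ∈ Finset.range (k + 1), wordSum (cumulantTerm κ ρ x) k j) := by
  have hgauss := (integrable_gaussianReal_iff one_ne_zero).1 <|
    integrable_finsetSum (Finset.range (k + 1)) fun j _ => integrable_wordSum_cumulantTerm κ ρ k j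
  refine (hgauss.const_mul (Real.sqrt (2 * Real.pi) : ℂ)).congr (.of_forall fun x => ?_)
  have hpi : (Real.sqrt (2 * Real.pi) : ℂ) ≠ 0 := by
    rw [Complex.ofReal_ne_zero]
    positivity
  simp only [gaussianPDFReal, Complex.real_smul]
  push_cast
  field_simp
  simp [mul_comm]

theorem ofReal_edgeworthFactor_eq_mul_integral (hκ : 0 < κ 2) (ρ : ℝ) (k : ℕ) :
    (edgeworthFactor κ ρ k : ℂ) = ((1 / Real.sqrt (2 * Real.pi) : ℝ) : ℂ) *
      ∫ x : ℝ, Complex.exp (-(x : ℂ) ^ 2 / 2) *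
        ∑ j ∈ Finset.range (k + 1), wordSum (cumulantTerm κ ρ x) k j := by
  rw [ofReal_edgeworthFactor_eq_integral hκ, integral_gaussianReal_eq_integral_smul one_ne_zero,
    ← integral_const_mul]
  refine integral_congr_ae (.of_forall fun x => ?_)
  simp only [Complex.real_smul, gaussianPDFReal]
  push_cast
  simp
  ring

theorem one_div_sqrt_two_pi_le_one : 1 / Real.sqrt (2 * Real.pi) ≤ 1 := by
  rw [div_le_one (by positivity), Real.one_le_sqrt]
  linarith [Real.pi_gt_three]

theorem exists_norm_integral_sub_edgeworthFactor_le :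
    ∃ C D : ℝ, 0 < C ∧ 1 ≤ D ∧ ∀ (κ : ℕ → ℝ) (ρ η : ℝ), 0 < κ 2 → 0 ≤ η →
      (∀ n, 3 ≤ n → |scaledCumulant κ ρ n| ≤ η ^ (n - 2)) → ∀ (k : ℕ) (g : ℝ → ℂ),
      (∀ x : ℝ, ‖g x - ∑ n ∈ Finset.Icc 3 (k + 2), cumulantTerm κ ρ x n‖ ≤
        x ^ 2 * (η * |x|) ^ (k + 1)) →
      Integrable (fun x : ℝ => Complex.exp (-(x : ℂ) ^ 2 / 2 + g x)) →
      ‖((1 / Real.sqrt (2 * Real.pi) : ℝ) : ℂ) *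
          (∫ x : ℝ, Complex.exp (-(x : ℂ) ^ 2 / 2 + g x)) - (edgeworthFactor κ ρ k : ℂ)‖ ≤
        C * D ^ k * (k : ℝ) ^ ((k : ℝ) / 2) * η ^ (k + 1) +
          ∫ x in {x : ℝ | 1 < 8 * η * |x|}, ‖Complex.exp (-(x : ℂ) ^ 2 / 2 + g x)‖ := by
  obtain ⟨C, D, hC, hD, hpow⟩ := exists_pow_add_le_exp_sq (Q := 1 / 32) (by norm_num) 1
  have hgauss : Integrable (fun x : ℝ => Real.exp (-(1 / 8) * x ^ 2)) :=
    integrable_exp_neg_mul_sq (by norm_num)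
  set G := ∫ x : ℝ, Real.exp (-(1 / 8) * x ^ 2)
  have hG : 0 < G := integral_exp_pos hgauss
  refine ⟨17 * 8 * C * G, 16 * D, by positivity, by linarith,
    fun κ ρ η hκ2 hη hκ k g hg hint => ?_⟩
  set K := 17 * 8 * C * (16 * D) ^ k * (k : ℝ) ^ ((k : ℝ) / 2) * η ^ (k + 1) with hK
  have hmain (x : ℝ) : 17 * 2 ^ k * (8 * η * |x|) ^ (k + 1) * Real.exp (-(5 / 32) * x ^ 2) ≤
      K * Real.exp (-(1 / 8) * x ^ 2) := by
    calc _ = 17 * 8 * 16 ^ k * η ^ (k + 1) * |x| ^ (k + 1) * Real.exp (-(5 / 32) * x ^ 2) := by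
          rw [mul_pow, mul_pow, pow_succ 8, show (16 : ℝ) = 2 * 8 by norm_num, mul_pow 2]
          ring
      _ ≤ 17 * 8 * 16 ^ k * η ^ (k + 1) *
          (C * D ^ k * (k : ℝ) ^ ((k : ℝ) / 2) * Real.exp (1 / 32 * |x| ^ 2)) *
          Real.exp (-(5 / 32) * x ^ 2) := by
          gcongr
          exact hpow k |x| (abs_nonneg x)
      _ = K * Real.exp (1 / 32 * x ^ 2 + -(5 / 32) * x ^ 2) := by
          rw [hK, Real.exp_add, sq_abs, mul_pow 16]
          ring
      _ = _ := by congr 2; ring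
  have hmeas : MeasurableSet {x : ℝ | 1 < 8 * η * |x|} :=
    measurableSet_lt measurable_const (by fun_prop)
  have hbound := norm_integral_le_of_norm_le
    ((hgauss.const_mul K).add (hint.norm.indicator hmeas)) (.of_forall fun x =>
      (norm_exp_sub_exp_mul_sum_wordSum_le hη hκ (hg x)).trans (add_le_add_left (hmain x) _))
  rw [integral_add' (hgauss.const_mul _) (hint.norm.indicator hmeas), integral_const_mul,
    integral_indicator hmeas, integral_sub hint (integrable_exp_mul_sum_wordSum κ ρ k)] at hbound
  rw [ofReal_edgeworthFactor_eq_mul_integral hκ2, ← mul_sub, norm_mul, Complex.norm_real,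
    Real.norm_of_nonneg (by positivity)]
  refine (mul_le_of_le_one_left (norm_nonneg _) one_div_sqrt_two_pi_le_one).trans
    (hbound.trans_eq ?_)
  rw [hK]
  ring

end Edgeworth

section Density
open Filter Topology FourierTransform
open scoped NNReal

/-- The Fourier inversion integral of the characteristic function of `μ`, the candidate for the
continuous density of `μ`. It is kept complex valued, so that no real part interferes with the
estimates of the integral. -/
noncomputable def inversionIntegral (μ : Measure ℝ) (x : ℝ) : ℂ :=
  ((1 / (2 * Real.pi) : ℝ) : ℂ) * ∫ t : ℝ, charFun μ t * Complex.exp (-(t * x * Complex.I))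

variable {μ : Measure ℝ}

theorem norm_exp_neg_mul_mul_I (t x : ℝ) : ‖Complex.exp (-(t * x * Complex.I))‖ = 1 := by
  simp [Complex.norm_exp]

theorem integrable_charFun_mul_exp (h : Integrable (charFun μ)) (x : ℝ) :
    Integrable fun t : ℝ => charFun μ t * Complex.exp (-(t * x * Complex.I)) := by
  refine h.mono (h.1.mul (Continuous.aestronglyMeasurable (by fun_prop)))
    (Eventually.of_forall fun t => ?_)
  rw [norm_mul, norm_exp_neg_mul_mul_I, mul_one]

theorem continuous_inversionIntegral (h : Integrable (charFun μ)) :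
    Continuous (inversionIntegral μ) := by
  refine continuous_const.mul (continuous_of_dominated (bound := fun t => ‖charFun μ t‖)
    (fun x => (integrable_charFun_mul_exp h x).1)
    (fun x => Eventually.of_forall fun t => ?_) h.norm
    (Eventually.of_forall fun t => by fun_prop))
  rw [norm_mul, norm_exp_neg_mul_mul_I, mul_one]

theorem inversionIntegral_eq_fourierInv :
    inversionIntegral μ = 𝓕⁻ fun w : ℝ => charFun μ (-(2 * Real.pi) * w) := by
  ext x
  have hscale := Measure.integral_comp_mul_left
    (fun t : ℝ => charFun μ t * Complex.exp (-(t * x * Complex.I))) (-(2 * Real.pi))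
  rw [abs_inv, abs_neg, abs_of_pos (by positivity : (0 : ℝ) < 2 * Real.pi), Complex.real_smul,
    ← one_div] at hscale
  rw [Real.fourierInv_eq', inversionIntegral, ← hscale]
  refine integral_congr_ae (Eventually.of_forall fun w => ?_)
  simp only [smul_eq_mul, mul_comm (Complex.exp _)]
  congr 2
  simp only [RCLike.inner_apply, conj_trivial]
  push_cast
  ring

section Smoothing

variable [IsFiniteMeasure μ]

theorem integrable_prod_exp_mul_gaussian {b : ℝ} (hb : 0 < b) (x : ℝ) :
    Integrable (Function.uncurry fun t z : ℝ =>
      Complex.exp (Complex.I * ((z - x : ℝ) : ℂ) * t) * Complex.exp (-b * (t : ℂ) ^ 2))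
      (volume.prod μ) := by
  refine ((integrable_exp_neg_mul_sq hb).mul_prod (integrable_const (1 : ℝ)) (ν := μ)).mono'
    (Continuous.aestronglyMeasurable (by unfold Function.uncurry; fun_prop))
    (Eventually.of_forall fun p => ?_)
  simp [Function.uncurry, Complex.norm_exp, ← Complex.ofReal_pow]

theorem integral_exp_mul_I_mul_gaussian {v : ℝ≥0} (hv : v ≠ 0) (x z : ℝ) :
    ((1 / (2 * Real.pi) : ℝ) : ℂ) * ∫ t : ℝ, Complex.exp (Complex.I * ((z - x : ℝ) : ℂ) * t) *
      Complex.exp (-((v / 2 : ℝ) : ℂ) * (t : ℂ) ^ 2) = gaussianPDFReal z v x := by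
  have hv' : (0 : ℝ) < v := by positivity
  have hexp : -((z - x : ℝ) : ℂ) ^ 2 / (4 * ((v / 2 : ℝ) : ℂ)) =
      ((-(x - z) ^ 2 / (2 * v) : ℝ) : ℂ) := by
    push_cast; ring
  have hsqrt : (Real.pi / ((v / 2 : ℝ) : ℂ)) ^ (1 / 2 : ℂ) =
      ((2 * Real.pi * (√(2 * Real.pi * v))⁻¹ : ℝ) : ℂ) := by
    have hsq : Real.pi / (v / 2) = (2 * Real.pi * (√(2 * Real.pi * v))⁻¹) ^ 2 := by
      rw [mul_pow, inv_pow, Real.sq_sqrt (by positivity)]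
      field_simp
    rw [← Complex.ofReal_div, show (1 / 2 : ℂ) = ((1 / 2 : ℝ) : ℂ) by push_cast; rfl,
      ← Complex.ofReal_cpow (by positivity), ← Real.sqrt_eq_rpow, hsq,
      Real.sqrt_sq (by positivity)]
  rw [fourierIntegral_gaussian (by simpa using hv'), hexp, hsqrt, gaussianPDFReal,
    ← Complex.ofReal_exp, ← Complex.ofReal_mul, ← Complex.ofReal_mul]
  congr 1
  field_simp

theorem integral_gaussian_mul_charFun {v : ℝ≥0} (hv : v ≠ 0) (x : ℝ) :
    ((1 / (2 * Real.pi) : ℝ) : ℂ) * ∫ t : ℝ, Complex.exp (-((v / 2 : ℝ) : ℂ) * (t : ℂ) ^ 2) *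
      (charFun μ t * Complex.exp (-(t * x * Complex.I))) =
      ((∫ z, gaussianPDFReal z v x ∂μ : ℝ) : ℂ) := by
  have hfubini : ∀ t : ℝ, Complex.exp (-((v / 2 : ℝ) : ℂ) * (t : ℂ) ^ 2) *
      (charFun μ t * Complex.exp (-(t * x * Complex.I))) =
      ∫ z : ℝ, Complex.exp (Complex.I * ((z - x : ℝ) : ℂ) * t) *
        Complex.exp (-((v / 2 : ℝ) : ℂ) * (t : ℂ) ^ 2) ∂μ := by
    intro t
    rw [charFun_apply_real, ← integral_mul_const, ← integral_const_mul]
    congr 1; ext z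
    rw [← Complex.exp_add, ← Complex.exp_add, ← Complex.exp_add]
    congr 1; push_cast; ring
  simp_rw [hfubini]
  rw [integral_integral_swap (integrable_prod_exp_mul_gaussian (by positivity) x),
    ← integral_const_mul, ← integral_complex_ofReal]
  exact integral_congr_ae (Eventually.of_forall fun z => integral_exp_mul_I_mul_gaussian hv x z)

theorem integrable_gaussianPDFReal_mean (v : ℝ≥0) (x : ℝ) :
    Integrable (fun z => gaussianPDFReal z v x) μ := by
  refine Integrable.of_bound (C := (√(2 * Real.pi * v))⁻¹)
    (by unfold gaussianPDFReal; exact Continuous.aestronglyMeasurable (by fun_prop))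
    (Eventually.of_forall fun z => ?_)
  rw [Real.norm_of_nonneg (gaussianPDFReal_nonneg _ _ _), gaussianPDFReal, neg_div]
  exact mul_le_of_le_one_right (by positivity)
    (Real.exp_le_one_iff.2 (neg_nonpos.2 (by positivity)))

theorem ofReal_integral_gaussianPDFReal (v : ℝ≥0) (x : ℝ) :
    ENNReal.ofReal (∫ z, gaussianPDFReal z v x ∂μ) = ∫⁻ z, gaussianPDF z v x ∂μ :=
  ofReal_integral_eq_lintegral_ofReal (integrable_gaussianPDFReal_mean v x)
    (Eventually.of_forall fun z => gaussianPDFReal_nonneg z v x)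

theorem measurable_gaussianPDF_mean_prod (v : ℝ≥0) :
    Measurable fun p : ℝ × ℝ => gaussianPDF p.2 v p.1 :=
  measurable_uncurry_gaussianPDF.comp
    (f := fun p : ℝ × ℝ => (p.2, v, p.1)) (by fun_prop)

theorem lintegral_lintegral_gaussianPDF {v : ℝ≥0} (hv : v ≠ 0) :
    ∫⁻ x, ∫⁻ z, gaussianPDF z v x ∂μ = μ univ := by
  rw [lintegral_lintegral_swap (measurable_gaussianPDF_mean_prod v).aemeasurable]
  simp [lintegral_gaussianPDF_eq_one _ hv]

theorem tendsto_integral_gaussianPDFReal (h : Integrable (charFun μ)) (x : ℝ) :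
    Tendsto (fun n : ℕ => ((∫ z, gaussianPDFReal z (2 / (n + 1)) x ∂μ : ℝ) : ℂ)) atTop
      (𝓝 (inversionIntegral μ x)) := by
  have hlim := (Real.tendsto_integral_cexp_sq_smul (integrable_charFun_mul_exp h x)).comp
    (tendsto_natCast_atTop_atTop.atTop_add (tendsto_const_nhds (x := (1 : ℝ))) :
      Tendsto (fun n : ℕ => (n : ℝ) + 1) atTop atTop)
  refine (hlim.const_mul ((1 / (2 * Real.pi) : ℝ) : ℂ)).congr fun n => ?_
  rw [← integral_gaussian_mul_charFun (by positivity)]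
  simp only [Function.comp_apply]
  congr 2; ext t
  rw [smul_eq_mul, Real.norm_eq_abs, ← Complex.ofReal_pow, sq_abs]
  push_cast
  congr 3
  field_simp

theorem tendsto_integral_gaussianPDFReal_re (h : Integrable (charFun μ)) (x : ℝ) :
    Tendsto (fun n : ℕ => ∫ z, gaussianPDFReal z (2 / (n + 1)) x ∂μ) atTop
      (𝓝 (inversionIntegral μ x).re) := by
  simpa using! (Complex.continuous_re.tendsto _).comp (tendsto_integral_gaussianPDFReal h x)

theorem ofReal_re_inversionIntegral (h : Integrable (charFun μ)) (x : ℝ) :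
    ((inversionIntegral μ x).re : ℂ) = inversionIntegral μ x :=
  tendsto_nhds_unique
    ((Complex.continuous_ofReal.tendsto _).comp (tendsto_integral_gaussianPDFReal_re h x))
    (tendsto_integral_gaussianPDFReal h x)

theorem re_inversionIntegral_nonneg (h : Integrable (charFun μ)) (x : ℝ) :
    0 ≤ (inversionIntegral μ x).re :=
  ge_of_tendsto' (tendsto_integral_gaussianPDFReal_re h x) fun _ =>
    integral_nonneg fun _ => gaussianPDFReal_nonneg _ _ _

theorem lintegral_re_inversionIntegral_le (h : Integrable (charFun μ)) :
    ∫⁻ x, ENNReal.ofReal (inversionIntegral μ x).re ≤ μ univ :=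
  calc ∫⁻ x, ENNReal.ofReal (inversionIntegral μ x).re
      = ∫⁻ x, liminf (fun n : ℕ => ∫⁻ z, gaussianPDF z (2 / (n + 1)) x ∂μ) atTop := by
        refine lintegral_congr fun x => ?_
        simp_rw [← ofReal_integral_gaussianPDFReal]
        exact (((ENNReal.continuous_ofReal.tendsto _).comp
          (tendsto_integral_gaussianPDFReal_re h x)).liminf_eq).symm
    _ ≤ liminf (fun n : ℕ => ∫⁻ x, ∫⁻ z, gaussianPDF z (2 / (n + 1)) x ∂μ) atTop :=
        lintegral_liminf_le fun n =>
          (measurable_gaussianPDF_mean_prod _).lintegral_prod_right'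
    _ = μ univ := by
        simp_rw [fun n : ℕ => lintegral_lintegral_gaussianPDF (μ := μ)
          (v := 2 / (n + 1)) (by positivity), liminf_const]

theorem integrable_inversionIntegral (h : Integrable (charFun μ)) :
    Integrable (inversionIntegral μ) := by
  refine ⟨(continuous_inversionIntegral h).aestronglyMeasurable, ?_⟩
  rw [hasFiniteIntegral_iff_norm]
  refine (lintegral_congr fun x => ?_).trans_lt
    ((lintegral_re_inversionIntegral_le h).trans_lt (measure_lt_top μ univ))
  rw [← ofReal_re_inversionIntegral h x, Complex.norm_real, Complex.ofReal_re,
    Real.norm_of_nonneg (re_inversionIntegral_nonneg h x)]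

theorem fourier_inversionIntegral (h : Integrable (charFun μ)) :
    𝓕 (inversionIntegral μ) = fun w : ℝ => charFun μ (-(2 * Real.pi) * w) := by
  rw [inversionIntegral_eq_fourierInv]
  refine Continuous.fourier_fourierInv_eq (continuous_charFun.comp (by fun_prop))
    (h.comp_mul_left' (by simp [Real.pi_ne_zero])) ?_
  have hneg : (𝓕 fun w : ℝ => charFun μ (-(2 * Real.pi) * w)) =
      fun x => inversionIntegral μ (-x) := by
    ext x
    rw [inversionIntegral_eq_fourierInv, Real.fourierInv_eq_fourier_neg, neg_neg]
  rw [hneg]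
  exact (integrable_inversionIntegral h).comp_neg

theorem eq_withDensity_inversionIntegral (h : Integrable (charFun μ)) :
    μ = volume.withDensity fun x => ENNReal.ofReal (inversionIntegral μ x).re := by
  have : IsFiniteMeasure
      (volume.withDensity fun x => ENNReal.ofReal (inversionIntegral μ x).re) :=
    isFiniteMeasure_withDensity
      ((lintegral_re_inversionIntegral_le h).trans_lt (measure_lt_top μ univ)).ne
  have hmeas : Measurable fun x => ENNReal.ofReal (inversionIntegral μ x).re :=
    (Complex.measurable_re.comp (continuous_inversionIntegral h).measurable).ennreal_ofReal
  refine Measure.ext_of_charFun (funext fun t => ?_)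
  have hinv := congrFun (fourier_inversionIntegral h) (-(2 * Real.pi)⁻¹ * t)
  rw [show -(2 * Real.pi) * (-(2 * Real.pi)⁻¹ * t) = t by field_simp] at hinv
  rw [← hinv, charFun_apply_real, integral_withDensity_eq_integral_toReal_smul hmeas
    (Eventually.of_forall fun x => ENNReal.ofReal_lt_top), Real.fourier_eq']
  refine integral_congr_ae (Eventually.of_forall fun x => ?_)
  simp only [ENNReal.toReal_ofReal (re_inversionIntegral_nonneg h x), Complex.real_smul,
    ofReal_re_inversionIntegral h x, smul_eq_mul, mul_comm (Complex.exp _)]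
  congr 2
  simp only [RCLike.inner_apply, conj_trivial]
  push_cast
  field_simp

theorem exists_continuous_density (h : Integrable (charFun μ)) :
    ∃ f : ℝ → ℝ, Continuous f ∧ (∀ x, 0 ≤ f x) ∧
      μ = volume.withDensity (fun x => ENNReal.ofReal (f x)) ∧
      ∀ x : ℝ, (f x : ℂ) = inversionIntegral μ x :=
  ⟨fun x => (inversionIntegral μ x).re,
    Complex.continuous_re.comp (continuous_inversionIntegral h),
    re_inversionIntegral_nonneg h, eq_withDensity_inversionIntegral h,
    ofReal_re_inversionIntegral h⟩

end Smoothing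

end Density

/-- The probability measure with density `(2 - α) u ^ (1 - α)` on `(0, 1]`, for `α < 2`: the law in
which the coefficients `κ̃_n` are moments. -/
noncomputable def powerLaw (α : ℝ) : Measure ℝ :=
  (volume.restrict (Ioc 0 1)).withDensity (fun u => ENNReal.ofReal ((2 - α) * u ^ (1 - α)))

section PowerLaw

variable {α : ℝ} {E : Type*} [NormedAddCommGroup E]

theorem measurable_powerLaw_density :
    Measurable fun u : ℝ => ENNReal.ofReal ((2 - α) * u ^ (1 - α)) := by fun_prop

theorem integral_powerLaw [NormedSpace ℝ E] (hα : α ≤ 2) (f : ℝ → E) :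
    ∫ u, f u ∂(powerLaw α) = ∫ u in Ioc (0 : ℝ) 1, ((2 - α) * u ^ (1 - α)) • f u := by
  rw [powerLaw, integral_withDensity_eq_integral_toReal_smul measurable_powerLaw_density
    (Filter.Eventually.of_forall fun x => ENNReal.ofReal_lt_top)]
  refine setIntegral_congr_fun measurableSet_Ioc fun u hu => ?_
  rw [ENNReal.toReal_ofReal (mul_nonneg (by linarith) (Real.rpow_nonneg hu.1.le _))]

theorem integrable_powerLaw_iff [NormedSpace ℝ E] (hα : α ≤ 2) (f : ℝ → E) :
    Integrable f (powerLaw α) ↔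
      IntegrableOn (fun u => ((2 - α) * u ^ (1 - α)) • f u) (Ioc (0 : ℝ) 1) := by
  rw [powerLaw, integrable_withDensity_iff_integrable_smul' measurable_powerLaw_density
    (Filter.Eventually.of_forall fun x => ENNReal.ofReal_lt_top)]
  refine integrable_congr ?_
  filter_upwards [ae_restrict_mem measurableSet_Ioc] with u hu
  rw [ENNReal.toReal_ofReal (mul_nonneg (by linarith) (Real.rpow_nonneg hu.1.le _))]

theorem ae_powerLaw : ∀ᵐ u ∂(powerLaw α), u ∈ Ioc (0 : ℝ) 1 :=
  (withDensity_absolutelyContinuous _ _).ae_le (ae_restrict_mem measurableSet_Ioc)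

theorem integrableOn_rpow_Ioc {s h : ℝ} (hs : -1 < s) :
    IntegrableOn (fun u : ℝ => u ^ s) (Ioc 0 h) := by
  rcases le_total 0 h with hh | hh
  · exact (intervalIntegrable_iff_integrableOn_Ioc_of_le hh).1
      (intervalIntegral.intervalIntegrable_rpow' hs)
  · rw [Ioc_eq_empty (by linarith)]; simp

theorem powerLaw_Ioc (hα : α < 2) {h : ℝ} (h0 : 0 ≤ h) (h1 : h ≤ 1) :
    powerLaw α (Ioc 0 h) = ENNReal.ofReal (h ^ (2 - α)) := by
  rw [powerLaw, withDensity_apply _ measurableSet_Ioc, Measure.restrict_restrict measurableSet_Ioc,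
    Ioc_inter_Ioc, max_self, min_eq_left h1, ← ofReal_integral_eq_lintegral_ofReal]
  · rw [integral_const_mul, ← intervalIntegral.integral_of_le h0,
      integral_rpow (Or.inl (by linarith)), Real.zero_rpow (by linarith),
      show 1 - α + 1 = 2 - α by ring]
    congr 1
    field_simp [show 2 - α ≠ 0 by linarith]
    simp
  · exact (integrableOn_rpow_Ioc (by linarith)).const_mul _
  · filter_upwards [ae_restrict_mem measurableSet_Ioc] with u hu
    exact mul_nonneg (by linarith) (Real.rpow_nonneg hu.1.le _)

theorem isProbabilityMeasure_powerLaw (hα : α < 2) : IsProbabilityMeasure (powerLaw α) := by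
  constructor
  have h := powerLaw_Ioc hα zero_le_one le_rfl
  rw [Real.one_rpow, ENNReal.ofReal_one] at h
  rw [← h]
  refine (measure_eq_measure_of_null_sdiff (subset_univ _) ?_).symm
  have := ae_powerLaw (α := α)
  rw [ae_iff] at this
  rwa [← compl_eq_univ_sdiff]

theorem integrable_of_bound_Ioc (hα : α < 2) {f : ℝ → E}
    (hf : AEStronglyMeasurable f (powerLaw α)) (C : ℝ) (hC : ∀ u ∈ Ioc (0 : ℝ) 1, ‖f u‖ ≤ C) :
    Integrable f (powerLaw α) := by
  have := isProbabilityMeasure_powerLaw hα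
  exact Integrable.of_bound hf C (ae_powerLaw.mono hC)

theorem integrable_inv_powerLaw (hα : α < 1) : Integrable (fun u : ℝ => u⁻¹) (powerLaw α) := by
  rw [integrable_powerLaw_iff (by linarith)]
  refine IntegrableOn.congr_fun
    ((integrableOn_rpow_Ioc (s := -α) (h := 1) (by linarith)).const_mul (2 - α))
    (fun u hu => ?_) measurableSet_Ioc
  simp only [smul_eq_mul]
  rw [show -α = 1 - α - 1 by ring, Real.rpow_sub_one hu.1.ne']
  ring_nf

/-- The moments `∫ u ^ n exp (b u)` of the exponentially tilted, but not renormalised, power law. -/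
noncomputable def powerMoment (α : ℝ) (n : ℕ) (b : ℝ) : ℝ :=
  ∫ u, u ^ n * Real.exp (b * u) ∂(powerLaw α)

theorem exp_mul_le {b u : ℝ} (hu : u ∈ Ioc (0 : ℝ) 1) : Real.exp (b * u) ≤ Real.exp |b| := by
  gcongr
  calc b * u ≤ |b| * u := mul_le_mul_of_nonneg_right (le_abs_self b) hu.1.le
    _ ≤ |b| := mul_le_of_le_one_right (abs_nonneg b) hu.2

theorem integrable_pow_mul_exp (hα : α < 2) (n : ℕ) (b : ℝ) :
    Integrable (fun u : ℝ => u ^ n * Real.exp (b * u)) (powerLaw α) := by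
  refine integrable_of_bound_Ioc hα (Continuous.aestronglyMeasurable (by fun_prop)) (Real.exp |b|)
    fun u hu => ?_
  have h0 := hu.1.le
  rw [Real.norm_of_nonneg (by positivity)]
  calc _ ≤ 1 * Real.exp |b| := by
        gcongr
        · exact pow_le_one₀ hu.1.le hu.2
        · exact Real.exp_le_exp.1 (exp_mul_le hu)
    _ = _ := one_mul _

theorem powerMoment_nonneg (n : ℕ) (b : ℝ) : 0 ≤ powerMoment α n b := by
  refine integral_nonneg_of_ae (ae_powerLaw.mono fun u hu => ?_)
  have := hu.1.le
  simp only [Pi.zero_apply]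
  positivity

theorem powerMoment_le (hα : α < 2) (n : ℕ) (b : ℝ) : powerMoment α n b ≤ powerMoment α 0 b := by
  refine integral_mono_ae (integrable_pow_mul_exp hα n b) (integrable_pow_mul_exp hα 0 b)
    (ae_powerLaw.mono fun u hu => ?_)
  simp only [pow_zero]
  gcongr
  exact pow_le_one₀ hu.1.le hu.2

theorem powerMoment_zero_mono (hα : α < 2) {b b' : ℝ} (h : b ≤ b') :
    powerMoment α 0 b ≤ powerMoment α 0 b' := by
  refine integral_mono_ae (integrable_pow_mul_exp hα 0 b) (integrable_pow_mul_exp hα 0 b')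
    (ae_powerLaw.mono fun u hu => ?_)
  simp only [pow_zero, one_mul]
  have := hu.1.le
  gcongr

theorem powerMoment_zero_zero (hα : α < 2) : powerMoment α 0 0 = 1 := by
  have := isProbabilityMeasure_powerLaw hα
  simp [powerMoment]

theorem powerMoment_zero_le_exp (hα : α < 2) {b : ℝ} (hb : 0 ≤ b) :
    powerMoment α 0 b ≤ Real.exp b := by
  have := isProbabilityMeasure_powerLaw hα
  calc powerMoment α 0 b ≤ ∫ _, Real.exp b ∂(powerLaw α) := by
        refine integral_mono_ae (integrable_pow_mul_exp hα 0 b) (integrable_const _)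
          (ae_powerLaw.mono fun u hu => ?_)
        have := exp_mul_le (b := b) hu
        rw [abs_of_nonneg hb] at this
        simpa using this
    _ = _ := by simp

theorem powerMoment_zero_pos (hα : α < 2) (b : ℝ) : 0 < powerMoment α 0 b := by
  have := isProbabilityMeasure_powerLaw hα
  have h := integrable_pow_mul_exp hα 0 b
  simp only [pow_zero, one_mul] at h
  simp only [powerMoment, pow_zero, one_mul]
  exact integral_exp_pos h

theorem le_powerMoment_zero_neg (hα : α < 2) {a : ℝ} (ha : 0 ≤ a) :
    Real.exp (-1) * (1 + a) ^ (-(2 - α)) ≤ powerMoment α 0 (-a) := by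
  have := isProbabilityMeasure_powerLaw hα
  have hmass : (powerLaw α).real (Ioc 0 (1 + a)⁻¹) = (1 + a) ^ (-(2 - α)) := by
    rw [Measure.real, powerLaw_Ioc hα (by positivity) (inv_le_one_of_one_le₀ (by linarith)),
      ENNReal.toReal_ofReal (by positivity), Real.inv_rpow (by positivity),
      Real.rpow_neg (by positivity)]
  have hexp : ∀ u ∈ Ioc 0 (1 + a)⁻¹, Real.exp (-1) ≤ u ^ 0 * Real.exp (-a * u) := by
    intro u hu
    have hau : a * u ≤ 1 := by
      calc a * u ≤ a * (1 + a)⁻¹ := by gcongr; exact hu.2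
        _ ≤ 1 := by rw [← div_eq_mul_inv, div_le_one (by positivity)]; linarith
    rw [pow_zero, one_mul]
    gcongr
    linarith
  calc Real.exp (-1) * (1 + a) ^ (-(2 - α))
      ≤ ∫ u in Ioc 0 (1 + a)⁻¹, u ^ 0 * Real.exp (-a * u) ∂(powerLaw α) := by
        rw [← hmass]
        exact setIntegral_ge_of_const_le_real measurableSet_Ioc (measure_ne_top _ _) hexp
          (integrable_pow_mul_exp hα 0 (-a)).integrableOn
    _ ≤ powerMoment α 0 (-a) := by
        refine setIntegral_le_integral (integrable_pow_mul_exp hα 0 (-a))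
          (Filter.Eventually.of_forall fun u => ?_)
        simp only [Pi.zero_apply, pow_zero, one_mul]
        positivity

theorem powerMoment_zero_neg_le (hα : α < 2) {c : ℝ} (hc : 0 < c) :
    powerMoment α 0 (-c) ≤ (2 - α) * Real.Gamma (2 - α) * c ^ (-(2 - α)) := by
  have hint : IntegrableOn (fun u : ℝ => u ^ (2 - α - 1) * Real.exp (-(c * u))) (Ioi 0) := by
    refine (integrableOn_rpow_mul_exp_neg_mul_rpow (p := 1) (s := 2 - α - 1) (b := c)
      (by linarith) one_pos hc).congr_fun (fun u _ => ?_) measurableSet_Ioi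
    simp
  rw [powerMoment, integral_powerLaw hα.le]
  calc ∫ u in Ioc (0 : ℝ) 1, ((2 - α) * u ^ (1 - α)) • (u ^ 0 * Real.exp (-c * u))
      = (2 - α) * ∫ u in Ioc (0 : ℝ) 1, u ^ (2 - α - 1) * Real.exp (-(c * u)) := by
        rw [← integral_const_mul]
        refine setIntegral_congr_fun measurableSet_Ioc fun u _ => ?_
        simp only [smul_eq_mul, pow_zero, one_mul]
        rw [show 2 - α - 1 = 1 - α by ring, mul_assoc, neg_mul]
    _ ≤ (2 - α) * ∫ u in Ioi (0 : ℝ), u ^ (2 - α - 1) * Real.exp (-(c * u)) := by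
        refine mul_le_mul_of_nonneg_left (setIntegral_mono_set hint ?_
          Ioc_subset_Ioi_self.eventuallyLE) (by linarith)
        filter_upwards [ae_restrict_mem measurableSet_Ioi] with u hu
        exact mul_nonneg (Real.rpow_nonneg (le_of_lt hu) _) (Real.exp_pos _).le
    _ = (2 - α) * Real.Gamma (2 - α) * c ^ (-(2 - α)) := by
        rw [Real.integral_rpow_mul_exp_neg_mul_Ioi (by linarith) hc, one_div, Real.inv_rpow hc.le,
          ← Real.rpow_neg hc.le]
        ring

theorem pow_mul_exp_neg_le {a u : ℝ} (ha : 0 ≤ a) (hu : u ∈ Icc (0 : ℝ) 1) (n : ℕ) :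
    u ^ n * Real.exp (-a * u) ≤
      Real.exp 1 * n.factorial * (2 / (1 + a)) ^ n * Real.exp (-((1 + a) / 2) * u) := by
  have hu0 := hu.1
  have hpow : u ^ n ≤ n.factorial * (2 / (1 + a)) ^ n * Real.exp ((1 + a) / 2 * u) := by
    have hfac := Real.pow_div_factorial_le_exp ((1 + a) / 2 * u) (by positivity) n
    rw [div_le_iff₀ (by positivity)] at hfac
    calc u ^ n = (2 / (1 + a)) ^ n * ((1 + a) / 2 * u) ^ n := by
          rw [← mul_pow]; congr 1; field_simp
      _ ≤ (2 / (1 + a)) ^ n * (Real.exp ((1 + a) / 2 * u) * n.factorial) := by gcongr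
      _ = _ := by ring
  calc u ^ n * Real.exp (-a * u)
      ≤ n.factorial * (2 / (1 + a)) ^ n * Real.exp ((1 + a) / 2 * u) * Real.exp (-a * u) := by
        gcongr
    _ = n.factorial * (2 / (1 + a)) ^ n * Real.exp (u - (1 + a) / 2 * u) := by
        rw [mul_assoc, ← Real.exp_add]; ring_nf
    _ ≤ n.factorial * (2 / (1 + a)) ^ n * Real.exp (1 - (1 + a) / 2 * u) := by
        gcongr; exact hu.2
    _ = _ := by rw [sub_eq_add_neg, Real.exp_add, neg_mul]; ring

theorem powerMoment_neg_le (hα : α < 2) (n : ℕ) {a : ℝ} (ha : 0 ≤ a) :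
    powerMoment α n (-a) ≤ Real.exp 1 * n.factorial * (2 / (1 + a)) ^ n *
      powerMoment α 0 (-((1 + a) / 2)) := by
  rw [powerMoment, powerMoment, ← integral_const_mul]
  refine integral_mono_ae (integrable_pow_mul_exp hα n (-a))
    ((integrable_pow_mul_exp hα 0 _).const_mul _) (ae_powerLaw.mono fun u hu => ?_)
  simpa only [pow_zero, one_mul] using pow_mul_exp_neg_le ha ⟨hu.1.le, hu.2⟩ n

theorem exists_powerMoment_neg_le (hα : α < 2) :
    ∃ C : ℝ, 1 ≤ C ∧ ∀ (n : ℕ) (a : ℝ), 0 ≤ a →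
      powerMoment α n (-a) ≤ C * n.factorial * (2 / (1 + a)) ^ n * (1 + a) ^ (-(2 - α)) := by
  set G := Real.exp 1 * ((2 - α) * Real.Gamma (2 - α) * 2 ^ (2 - α))
  refine ⟨max 1 G, le_max_left _ _, fun n a ha => ?_⟩
  calc powerMoment α n (-a)
      ≤ Real.exp 1 * n.factorial * (2 / (1 + a)) ^ n *
          ((2 - α) * Real.Gamma (2 - α) * ((1 + a) / 2) ^ (-(2 - α))) := by
        refine (powerMoment_neg_le hα n ha).trans ?_
        gcongr
        exact powerMoment_zero_neg_le hα (by positivity)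
    _ = G * n.factorial * (2 / (1 + a)) ^ n * (1 + a) ^ (-(2 - α)) := by
        rw [Real.div_rpow (by positivity) zero_le_two, Real.rpow_neg zero_le_two, div_inv_eq_mul]
        ring
    _ ≤ _ := by gcongr; exact le_max_right _ _

end PowerLaw

section Oscillation

theorem exists_abs_sin_le {v₀ : ℝ} (hv₀ : 0 < v₀) :
    ∃ c : ℝ, 0 < c ∧ ∀ v, v₀ ≤ v → c ≤ 1 - |Real.sin v| / v := by
  have hcont : ContinuousOn (fun v : ℝ => 1 - |Real.sin v| / v) (Icc v₀ (v₀ + 2)) := by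
    refine continuousOn_const.sub (ContinuousOn.div (by fun_prop) continuousOn_id fun x hx => ?_)
    exact (lt_of_lt_of_le hv₀ hx.1).ne'
  obtain ⟨w, hw, hmin⟩ := isCompact_Icc.exists_isMinOn (nonempty_Icc.2 (by linarith)) hcont
  have hw0 : 0 < w := lt_of_lt_of_le hv₀ hw.1
  have hpos : 0 < 1 - |Real.sin w| / w := by
    rw [sub_pos, div_lt_one hw0]
    simpa [abs_of_pos hw0] using Real.abs_sin_lt_abs hw0.ne'
  refine ⟨min (1 - |Real.sin w| / w) (1 / 2), lt_min hpos (by norm_num), fun v hv => ?_⟩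
  rcases le_total v (v₀ + 2) with hle | hge
  · exact (min_le_left _ _).trans (hmin ⟨hv, hle⟩)
  · refine (min_le_right _ _).trans ?_
    have hv0 : 0 < v := by linarith
    have hhalf : |Real.sin v| / v ≤ 1 / 2 := by
      rw [div_le_div_iff₀ hv0 (by norm_num)]
      linarith [Real.abs_sin_le_one v]
    linarith

theorem integral_one_sub_cos {t : ℝ} (ht : t ≠ 0) :
    ∫ u in (1 / 2 : ℝ)..1, (1 - Real.cos (t * u)) =
      1 / 2 - t⁻¹ * (2 * Real.sin (t / 4) * Real.cos (3 * t / 4)) := by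
  have hsin : Real.sin t - Real.sin (t / 2) = 2 * Real.sin (t / 4) * Real.cos (3 * t / 4) := by
    rw [Real.sin_sub_sin]; congr 2 <;> ring_nf
  rw [intervalIntegral.integral_sub (by simp) (Continuous.intervalIntegrable (by fun_prop) _ _),
    intervalIntegral.integral_comp_mul_left (fun x => Real.cos x) ht, integral_cos,
    ← hsin, intervalIntegral.integral_const, smul_eq_mul, smul_eq_mul, mul_one, mul_one,
    mul_one_div]
  norm_num

theorem exists_le_integral_one_sub_cos {c₀ : ℝ} (hc₀ : 0 < c₀) :
    ∃ c : ℝ, 0 < c ∧ ∀ t : ℝ, c₀ ≤ |t| → c ≤ ∫ u in (1 / 2 : ℝ)..1, (1 - Real.cos (t * u)) := by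
  obtain ⟨c, hc, hsinc⟩ := exists_abs_sin_le (v₀ := c₀ / 4) (by positivity)
  refine ⟨c / 2, by positivity, fun t ht => ?_⟩
  wlog hsign : 0 ≤ t generalizing t
  · simpa using this (-t) (by rwa [abs_neg]) (by linarith)
  rw [abs_of_nonneg hsign] at ht
  have ht0 : 0 < t := by linarith
  have hquot : t⁻¹ * (2 * Real.sin (t / 4) * Real.cos (3 * t / 4)) ≤
      |Real.sin (t / 4)| / (t / 4) / 2 := by
    calc t⁻¹ * (2 * Real.sin (t / 4) * Real.cos (3 * t / 4))
        ≤ t⁻¹ * |2 * Real.sin (t / 4) * Real.cos (3 * t / 4)| := by gcongr; exact le_abs_self _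
      _ = t⁻¹ * (2 * |Real.sin (t / 4)| * |Real.cos (3 * t / 4)|) := by
          rw [abs_mul, abs_mul, abs_two]
      _ ≤ t⁻¹ * (2 * |Real.sin (t / 4)| * 1) := by gcongr; exact Real.abs_cos_le_one _
      _ = |Real.sin (t / 4)| / (t / 4) / 2 := by field_simp; ring
  rw [integral_one_sub_cos ht0.ne']
  linarith [hsinc (t / 4) (by linarith)]

end Oscillation

section Decay

variable {α : ℝ}

/-- Minus the real part of the centred cumulant exponent of the tilted law at the frequency `t`:
the characteristic function of that law decays like `exp (-ρ² decayRate)`. -/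
noncomputable def decayRate (α b t : ℝ) : ℝ :=
  ∫ u, (1 - Real.cos (t * u)) / u ^ 2 * Real.exp (b * u) ∂(powerLaw α)

theorem decayRate_integrand_nonneg (b t u : ℝ) :
    0 ≤ (1 - Real.cos (t * u)) / u ^ 2 * Real.exp (b * u) :=
  mul_nonneg (div_nonneg (sub_nonneg.2 (Real.cos_le_one _)) (sq_nonneg u)) (Real.exp_pos _).le

theorem decayRate_nonneg (b t : ℝ) : 0 ≤ decayRate α b t :=
  integral_nonneg fun u => decayRate_integrand_nonneg b t u

theorem integrable_decayRate (hα : α < 2) (b t : ℝ) :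
    Integrable (fun u : ℝ => (1 - Real.cos (t * u)) / u ^ 2 * Real.exp (b * u)) (powerLaw α) := by
  refine integrable_of_bound_Ioc hα (Measurable.aestronglyMeasurable (by fun_prop))
    (t ^ 2 / 2 * Real.exp |b|) fun u hu => ?_
  rw [Real.norm_of_nonneg (decayRate_integrand_nonneg b t u)]
  refine mul_le_mul ?_ (exp_mul_le hu) (Real.exp_pos _).le (by positivity)
  rw [div_le_iff₀ (pow_pos hu.1 2)]
  linarith [Real.one_sub_sq_div_two_le_cos (x := t * u)]

theorem two_div_pi_sq_mul_sq_le_one_sub_cos_div {t u : ℝ} (hu : u ≠ 0) (h : |t * u| ≤ Real.pi) :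
    2 / Real.pi ^ 2 * t ^ 2 ≤ (1 - Real.cos (t * u)) / u ^ 2 := by
  rw [le_div_iff₀ (by positivity)]
  linarith [Real.cos_le_one_sub_mul_cos_sq h]

theorem exists_rpow_le_decayRate (hα : α < 2) {c₁ : ℝ} (hc₁ : 0 < c₁) (hc₁' : c₁ ≤ 1) :
    ∃ c : ℝ, 0 < c ∧ ∀ b t : ℝ, c₁ * (1 + max (-b) 0) ≤ |t| → c * |t| ^ α ≤ decayRate α b t := by
  have := isProbabilityMeasure_powerLaw hα
  refine ⟨2 / Real.pi ^ 2 * Real.exp (-1) * c₁ ^ (2 - α), by positivity, fun b t ht => ?_⟩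
  set a := max (-b) 0
  have ha0 : 0 ≤ a := le_max_right _ _
  have hba : -b ≤ a := le_max_left _ _
  have ht0 : 0 < |t| := lt_of_lt_of_le (by positivity) ht
  have hle1 : c₁ / |t| ≤ 1 := by
    rw [div_le_one ht0]; nlinarith
  have hmass : (powerLaw α).real (Ioc 0 (c₁ / |t|)) = (c₁ / |t|) ^ (2 - α) := by
    rw [Measure.real, powerLaw_Ioc hα (by positivity) hle1, ENNReal.toReal_ofReal (by positivity)]
  have hintegrand : ∀ u ∈ Ioc 0 (c₁ / |t|), 2 / Real.pi ^ 2 * t ^ 2 * Real.exp (-1) ≤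
      (1 - Real.cos (t * u)) / u ^ 2 * Real.exp (b * u) := by
    rintro u ⟨hu0, hu⟩
    have htu : |t| * u ≤ c₁ := by rwa [le_div_iff₀ ht0, mul_comm] at hu
    have hau : (1 + a) * u ≤ 1 := by
      have : c₁ * ((1 + a) * u) ≤ c₁ * 1 := by nlinarith
      exact le_of_mul_le_mul_left this hc₁
    gcongr
    · exact div_nonneg (sub_nonneg.2 (Real.cos_le_one _)) (sq_nonneg u)
    · refine two_div_pi_sq_mul_sq_le_one_sub_cos_div hu0.ne' ?_
      rw [abs_mul, abs_of_pos hu0]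
      linarith [Real.pi_gt_three]
    · nlinarith
  calc 2 / Real.pi ^ 2 * Real.exp (-1) * c₁ ^ (2 - α) * |t| ^ α
      = 2 / Real.pi ^ 2 * t ^ 2 * Real.exp (-1) * (powerLaw α).real (Ioc 0 (c₁ / |t|)) := by
        rw [hmass, Real.div_rpow hc₁.le ht0.le, Real.rpow_sub ht0, Real.rpow_two, sq_abs]
        have : t ≠ 0 := abs_pos.1 ht0
        field_simp
    _ ≤ ∫ u in Ioc 0 (c₁ / |t|), (1 - Real.cos (t * u)) / u ^ 2 * Real.exp (b * u)
          ∂(powerLaw α) :=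
        setIntegral_ge_of_const_le_real measurableSet_Ioc (measure_ne_top _ _) hintegrand
          (integrable_decayRate hα b t).integrableOn
    _ ≤ decayRate α b t :=
        setIntegral_le_integral (integrable_decayRate hα b t)
          (Filter.Eventually.of_forall fun u => decayRate_integrand_nonneg b t u)

theorem mul_exp_mul_one_sub_cos_le (hα0 : 0 ≤ α) (hα : α ≤ 2) {b u : ℝ} (hb : 0 ≤ b)
    (hu : u ∈ Icc (1 / 2 : ℝ) 1) (t : ℝ) :
    (2 - α) / 2 * Real.exp (b / 2) * (1 - Real.cos (t * u)) ≤
      ((2 - α) * u ^ (1 - α)) • ((1 - Real.cos (t * u)) / u ^ 2 * Real.exp (b * u)) := by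
  have hu0 : 0 < u := by linarith [hu.1]
  have hcos : 0 ≤ 1 - Real.cos (t * u) := sub_nonneg.2 (Real.cos_le_one _)
  have hdensity : (2 - α) / 2 ≤ (2 - α) * u ^ (1 - α) := by
    have hrpow : u ^ (1 : ℝ) ≤ u ^ (1 - α) :=
      Real.rpow_le_rpow_of_exponent_ge hu0 hu.2 (by linarith)
    rw [Real.rpow_one] at hrpow
    nlinarith [hu.1]
  have hdiv : 1 - Real.cos (t * u) ≤ (1 - Real.cos (t * u)) / u ^ 2 := by
    rw [le_div_iff₀ (by positivity)]
    exact mul_le_of_le_one_right hcos (pow_le_one₀ hu0.le hu.2)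
  have hexp : Real.exp (b / 2) ≤ Real.exp (b * u) := by
    gcongr; nlinarith [hu.1]
  rw [smul_eq_mul, mul_assoc, mul_comm (Real.exp (b / 2))]
  exact mul_le_mul hdensity (mul_le_mul hdiv hexp (Real.exp_pos _).le (hcos.trans hdiv))
    (by positivity) ((div_nonneg (sub_nonneg.2 hα) two_pos.le).trans hdensity)

theorem exists_exp_le_decayRate (hα0 : 0 ≤ α) (hα : α < 2) {c₀ : ℝ} (hc₀ : 0 < c₀) :
    ∃ c : ℝ, 0 < c ∧ ∀ b t : ℝ, 0 ≤ b → c₀ ≤ |t| → c * Real.exp (b / 2) ≤ decayRate α b t := by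
  obtain ⟨c, hc, hcos⟩ := exists_le_integral_one_sub_cos hc₀
  have hα' : 0 < 2 - α := by linarith
  refine ⟨(2 - α) / 2 * c, by positivity, fun b t hb ht => ?_⟩
  have hint := (integrable_powerLaw_iff hα.le _).1 (integrable_decayRate (α := α) hα b t)
  rw [decayRate, integral_powerLaw hα.le]
  have hsub : Ioc (1 / 2 : ℝ) 1 ⊆ Ioc 0 1 := Ioc_subset_Ioc_left (by norm_num)
  calc (2 - α) / 2 * c * Real.exp (b / 2)
      = (2 - α) / 2 * Real.exp (b / 2) * c := by ring
    _ ≤ (2 - α) / 2 * Real.exp (b / 2) * ∫ u in (1 / 2 : ℝ)..1, (1 - Real.cos (t * u)) := by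
        gcongr; exact hcos t ht
    _ = ∫ u in Ioc (1 / 2 : ℝ) 1, (2 - α) / 2 * Real.exp (b / 2) * (1 - Real.cos (t * u)) := by
        rw [intervalIntegral.integral_of_le (by norm_num), integral_const_mul]
    _ ≤ ∫ u in Ioc (1 / 2 : ℝ) 1, ((2 - α) * u ^ (1 - α)) •
          ((1 - Real.cos (t * u)) / u ^ 2 * Real.exp (b * u)) :=
        setIntegral_mono_on (Continuous.integrableOn_Ioc (by fun_prop)) (hint.mono_set hsub)
          measurableSet_Ioc fun u hu => mul_exp_mul_one_sub_cos_le hα0 hα.le hb ⟨hu.1.le, hu.2⟩ t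
    _ ≤ _ := by
        refine setIntegral_mono_set hint ?_ hsub.eventuallyLE
        filter_upwards [ae_restrict_mem measurableSet_Ioc] with u hu
        exact smul_nonneg (mul_nonneg hα'.le (Real.rpow_nonneg hu.1.le _))
          (decayRate_integrand_nonneg b t u)

theorem integrable_exp_neg_mul_abs_rpow (hα0 : 0 < α) {c : ℝ} (hc : 0 < c) :
    Integrable (fun t : ℝ => Real.exp (-c * |t| ^ α)) := by
  have hpos : IntegrableOn (fun t : ℝ => Real.exp (-c * |t| ^ α)) (Ioi 0) := by
    refine (integrableOn_rpow_mul_exp_neg_mul_rpow (p := α) (s := 0) (b := c) (by norm_num) hα0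
      hc).congr_fun (fun u hu => ?_) measurableSet_Ioi
    simp [abs_of_pos (show 0 < u from hu)]
  rw [← integrableOn_univ, ← Iic_union_Ioi (a := (0 : ℝ)), integrableOn_union]
  refine ⟨?_, hpos⟩
  rw [integrableOn_Iic_iff_integrableOn_Iio]
  rw [← integrable_indicator_iff measurableSet_Ioi] at hpos
  rw [← integrable_indicator_iff measurableSet_Iio]
  refine hpos.comp_neg.congr (Filter.Eventually.of_forall fun t => ?_)
  simp [indicator]

end Decay

section CentredExponent

variable {α : ℝ}

/-- The integrand of `centredExponent`. -/
noncomputable def centredKernel (b t u : ℝ) : ℂ :=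
  (Complex.exp (Complex.I * ((t * u : ℝ) : ℂ)) - 1 - Complex.I * ((t * u : ℝ) : ℂ)) /
    ((u ^ 2 : ℝ) : ℂ) * ((Real.exp (b * u) : ℝ) : ℂ)

/-- The characteristic exponent, per unit of `ρ²` and at time scale `1 / ρ`, of the centred law
obtained by tilting with parameter `b`. -/
noncomputable def centredExponent (α b t : ℝ) : ℂ :=
  ∫ u, centredKernel b t u ∂(powerLaw α)

/-- The density at the mean of the tilted law, as given by Fourier inversion of `exp (ρ² ψ(t / ρ))`
with `ψ = centredExponent α b`. -/
noncomputable def centredDensity (α b ρ : ℝ) : ℂ :=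
  ((ρ / (2 * Real.pi) : ℝ) : ℂ) * ∫ t : ℝ, Complex.exp ((ρ ^ 2 : ℝ) * centredExponent α b t)

theorem measurable_centredKernel (b : ℝ) :
    Measurable (Function.uncurry (centredKernel b)) := by
  unfold Function.uncurry centredKernel
  fun_prop

theorem centredKernel_sub_sum_eq (b t : ℝ) {u : ℝ} (hu : 0 < u) (N : ℕ) :
    centredKernel b t u - ∑ m ∈ Finset.range N,
        ((u ^ m * Real.exp (b * u) : ℝ) : ℂ) * ((Complex.I * t) ^ (m + 2) / (m + 2).factorial) =
      (Complex.exp (Complex.I * ((t * u : ℝ) : ℂ)) - ∑ n ∈ Finset.range (N + 2),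
        (Complex.I * ((t * u : ℝ) : ℂ)) ^ n / (n.factorial : ℂ)) *
          ((Real.exp (b * u) / u ^ 2 : ℝ) : ℂ) := by
  have hu' : (u : ℂ) ≠ 0 := Complex.ofReal_ne_zero.2 hu.ne'
  have hsum : ∑ m ∈ Finset.range N,
      ((u ^ m * Real.exp (b * u) : ℝ) : ℂ) * ((Complex.I * t) ^ (m + 2) / (m + 2).factorial) =
      (∑ m ∈ Finset.range N, (Complex.I * ((t * u : ℝ) : ℂ)) ^ (m + 2) /
        ((m + 2).factorial : ℂ)) * ((Real.exp (b * u) / u ^ 2 : ℝ) : ℂ) := by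
    rw [Finset.sum_mul]
    refine Finset.sum_congr rfl fun m _ => ?_
    push_cast
    field_simp
    ring
  rw [hsum, Finset.sum_range_succ', Finset.sum_range_succ', centredKernel]
  push_cast
  simp only [pow_one, pow_zero, Nat.factorial_one, Nat.factorial_zero, Nat.cast_one,
    div_one, Nat.add_assoc, Nat.reduceAdd]
  ring

theorem norm_centredKernel_sub_sum_le (b t : ℝ) {u : ℝ} (hu : 0 < u) (N : ℕ) :
    ‖centredKernel b t u - ∑ m ∈ Finset.range N,
        ((u ^ m * Real.exp (b * u) : ℝ) : ℂ) *
          ((Complex.I * t) ^ (m + 2) / (m + 2).factorial)‖ ≤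
      |t| ^ (N + 2) / (N + 2).factorial * (u ^ N * Real.exp (b * u)) := by
  have hre : (Complex.I * ((t * u : ℝ) : ℂ)).re ≤ 0 := by simp
  rw [centredKernel_sub_sum_eq b t hu, norm_mul, Complex.norm_real,
    Real.norm_of_nonneg (by positivity)]
  calc _ ≤ ‖Complex.I * ((t * u : ℝ) : ℂ)‖ ^ (N + 2) / (N + 2).factorial *
          (Real.exp (b * u) / u ^ 2) := by
        gcongr; exact norm_exp_sub_sum_le_of_re_nonpos _ hre
    _ = _ := by
        rw [norm_mul, Complex.norm_I, one_mul, Complex.norm_real, Real.norm_eq_abs, abs_mul,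
          abs_of_pos hu]
        field_simp
        ring

theorem norm_centredKernel_le (b t : ℝ) {u : ℝ} (hu : 0 < u) :
    ‖centredKernel b t u‖ ≤ t ^ 2 / 2 * Real.exp (b * u) := by
  simpa [Nat.factorial] using norm_centredKernel_sub_sum_le b t hu 0

theorem integrable_centredKernel (hα : α < 2) (b t : ℝ) :
    Integrable (centredKernel b t) (powerLaw α) :=
  integrable_of_bound_Ioc hα
    ((measurable_centredKernel b).of_uncurry_left).aestronglyMeasurable
    (t ^ 2 / 2 * Real.exp |b|) fun _ hu => (norm_centredKernel_le b t hu.1).trans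
      (mul_le_mul_of_nonneg_left (exp_mul_le hu) (by positivity))

theorem measurable_centredExponent (hα : α < 2) (b : ℝ) : Measurable (centredExponent α b) := by
  have := isProbabilityMeasure_powerLaw hα
  exact (measurable_centredKernel b).stronglyMeasurable.integral_prod_right.measurable

theorem re_centredExponent (hα : α < 2) (b t : ℝ) :
    (centredExponent α b t).re = -decayRate α b t := by
  have hre : ∀ u : ℝ, RCLike.re (centredKernel b t u) =
      -((1 - Real.cos (t * u)) / u ^ 2 * Real.exp (b * u)) := fun u => by
    rw [centredKernel, RCLike.re_to_complex, Complex.re_mul_ofReal, Complex.div_ofReal_re,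
      mul_comm Complex.I, Complex.sub_re, Complex.sub_re, Complex.exp_ofReal_mul_I_re]
    simp only [Complex.one_re, Complex.re_ofReal_mul, Complex.I_re, mul_zero]
    ring
  calc (centredExponent α b t).re = ∫ u, RCLike.re (centredKernel b t u) ∂(powerLaw α) :=
        (integral_re (integrable_centredKernel hα b t)).symm
    _ = -decayRate α b t := by simp_rw [hre, integral_neg, decayRate]

theorem norm_exp_centredExponent (hα : α < 2) (ρ b t : ℝ) :
    ‖Complex.exp ((ρ ^ 2 : ℝ) * centredExponent α b t)‖ =
      Real.exp (-(ρ ^ 2 * decayRate α b t)) := by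
  rw [Complex.norm_exp, Complex.re_ofReal_mul, re_centredExponent hα, mul_neg]

theorem norm_centredExponent_sub_sum_le (hα : α < 2) (b t : ℝ) (N : ℕ) :
    ‖centredExponent α b t - ∑ m ∈ Finset.range N,
        ((powerMoment α m b / (m + 2).factorial : ℝ) : ℂ) * (Complex.I * t) ^ (m + 2)‖ ≤
      |t| ^ (N + 2) / (N + 2).factorial * powerMoment α N b := by
  have hterm : ∀ m : ℕ,
      ((powerMoment α m b / (m + 2).factorial : ℝ) : ℂ) * (Complex.I * t) ^ (m + 2) =
        ∫ u : ℝ, ((u ^ m * Real.exp (b * u) : ℝ) : ℂ) *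
          ((Complex.I * t) ^ (m + 2) / (m + 2).factorial) ∂(powerLaw α) := fun m => by
    rw [integral_mul_const, integral_complex_ofReal, powerMoment]
    push_cast
    ring
  have hint : ∀ m ∈ Finset.range N, Integrable (fun u : ℝ =>
      ((u ^ m * Real.exp (b * u) : ℝ) : ℂ) *
        ((Complex.I * t) ^ (m + 2) / (m + 2).factorial)) (powerLaw α) := fun m _ =>
    ((integrable_pow_mul_exp hα m b).ofReal).mul_const _
  simp_rw [hterm]
  rw [centredExponent, ← integral_finsetSum _ hint,
    ← integral_sub (integrable_centredKernel hα b t) (integrable_finsetSum _ hint),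
    powerMoment, ← integral_const_mul]
  exact norm_integral_le_of_norm_le ((integrable_pow_mul_exp hα N b).const_mul _)
    (ae_powerLaw.mono fun u hu => norm_centredKernel_sub_sum_le b t hu.1 N)

theorem integrable_exp_centredExponent (hα0 : 0 < α) (hα : α < 2) {ρ : ℝ} (hρ : 0 < ρ) (b : ℝ) :
    Integrable (fun t : ℝ => Complex.exp ((ρ ^ 2 : ℝ) * centredExponent α b t)) := by
  obtain ⟨c, hc, hdecay⟩ := exists_rpow_le_decayRate hα one_pos le_rfl
  set R := 1 + max (-b) 0
  have : 0 < R := by linarith [le_max_right (-b) 0]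
  have hmeas := measurable_centredExponent hα b
  refine ((integrable_exp_neg_mul_abs_rpow hα0 (c := ρ ^ 2 * c) (by positivity)).const_mul
    (Real.exp (ρ ^ 2 * c * R ^ α))).mono' (Measurable.aestronglyMeasurable (by fun_prop))
    (Filter.Eventually.of_forall fun t => ?_)
  rw [norm_exp_centredExponent hα, ← Real.exp_add]
  gcongr
  rcases le_total R |t| with ht | ht
  · have hlow : ρ ^ 2 * (c * |t| ^ α) ≤ ρ ^ 2 * decayRate α b t := by
      gcongr
      exact hdecay b t (by rwa [one_mul])
    have : 0 ≤ ρ ^ 2 * c * R ^ α := by positivity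
    linarith
  · have hle : ρ ^ 2 * c * |t| ^ α ≤ ρ ^ 2 * c * R ^ α := by gcongr
    have := mul_nonneg (sq_nonneg ρ) (decayRate_nonneg (α := α) b t)
    linarith

section Rescaled

variable {κ : ℕ → ℝ} {ρ b : ℝ}

theorem cumulantTerm_eq_mul (hκ : ∀ m, κ (m + 2) = powerMoment α m b) (hκ2 : 0 < κ 2)
    (hρ : 0 < ρ) (x : ℝ) (m : ℕ) :
    cumulantTerm κ ρ x (m + 2) = ((ρ ^ 2 : ℝ) : ℂ) *
      (((powerMoment α m b / (m + 2).factorial : ℝ) : ℂ) *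
        (Complex.I * ((x / (Real.sqrt (κ 2) * ρ) : ℝ) : ℂ)) ^ (m + 2)) := by
  have hs : (Real.sqrt (κ 2) : ℂ) ≠ 0 := Complex.ofReal_ne_zero.2 (Real.sqrt_pos.2 hκ2).ne'
  have hρ' : (ρ : ℂ) ≠ 0 := Complex.ofReal_ne_zero.2 hρ.ne'
  rw [cumulantTerm, scaledCumulant, hκ, Nat.add_sub_cancel]
  push_cast
  rw [mul_div_assoc', div_pow, mul_pow (Real.sqrt (κ 2) : ℂ)]
  field_simp
  ring

theorem cumulantTerm_two (hκ2 : 0 < κ 2) (ρ x : ℝ) :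
    cumulantTerm κ ρ x 2 = -(x : ℂ) ^ 2 / 2 := by
  have hhalf : scaledCumulant κ ρ 2 = 1 / 2 := by
    rw [scaledCumulant, Real.sq_sqrt hκ2.le]
    simp
    field_simp
  rw [cumulantTerm, hhalf, mul_pow, Complex.I_sq]
  push_cast
  ring

theorem norm_rescaledExponent_sub_sum_le (hα : α < 2)
    (hκ : ∀ m, κ (m + 2) = powerMoment α m b) (hρ : 0 < ρ) (N : ℕ) (x : ℝ) :
    ‖(ρ ^ 2 : ℝ) * centredExponent α b (x / (Real.sqrt (κ 2) * ρ)) + (x : ℂ) ^ 2 / 2 -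
        ∑ n ∈ Finset.Icc 3 (N + 2), cumulantTerm κ ρ x n‖ ≤
      scaledCumulant κ ρ (N + 3) * |x| ^ (N + 3) := by
  have hκ2 : 0 < κ 2 := by rw [hκ 0]; exact powerMoment_zero_pos hα b
  have hsρ : 0 < Real.sqrt (κ 2) * ρ := mul_pos (Real.sqrt_pos.2 hκ2) hρ
  have hsum : ∑ n ∈ Finset.Icc 3 (N + 2), cumulantTerm κ ρ x n =
      ∑ m ∈ Finset.range N, cumulantTerm κ ρ x (m + 1 + 2) := by
    rw [Finset.range_eq_Ico, Finset.sum_Ico_add' (fun n => cumulantTerm κ ρ x n) 0 N 3]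
    rfl
  have hexpand : (ρ ^ 2 : ℝ) * centredExponent α b (x / (Real.sqrt (κ 2) * ρ)) +
        (x : ℂ) ^ 2 / 2 - ∑ n ∈ Finset.Icc 3 (N + 2), cumulantTerm κ ρ x n =
      ((ρ ^ 2 : ℝ) : ℂ) * (centredExponent α b (x / (Real.sqrt (κ 2) * ρ)) -
        ∑ m ∈ Finset.range (N + 1), ((powerMoment α m b / (m + 2).factorial : ℝ) : ℂ) *
          (Complex.I * ((x / (Real.sqrt (κ 2) * ρ) : ℝ) : ℂ)) ^ (m + 2)) := by
    rw [mul_sub, Finset.mul_sum]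
    simp_rw [← cumulantTerm_eq_mul hκ hκ2 hρ]
    rw [Finset.sum_range_succ', hsum, cumulantTerm_two hκ2]
    ring
  rw [hexpand, norm_mul, Complex.norm_real, Real.norm_of_nonneg (sq_nonneg ρ)]
  calc _ ≤ ρ ^ 2 * (|x / (Real.sqrt (κ 2) * ρ)| ^ (N + 3) / (N + 3).factorial *
          powerMoment α (N + 1) b) := by
        gcongr; exact norm_centredExponent_sub_sum_le hα b _ (N + 1)
    _ = _ := by
        rw [scaledCumulant, hκ (N + 1), abs_div, abs_of_pos hsρ, div_pow, mul_pow,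
          show N + 3 - 2 = N + 1 by omega]
        field_simp
        ring

theorem setIntegral_comp_div (f : ℝ → ℝ) (c : ℝ) {a : ℝ} (ha : 0 < a) :
    ∫ x in {x : ℝ | 1 < c * |x|}, f (x / a) = a * ∫ t in {t : ℝ | 1 < c * a * |t|}, f t := by
  rw [← integral_indicator (measurableSet_lt measurable_const (by fun_prop)),
    ← integral_indicator (measurableSet_lt measurable_const (by fun_prop))]
  have hsubst := Measure.integral_comp_div ({t : ℝ | 1 < c * a * |t|}.indicator f) a
  rw [abs_of_pos ha, smul_eq_mul] at hsubst
  rw [← hsubst]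
  congr 1
  ext x
  have : c * a * |x / a| = c * |x| := by rw [abs_div, abs_of_pos ha]; field_simp
  simp only [indicator, mem_ofPred_eq, this]

theorem integral_rescaled_eq_centredDensity (α b : ℝ) {s ρ : ℝ} (hs : 0 < s) (hρ : 0 < ρ) :
    ((1 / Real.sqrt (2 * Real.pi) : ℝ) : ℂ) *
        ∫ x : ℝ, Complex.exp ((ρ ^ 2 : ℝ) * centredExponent α b (x / (s * ρ))) =
      ((s * Real.sqrt (2 * Real.pi) : ℝ) : ℂ) * centredDensity α b ρ := by
  have hsubst := Measure.integral_comp_div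
    (fun t : ℝ => Complex.exp ((ρ ^ 2 : ℝ) * centredExponent α b t)) (s * ρ)
  have hconst : 1 / Real.sqrt (2 * Real.pi) * (s * ρ) =
      s * Real.sqrt (2 * Real.pi) * (ρ / (2 * Real.pi)) := by
    nth_rewrite 3 [← Real.sq_sqrt Real.two_pi_pos.le]
    field_simp
  rw [hsubst, abs_of_pos (mul_pos hs hρ), Complex.real_smul, centredDensity, ← mul_assoc,
    ← mul_assoc, ← Complex.ofReal_mul, ← Complex.ofReal_mul, hconst]

end Rescaled

theorem exists_norm_centredDensity_sub_edgeworthFactor_le :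
    ∃ C D : ℝ, 0 < C ∧ 1 ≤ D ∧ ∀ α : ℝ, 0 < α → α < 2 → ∀ (κ : ℕ → ℝ) (ρ η b : ℝ),
      0 < ρ → 0 ≤ η → (∀ m, κ (m + 2) = powerMoment α m b) →
      (∀ n, 3 ≤ n → |scaledCumulant κ ρ n| ≤ η ^ (n - 2)) → ∀ k : ℕ,
        ‖((Real.sqrt (κ 2) * Real.sqrt (2 * Real.pi) : ℝ) : ℂ) * centredDensity α b ρ -
          (edgeworthFactor κ ρ k : ℂ)‖ ≤
          C * D ^ k * (k : ℝ) ^ ((k : ℝ) / 2) * η ^ (k + 1) +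
            Real.sqrt (κ 2) * ρ * ∫ t in {t : ℝ | 1 < 8 * η * (Real.sqrt (κ 2) * ρ) * |t|},
              Real.exp (-(ρ ^ 2 * decayRate α b t)) := by
  obtain ⟨C, D, hC, hD, hbound⟩ := exists_norm_integral_sub_edgeworthFactor_le
  refine ⟨C, D, hC, hD, fun α hα0 hα κ ρ η b hρ hη hκ hscaled k => ?_⟩
  have hκ2 : 0 < κ 2 := by rw [hκ 0]; exact powerMoment_zero_pos hα b
  have hs : 0 < Real.sqrt (κ 2) := Real.sqrt_pos.2 hκ2
  have hsρ : 0 < Real.sqrt (κ 2) * ρ := by positivity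
  have hcancel : ∀ x : ℝ, Complex.exp (-(x : ℂ) ^ 2 / 2 + ((ρ ^ 2 : ℝ) *
      centredExponent α b (x / (Real.sqrt (κ 2) * ρ)) + (x : ℂ) ^ 2 / 2)) =
        Complex.exp ((ρ ^ 2 : ℝ) * centredExponent α b (x / (Real.sqrt (κ 2) * ρ))) := fun x => by
    congr 1; ring
  have hmain := hbound κ ρ η hκ2 hη hscaled k (fun x => (ρ ^ 2 : ℝ) *
      centredExponent α b (x / (Real.sqrt (κ 2) * ρ)) + (x : ℂ) ^ 2 / 2) (fun x => by
    calc _ ≤ scaledCumulant κ ρ (k + 3) * |x| ^ (k + 3) :=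
          norm_rescaledExponent_sub_sum_le hα hκ hρ k x
      _ ≤ η ^ (k + 1) * |x| ^ (k + 3) := by
          gcongr
          exact (le_abs_self _).trans (hscaled (k + 3) (by omega))
      _ = x ^ 2 * (η * |x|) ^ (k + 1) := by rw [← sq_abs x]; ring) (by
    simp_rw [hcancel]
    exact (integrable_exp_centredExponent hα0 hα hρ b).comp_div hsρ.ne')
  simp_rw [hcancel, norm_exp_centredExponent hα] at hmain
  rwa [integral_rescaled_eq_centredDensity α b hs hρ, setIntegral_comp_div
    (fun t => Real.exp (-(ρ ^ 2 * decayRate α b t))) (8 * η) hsρ] at hmain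

end CentredExponent

section Expansion

variable {α : ℝ}

theorem mul_pow_add_mul_pow_le {A B D E : ℝ} (hA : 0 ≤ A) (hB : 0 ≤ B) (hD : 0 ≤ D) (hE : 0 ≤ E)
    (k : ℕ) : A * D ^ k + B * E ^ k ≤ (A + B) * max D E ^ k := by
  rw [add_mul]
  gcongr
  · exact le_max_left D E
  · exact le_max_right D E

theorem pow_le_inv_pow_mul_exp {c s : ℝ} (hc : 0 < c) (hs : 0 ≤ s) (n : ℕ) :
    s ^ n ≤ c⁻¹ ^ n * Real.exp (n * (c * s)) := by
  rw [Real.exp_nat_mul, ← mul_pow]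
  gcongr
  rw [← div_eq_inv_mul, le_div_iff₀ hc, mul_comm]
  linarith [Real.add_one_le_exp (c * s)]

theorem exists_mul_pow_mul_exp_le {c : ℝ} (hc : 0 < c) :
    ∃ C D : ℝ, 0 < C ∧ 0 < D ∧ ∀ (k : ℕ) (s ρ : ℝ), 1 ≤ s → 1 ≤ ρ → Real.sqrt k ≤ ρ →
      (s * ρ) ^ (k + 2) * Real.exp (-(c * (ρ ^ 2 * s))) ≤
        C * D ^ k * (k : ℝ) ^ ((k : ℝ) / 2) := by
  obtain ⟨C, D, hC, hD, hρpow⟩ := exists_pow_add_le_exp_sq (Q := c / 2) (by positivity) 2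
  refine ⟨C * (c / 6)⁻¹ ^ 2, D * (c / 6)⁻¹, by positivity, by positivity,
    fun k s ρ hs hρ hk => ?_⟩
  have hkρ : (k : ℝ) ≤ ρ ^ 2 := (Real.sqrt_le_left (by linarith)).1 hk
  have hspow : s ^ (k + 2) ≤ (c / 6)⁻¹ ^ (k + 2) * Real.exp (c / 2 * (ρ ^ 2 * s)) := by
    refine (pow_le_inv_pow_mul_exp (c := c / 6) (by positivity) (by linarith) (k + 2)).trans ?_
    have hcount : ((k + 2 : ℕ) : ℝ) ≤ 3 * ρ ^ 2 := by push_cast; nlinarith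
    refine mul_le_mul_of_nonneg_left (Real.exp_le_exp.2 ?_) (by positivity)
    calc ((k + 2 : ℕ) : ℝ) * (c / 6 * s) ≤ 3 * ρ ^ 2 * (c / 6 * s) := by gcongr
      _ = c / 2 * (ρ ^ 2 * s) := by ring
  have hexp : Real.exp (c / 2 * (ρ ^ 2 * s)) * Real.exp (c / 2 * ρ ^ 2) *
      Real.exp (-(c * (ρ ^ 2 * s))) ≤ 1 := by
    rw [← Real.exp_add, ← Real.exp_add, Real.exp_le_one_iff]
    have : c * ρ ^ 2 * 1 ≤ c * ρ ^ 2 * s := by gcongr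
    linarith
  calc (s * ρ) ^ (k + 2) * Real.exp (-(c * (ρ ^ 2 * s)))
      = s ^ (k + 2) * ρ ^ (k + 2) * Real.exp (-(c * (ρ ^ 2 * s))) := by rw [mul_pow]
    _ ≤ ((c / 6)⁻¹ ^ (k + 2) * Real.exp (c / 2 * (ρ ^ 2 * s))) *
          (C * D ^ k * (k : ℝ) ^ ((k : ℝ) / 2) * Real.exp (c / 2 * ρ ^ 2)) *
          Real.exp (-(c * (ρ ^ 2 * s))) := by
        gcongr; exact hρpow k ρ (by linarith)
    _ = (C * (c / 6)⁻¹ ^ 2) * (D * (c / 6)⁻¹) ^ k * (k : ℝ) ^ ((k : ℝ) / 2) *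
          (Real.exp (c / 2 * (ρ ^ 2 * s)) * Real.exp (c / 2 * ρ ^ 2) *
            Real.exp (-(c * (ρ ^ 2 * s)))) := by
        rw [mul_pow D]; ring
    _ ≤ _ := mul_le_of_le_one_right (by positivity) hexp

theorem setIntegral_exp_neg_sq_mul_le (hα0 : 0 < α) {c T ρ : ℝ} (hc : 0 < c) (hρ : 1 ≤ ρ)
    {S : Set ℝ} (hS : MeasurableSet S) {J : ℝ → ℝ} (hpow : ∀ t ∈ S, c * |t| ^ α ≤ J t)
    (hT : ∀ t ∈ S, T ≤ J t) :
    ∫ t in S, Real.exp (-(ρ ^ 2 * J t)) ≤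
      (∫ t : ℝ, Real.exp (-(c / 2) * |t| ^ α)) * Real.exp (-(ρ ^ 2 * (T / 2))) := by
  have hint := (integrable_exp_neg_mul_abs_rpow hα0 (half_pos hc)).mul_const
    (Real.exp (-(ρ ^ 2 * (T / 2))))
  rw [← integral_mul_const]
  refine le_trans (integral_mono_of_nonneg
    (Filter.Eventually.of_forall fun t => (Real.exp_pos _).le) hint.integrableOn ?_)
    (setIntegral_le_integral hint (Filter.Eventually.of_forall fun t => by positivity))
  filter_upwards [ae_restrict_mem hS] with t ht
  have hρ2 : 1 ≤ ρ ^ 2 := one_le_pow₀ hρ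
  have hhalf : c / 2 * |t| ^ α ≤ ρ ^ 2 * (J t / 2) := by
    have : 0 ≤ c * |t| ^ α := by positivity
    nlinarith [hpow t ht]
  have : ρ ^ 2 * (T / 2) ≤ ρ ^ 2 * (J t / 2) := by gcongr; exact hT t ht
  rw [← Real.exp_add]
  gcongr
  linarith

theorem add_le_mul_max_pow_mul {C D I C₀ D₀ W E η T : ℝ} {k : ℕ} (hC : 0 ≤ C) (hD : 0 ≤ D)
    (hI : 0 ≤ I) (hC₀ : 0 ≤ C₀) (hD₀ : 0 ≤ D₀) (hW : 0 ≤ W) (hη : 0 < η)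
    (hT : T ≤ I * (η⁻¹ * E)) (hE : η⁻¹ ^ (k + 2) * E ≤ C₀ * D₀ ^ k * W) :
    C * D ^ k * W * η ^ (k + 1) + T ≤ (C + I * C₀) * max D D₀ ^ k * W * η ^ (k + 1) := by
  have hE' : η⁻¹ * E ≤ C₀ * D₀ ^ k * W * η ^ (k + 1) := by
    calc η⁻¹ * E = η⁻¹ ^ (k + 2) * E * η ^ (k + 1) := by
          rw [pow_succ, inv_pow]; field_simp
      _ ≤ _ := by gcongr
  calc C * D ^ k * W * η ^ (k + 1) + T
      ≤ C * D ^ k * W * η ^ (k + 1) + I * (C₀ * D₀ ^ k * W * η ^ (k + 1)) := by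
        gcongr; exact hT.trans (by gcongr)
    _ = (C * D ^ k + I * C₀ * D₀ ^ k) * (W * η ^ (k + 1)) := by ring
    _ ≤ (C + I * C₀) * max D D₀ ^ k * (W * η ^ (k + 1)) := by
        gcongr; exact mul_pow_add_mul_pow_le hC (by positivity) hD hD₀ k
    _ = _ := by ring

section TiltRight

variable {κ : ℕ → ℝ} {ρ b : ℝ}

theorem abs_scaledCumulant_le_inv_pow (hα : α < 2) (hκ : ∀ m, κ (m + 2) = powerMoment α m b)
    (hρ : 0 < ρ) {n : ℕ} (hn : 2 ≤ n) :
    |scaledCumulant κ ρ n| ≤ (Real.sqrt (κ 2) * ρ)⁻¹ ^ (n - 2) := by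
  obtain ⟨m, rfl⟩ := Nat.exists_eq_add_of_le' hn
  have hκ2 : 0 < κ 2 := by rw [hκ 0]; exact powerMoment_zero_pos hα b
  have : 0 < Real.sqrt (κ 2) := Real.sqrt_pos.2 hκ2
  have hnonneg : 0 ≤ κ (m + 2) := by rw [hκ]; exact powerMoment_nonneg m b
  have hle : κ (m + 2) ≤ Real.sqrt (κ 2) ^ 2 := by
    rw [Real.sq_sqrt hκ2.le, hκ m, hκ 0]; exact powerMoment_le hα m b
  rw [scaledCumulant, Nat.add_sub_cancel, abs_of_nonneg (by positivity)]
  calc κ (m + 2) / (m + 2).factorial / (Real.sqrt (κ 2) ^ (m + 2) * ρ ^ m)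
      ≤ Real.sqrt (κ 2) ^ 2 / (Real.sqrt (κ 2) ^ (m + 2) * ρ ^ m) := by
        gcongr
        exact (div_le_self hnonneg (by exact_mod_cast (m + 2).factorial_pos)).trans hle
    _ = _ := by rw [inv_pow, mul_pow, pow_add]; field_simp

theorem sqrt_powerMoment_zero_le_exp (hα : α < 2) (hb : 0 ≤ b) :
    Real.sqrt (powerMoment α 0 b) ≤ Real.exp (b / 2) := by
  rw [Real.exp_half]
  exact Real.sqrt_le_sqrt (powerMoment_zero_le_exp hα hb)

theorem exists_setIntegral_exp_neg_decayRate_le (hα0 : 0 < α) (hα : α < 2) {L : ℝ} (hL : 1 ≤ L) :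
    ∃ I c : ℝ, 0 ≤ I ∧ 0 < c ∧ ∀ b ρ : ℝ, 0 ≤ b → 1 ≤ ρ →
      ∫ t in {t : ℝ | 1 < L * |t|}, Real.exp (-(ρ ^ 2 * decayRate α b t)) ≤
        I * Real.exp (-(c * (ρ ^ 2 * Real.exp (b / 2)))) := by
  obtain ⟨c₁, hc₁, hpow⟩ := exists_rpow_le_decayRate hα (c₁ := L⁻¹) (by positivity)
    (inv_le_one_of_one_le₀ hL)
  obtain ⟨c₂, hc₂, hexp⟩ := exists_exp_le_decayRate hα0.le hα (c₀ := L⁻¹) (by positivity)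
  refine ⟨∫ t : ℝ, Real.exp (-(c₁ / 2) * |t| ^ α), c₂ / 2, by positivity, by positivity,
    fun b ρ hb hρ => ?_⟩
  have hlow : ∀ t ∈ {t : ℝ | 1 < L * |t|}, L⁻¹ ≤ |t| := fun t ht =>
    (inv_le_iff_one_le_mul₀' (by positivity)).2 (le_of_lt ht)
  refine (setIntegral_exp_neg_sq_mul_le hα0 hc₁ hρ
    (measurableSet_lt measurable_const (by fun_prop))
    (fun t ht => hpow b t (by simpa [hb] using hlow t ht))
    (fun t ht => hexp b t hb (hlow t ht))).trans (le_of_eq ?_)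
  ring_nf

theorem exists_edgeworth_of_tilt_nonneg (hα0 : 0 < α) (hα : α < 2) :
    ∃ C D C' : ℝ, 0 < C ∧ 0 < D ∧ 0 < C' ∧ ∀ (κ : ℕ → ℝ) (ρ b : ℝ), 1 ≤ ρ → 0 ≤ b →
      (∀ m, κ (m + 2) = powerMoment α m b) → ∀ k : ℕ, C' * Real.sqrt k ≤ ρ →
        |edgeworthFactor κ ρ k - 1| ≤ 1 / 2 ∧
        ‖((Real.sqrt (κ 2) * Real.sqrt (2 * Real.pi) : ℝ) : ℂ) * centredDensity α b ρ -
          (edgeworthFactor κ ρ k : ℂ)‖ ≤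
          C * D ^ k * (k : ℝ) ^ ((k : ℝ) / 2) / (Real.sqrt (κ 2) * ρ) ^ (k + 1) := by
  obtain ⟨C', hC', hfactor⟩ := exists_abs_edgeworthFactor_sub_one_le
  obtain ⟨C, D, hC, hD, hexpand⟩ := exists_norm_centredDensity_sub_edgeworthFactor_le
  obtain ⟨I, c, hI, hc, htail⟩ :=
    exists_setIntegral_exp_neg_decayRate_le hα0 hα (L := 8) (by norm_num)
  obtain ⟨C₀, D₀, hC₀, hD₀, hpow⟩ := exists_mul_pow_mul_exp_le hc
  refine ⟨C + I * C₀, max D D₀, max C' 1, by positivity, by positivity, by positivity,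
    fun κ ρ b hρ hb hκ k hk => ?_⟩
  have hκ2 : 1 ≤ κ 2 := by
    rw [hκ 0, ← powerMoment_zero_zero hα]; exact powerMoment_zero_mono hα hb
  set s := Real.sqrt (κ 2) with hs
  have hs1 : 1 ≤ s := Real.one_le_sqrt.2 hκ2
  have hsρ : 0 < s * ρ := by positivity
  have hse : s ≤ Real.exp (b / 2) := by rw [hs, hκ 0]; exact sqrt_powerMoment_zero_le_exp hα hb
  have hscaled : ∀ n, 3 ≤ n → |scaledCumulant κ ρ n| ≤ (s * ρ)⁻¹ ^ (n - 2) := fun n hn =>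
    abs_scaledCumulant_le_inv_pow hα hκ (by positivity) (by omega)
  have hk' : C' * Real.sqrt k ≤ ρ ∧ Real.sqrt k ≤ ρ := by
    rw [max_mul_of_nonneg _ _ (Real.sqrt_nonneg _), one_mul] at hk
    exact max_le_iff.1 hk
  have hsmall : C' * (s * ρ)⁻¹ * Real.sqrt k ≤ 1 := by
    rw [mul_right_comm, ← div_eq_mul_inv, div_le_one hsρ]
    exact hk'.1.trans (le_mul_of_one_le_left (by positivity) hs1)
  have hset : {t : ℝ | 1 < 8 * (s * ρ)⁻¹ * (s * ρ) * |t|} = {t | 1 < 8 * |t|} := by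
    rw [inv_mul_cancel_right₀ hsρ.ne']
  refine ⟨hfactor κ ρ _ (by positivity) (by positivity) hscaled k hsmall, ?_⟩
  have herr := hexpand α hα0 hα κ ρ _ b (by positivity) (by positivity) hκ hscaled k
  rw [← hs, hset] at herr
  rw [div_eq_mul_inv, ← inv_pow]
  refine herr.trans (add_le_mul_max_pow_mul hC.le (by positivity) hI hC₀.le hD₀.le (by positivity)
    (by positivity) ?_ (by rw [inv_inv]; exact hpow k s ρ hs1 hρ hk'.2))
  calc s * ρ * ∫ t in {t : ℝ | 1 < 8 * |t|}, Real.exp (-(ρ ^ 2 * decayRate α b t))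
      ≤ s * ρ * (I * Real.exp (-(c * (ρ ^ 2 * Real.exp (b / 2))))) := by
        gcongr; exact htail b ρ hb hρ
    _ ≤ s * ρ * (I * Real.exp (-(c * (ρ ^ 2 * s)))) := by gcongr
    _ = _ := by rw [inv_inv]; ring

end TiltRight

section TiltLeft

/-- The effective length of the support of the power law tilted with parameter `b ≤ 0`: the part
of `(0, 1]` that keeps its mass has length of order `(1 + |b|)⁻¹`. -/
noncomputable def effectiveLength (α b : ℝ) : ℝ :=
  powerMoment α 0 b ^ (1 / (2 - α))

variable {a : ℝ}

theorem effectiveLength_pos (hα : α < 2) (b : ℝ) : 0 < effectiveLength α b :=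
  Real.rpow_pos_of_pos (powerMoment_zero_pos hα b) _

theorem effectiveLength_le_one (hα : α < 2) {b : ℝ} (hb : b ≤ 0) : effectiveLength α b ≤ 1 := by
  refine Real.rpow_le_one (powerMoment_zero_pos hα b).le ?_ (by have := sub_pos.2 hα; positivity)
  rw [← powerMoment_zero_zero hα]
  exact powerMoment_zero_mono hα hb

theorem mul_one_add_rpow_rpow (hα : α < 2) {B : ℝ} (hB : 0 ≤ B) (ha : 0 ≤ a) :
    (B * (1 + a) ^ (-(2 - α))) ^ (1 / (2 - α)) = B ^ (1 / (2 - α)) * (1 + a)⁻¹ := by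
  rw [Real.mul_rpow hB (by positivity), ← Real.rpow_mul (by positivity), neg_mul,
    mul_one_div_cancel (by linarith), Real.rpow_neg_one]

theorem inv_one_add_le_effectiveLength (hα : α < 2) (ha : 0 ≤ a) :
    (1 + a)⁻¹ ≤ Real.exp (1 / (2 - α)) * effectiveLength α (-a) := by
  have h := Real.rpow_le_rpow (by positivity) (le_powerMoment_zero_neg hα ha)
    (one_div_pos.2 (sub_pos.2 hα)).le
  rwa [mul_one_add_rpow_rpow hα (Real.exp_pos _).le ha, ← Real.exp_mul, neg_one_mul, Real.exp_neg,
    inv_mul_le_iff₀ (Real.exp_pos _)] at h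

theorem exists_effectiveLength_le (hα : α < 2) :
    ∃ B : ℝ, 0 < B ∧ ∀ a : ℝ, 0 ≤ a → effectiveLength α (-a) ≤ B * (1 + a)⁻¹ := by
  obtain ⟨B, hB, hmoment⟩ := exists_powerMoment_neg_le hα
  refine ⟨B ^ (1 / (2 - α)), by positivity, fun a ha => ?_⟩
  rw [← mul_one_add_rpow_rpow hα (by positivity) ha, effectiveLength]
  have := sub_pos.2 hα
  exact Real.rpow_le_rpow (powerMoment_nonneg 0 _) (by simpa using hmoment 0 a ha) (by positivity)

theorem exists_powerMoment_neg_le_effectiveLength_pow (hα : α < 2) :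
    ∃ A : ℝ, 0 < A ∧ ∀ (n : ℕ) (a : ℝ), 0 ≤ a → powerMoment α n (-a) ≤
      powerMoment α 0 (-a) * n.factorial * (A * effectiveLength α (-a)) ^ n := by
  obtain ⟨B, hB, hmoment⟩ := exists_powerMoment_neg_le hα
  set E := Real.exp (1 / (2 - α))
  have he : 1 ≤ Real.exp 1 := Real.one_le_exp zero_le_one
  refine ⟨B * Real.exp 1 * (2 * E), by positivity, fun n a ha => ?_⟩
  rcases Nat.eq_zero_or_pos n with rfl | hn
  · simp
  have hq := effectiveLength_pos hα (-a)
  have hlow : (1 + a) ^ (-(2 - α)) ≤ Real.exp 1 * powerMoment α 0 (-a) := by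
    have := le_powerMoment_zero_neg hα ha
    rwa [Real.exp_neg, inv_mul_le_iff₀ (Real.exp_pos _)] at this
  have hBe : B * Real.exp 1 ≤ (B * Real.exp 1) ^ n := le_self_pow₀ (by nlinarith) hn.ne'
  have hmoment0 := powerMoment_nonneg (α := α) 0 (-a)
  calc powerMoment α n (-a)
      ≤ B * n.factorial * (2 * (1 + a)⁻¹) ^ n * (1 + a) ^ (-(2 - α)) := hmoment n a ha
    _ ≤ B * n.factorial * (2 * (E * effectiveLength α (-a))) ^ n *
          (Real.exp 1 * powerMoment α 0 (-a)) := by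
        gcongr; exact inv_one_add_le_effectiveLength hα ha
    _ = B * Real.exp 1 * (powerMoment α 0 (-a) * n.factorial *
          (2 * (E * effectiveLength α (-a))) ^ n) := by ring
    _ ≤ (B * Real.exp 1) ^ n * (powerMoment α 0 (-a) * n.factorial *
          (2 * (E * effectiveLength α (-a))) ^ n) := by gcongr
    _ = _ := by rw [← mul_assoc 2, mul_assoc (B * Real.exp 1), mul_pow (B * Real.exp 1)]; ring

theorem exists_abs_scaledCumulant_le_effectiveLength_pow (hα : α < 2) :
    ∃ A : ℝ, 0 < A ∧ ∀ (κ : ℕ → ℝ) (ρ b : ℝ), 0 < ρ → b ≤ 0 →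
      (∀ m, κ (m + 2) = powerMoment α m b) → ∀ n, 2 ≤ n →
      |scaledCumulant κ ρ n| ≤
        (A * (effectiveLength α b / (Real.sqrt (κ 2) * ρ))) ^ (n - 2) := by
  obtain ⟨A, hA, hmoment⟩ := exists_powerMoment_neg_le_effectiveLength_pow hα
  refine ⟨A, hA, fun κ ρ b hρ hb hκ n hn => ?_⟩
  obtain ⟨m, rfl⟩ := Nat.exists_eq_add_of_le' hn
  have hκ2 : 0 < κ 2 := by rw [hκ 0]; exact powerMoment_zero_pos hα b
  have : 0 < Real.sqrt (κ 2) := Real.sqrt_pos.2 hκ2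
  have hnonneg : 0 ≤ κ (m + 2) := by rw [hκ]; exact powerMoment_nonneg m b
  have hq := effectiveLength_pos hα b
  have hle : κ (m + 2) ≤ Real.sqrt (κ 2) ^ 2 * (A * effectiveLength α b) ^ m *
      (m + 2).factorial := by
    have hfactorial : (m.factorial : ℝ) ≤ (m + 2).factorial := by
      exact_mod_cast Nat.factorial_le (by omega)
    have h := hmoment m (-b) (neg_nonneg.2 hb)
    rw [neg_neg, ← hκ m, ← hκ 0] at h
    rw [Real.sq_sqrt hκ2.le, mul_right_comm]
    exact h.trans (by gcongr)
  rw [scaledCumulant, Nat.add_sub_cancel, abs_of_nonneg (by positivity)]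
  calc κ (m + 2) / (m + 2).factorial / (Real.sqrt (κ 2) ^ (m + 2) * ρ ^ m)
      ≤ Real.sqrt (κ 2) ^ 2 * (A * effectiveLength α b) ^ m /
          (Real.sqrt (κ 2) ^ (m + 2) * ρ ^ m) := by
        gcongr
        rwa [div_le_iff₀ (by positivity)]
    _ = _ := by rw [mul_div_assoc', div_pow, mul_pow _ ρ, pow_add]; field_simp

theorem exists_setIntegral_exp_neg_decayRate_neg_le (hα0 : 0 < α) (hα : α < 2) {L : ℝ}
    (hL : 0 < L) :
    ∃ I c : ℝ, 0 ≤ I ∧ 0 < c ∧ ∀ b ρ : ℝ, b ≤ 0 → 1 ≤ ρ →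
      ∫ t in {t : ℝ | 1 < L * effectiveLength α b * |t|}, Real.exp (-(ρ ^ 2 * decayRate α b t)) ≤
        I * Real.exp (-(c * (ρ ^ 2 * effectiveLength α b ^ (-α)))) := by
  obtain ⟨B, hB, hup⟩ := exists_effectiveLength_le hα
  obtain ⟨c, hc, hpow⟩ := exists_rpow_le_decayRate hα (c₁ := min 1 (1 / (L * B)))
    (by positivity) (min_le_left _ _)
  refine ⟨∫ t : ℝ, Real.exp (-(c / 2) * |t| ^ α), c * L ^ (-α) / 2, by positivity, by positivity,
    fun b ρ hb hρ => ?_⟩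
  have hq := effectiveLength_pos hα b
  have hdecay : ∀ t ∈ {t : ℝ | 1 < L * effectiveLength α b * |t|},
      c * |t| ^ α ≤ decayRate α b t := fun t ht => by
    refine hpow b t ?_
    have hbB : effectiveLength α b ≤ B * (1 + -b)⁻¹ := by
      simpa using hup (-b) (neg_nonneg.2 hb)
    have hone : 1 ≤ L * (B * (1 + -b)⁻¹) * |t| := (le_of_lt ht).trans (by gcongr)
    rw [max_eq_left (neg_nonneg.2 hb)]
    calc min 1 (1 / (L * B)) * (1 + -b) ≤ 1 / (L * B) * (1 + -b) := by
          gcongr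
          · linarith
          · exact min_le_right _ _
      _ ≤ 1 / (L * B) * (1 + -b) * (L * (B * (1 + -b)⁻¹) * |t|) :=
          le_mul_of_one_le_right (mul_nonneg (by positivity) (by linarith)) hone
      _ = |t| := by
          have : 1 + -b ≠ 0 := by linarith
          field_simp
  refine (setIntegral_exp_neg_sq_mul_le hα0 hc hρ
    (measurableSet_lt measurable_const (by fun_prop)) hdecay
    (T := c * (L ^ (-α) * effectiveLength α b ^ (-α))) fun t ht => ?_).trans (le_of_eq (by ring_nf))
  refine le_trans ?_ (hdecay t ht)
  rw [← Real.mul_rpow hL.le hq.le, Real.rpow_neg (by positivity), ← Real.inv_rpow (by positivity)]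
  gcongr
  exact (inv_le_iff_one_le_mul₀' (by positivity)).2 (le_of_lt ht)

theorem sq_div_effectiveLength (hα : α < 2) (b ρ : ℝ) :
    (Real.sqrt (powerMoment α 0 b) * ρ / effectiveLength α b) ^ 2 =
      ρ ^ 2 * effectiveLength α b ^ (-α) := by
  have hκ := powerMoment_zero_pos hα b
  have hq := effectiveLength_pos hα b
  have hmoment : powerMoment α 0 b = effectiveLength α b ^ (2 - α) := by
    rw [effectiveLength, ← Real.rpow_mul hκ.le, one_div_mul_cancel (by linarith), Real.rpow_one]
  rw [div_pow, mul_pow, Real.sq_sqrt hκ.le, hmoment, Real.rpow_sub hq, Real.rpow_neg hq.le,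
    Real.rpow_two]
  field_simp

theorem effectiveLength_div (hα : α < 2) (b ρ : ℝ) :
    effectiveLength α b / (Real.sqrt (powerMoment α 0 b) * ρ) =
      powerMoment α 0 b ^ (1 / (2 - α) - 1 / 2) / ρ := by
  rw [Real.rpow_sub (powerMoment_zero_pos hα b), ← Real.sqrt_eq_rpow, div_div, effectiveLength]

theorem powerMoment_zero_rpow_le_one (hα0 : 0 ≤ α) (hα : α < 2) (hb : b ≤ 0) :
    powerMoment α 0 b ^ (1 / (2 - α) - 1 / 2) ≤ 1 := by
  refine Real.rpow_le_one (powerMoment_nonneg 0 b) ?_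
    (sub_nonneg.2 (one_div_le_one_div_of_le (sub_pos.2 hα) (by linarith)))
  rw [← powerMoment_zero_zero hα]
  exact powerMoment_zero_mono hα hb

theorem exists_mul_setIntegral_exp_neg_decayRate_neg_le (hα0 : 0 < α) (hα : α < 2) {L : ℝ}
    (hL : 0 < L) :
    ∃ I c : ℝ, 0 ≤ I ∧ 0 < c ∧ ∀ b ρ x : ℝ, b ≤ 0 → 1 ≤ ρ →
      x = Real.sqrt (powerMoment α 0 b) * ρ / effectiveLength α b →
      Real.sqrt (powerMoment α 0 b) * ρ * ∫ t in {t : ℝ | 1 < L * effectiveLength α b * |t|},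
        Real.exp (-(ρ ^ 2 * decayRate α b t)) ≤ I * (x * Real.exp (-(c * x ^ 2))) := by
  obtain ⟨I, c, hI, hc, htail⟩ := exists_setIntegral_exp_neg_decayRate_neg_le hα0 hα hL
  refine ⟨I, c, hI, hc, fun b ρ x hb hρ hx => ?_⟩
  have hq := effectiveLength_pos hα b
  have hle : Real.sqrt (powerMoment α 0 b) * ρ ≤ x := by
    rw [hx]
    exact le_div_self (by positivity) hq (effectiveLength_le_one hα hb)
  have hexp := htail b ρ hb hρ
  rw [← sq_div_effectiveLength hα, ← hx] at hexp
  calc _ ≤ x * (I * Real.exp (-(c * x ^ 2))) :=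
        mul_le_mul hle hexp (by positivity) (le_trans (by positivity) hle)
    _ = _ := by ring

theorem exists_edgeworth_of_tilt_nonpos (hα0 : 0 < α) (hα : α < 2) :
    ∃ C D C' : ℝ, 0 < C ∧ 0 < D ∧ 0 < C' ∧ ∀ (κ : ℕ → ℝ) (ρ b : ℝ), 1 ≤ ρ → b ≤ 0 →
      (∀ m, κ (m + 2) = powerMoment α m b) → ∀ k : ℕ, C' * Real.sqrt k ≤ ρ →
        |edgeworthFactor κ ρ k - 1| ≤ 1 / 2 ∧
        ‖((Real.sqrt (κ 2) * Real.sqrt (2 * Real.pi) : ℝ) : ℂ) * centredDensity α b ρ -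
          (edgeworthFactor κ ρ k : ℂ)‖ ≤
          C * D ^ k * (k : ℝ) ^ ((k : ℝ) / 2) * (κ 2 ^ (1 / (2 - α) - 1 / 2) / ρ) ^ (k + 1) := by
  obtain ⟨C', hC', hfactor⟩ := exists_abs_edgeworthFactor_sub_one_le
  obtain ⟨C, D, hC, hD, hexpand⟩ := exists_norm_centredDensity_sub_edgeworthFactor_le
  obtain ⟨A, hA, hscaled⟩ := exists_abs_scaledCumulant_le_effectiveLength_pow hα
  obtain ⟨I, c, hI, hc, htail⟩ :=
    exists_mul_setIntegral_exp_neg_decayRate_neg_le hα0 hα (L := 8 * A) (by positivity)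
  obtain ⟨C₀, D₀, hC₀, hD₀, hpow⟩ := exists_pow_add_le_exp_sq hc 2
  refine ⟨C * A + I * C₀, max (D * A) D₀, C' * A, by positivity, by positivity, by positivity,
    fun κ ρ b hρ hb hκ k hk => ?_⟩
  have hκ2 : 0 < κ 2 := by rw [hκ 0]; exact powerMoment_zero_pos hα b
  have : 0 < Real.sqrt (κ 2) := Real.sqrt_pos.2 hκ2
  have hq := effectiveLength_pos hα b
  obtain ⟨x, hx⟩ : ∃ x, x = Real.sqrt (κ 2) * ρ / effectiveLength α b := ⟨_, rfl⟩
  have hx0 : 0 < x := by rw [hx]; positivity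
  have hxκ : x⁻¹ = κ 2 ^ (1 / (2 - α) - 1 / 2) / ρ := by
    rw [hx, inv_div, hκ 0, effectiveLength_div hα]
  have hxρ : x⁻¹ ≤ ρ⁻¹ := by
    rw [hxκ, hκ 0, div_eq_mul_inv]
    exact mul_le_of_le_one_left (by positivity) (powerMoment_zero_rpow_le_one hα0.le hα hb)
  have hcumulant : ∀ n, 3 ≤ n → |scaledCumulant κ ρ n| ≤ (A * x⁻¹) ^ (n - 2) := fun n hn => by
    rw [hx, inv_div]; exact hscaled κ ρ b (by positivity) hb hκ n (by omega)
  have hsmall : C' * (A * x⁻¹) * Real.sqrt k ≤ 1 :=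
    calc C' * (A * x⁻¹) * Real.sqrt k ≤ C' * (A * ρ⁻¹) * Real.sqrt k := by gcongr
      _ = C' * A * Real.sqrt k / ρ := by ring
      _ ≤ 1 := (div_le_one (by positivity)).2 hk
  refine ⟨hfactor κ ρ _ hκ2 (by positivity) hcumulant k hsmall, ?_⟩
  have hset : 8 * (A * x⁻¹) * (Real.sqrt (κ 2) * ρ) = 8 * A * effectiveLength α b := by
    rw [hx]; field_simp
  have herr := hexpand α hα0 hα κ ρ _ b (by positivity) (by positivity) hκ hcumulant k
  rw [hset, show C * D ^ k * (k : ℝ) ^ ((k : ℝ) / 2) * (A * x⁻¹) ^ (k + 1) =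
    C * A * (D * A) ^ k * (k : ℝ) ^ ((k : ℝ) / 2) * x⁻¹ ^ (k + 1) by ring] at herr
  rw [← hxκ]
  refine herr.trans (add_le_mul_max_pow_mul (by positivity) (by positivity) hI hC₀.le
    (by positivity) (by positivity) (by positivity) (E := Real.exp (-(c * x ^ 2))) ?_ ?_)
  · rw [inv_inv, hκ 0]; exact htail b ρ x hb hρ (by rw [hx, hκ 0])
  · rw [inv_inv, Real.exp_neg, ← div_eq_mul_inv, div_le_iff₀ (Real.exp_pos _)]
    exact hpow k x hx0.le

end TiltLeft

end Expansion

section LevyExponent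

variable {α : ℝ}

/-- The Lévy exponent `z ↦ ∫ (exp (z u) - 1) / u ^ 2` of the jump measure whose second moment
density is the power law. -/
noncomputable def complexLevyExponent (α : ℝ) (z : ℂ) : ℂ :=
  ∫ u : ℝ, (Complex.exp (z * u) - 1) / (u : ℂ) ^ 2 ∂(powerLaw α)

/-- The Lévy exponent on the real axis. -/
noncomputable def levyExponent (α b : ℝ) : ℝ :=
  ∫ u, (Real.exp (b * u) - 1) / u ^ 2 ∂(powerLaw α)

/-- The derivative of `levyExponent`: the mean of the law obtained by tilting with parameter `b`. -/
noncomputable def levyMean (α b : ℝ) : ℝ :=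
  ∫ u, u⁻¹ * Real.exp (b * u) ∂(powerLaw α)

theorem complexLevyExponent_ofReal (b : ℝ) : complexLevyExponent α b = levyExponent α b := by
  rw [complexLevyExponent, levyExponent, ← integral_complex_ofReal]
  push_cast
  rfl

theorem norm_exp_mul_sub_one_le (z : ℂ) {x : ℝ} (hx₀ : 0 ≤ x) (hx₁ : x ≤ 1) :
    ‖Complex.exp (z * x) - 1‖ ≤ ‖z‖ * Real.exp ‖z‖ * x := by
  have hzx : ‖z * x‖ = ‖z‖ * x := by
    rw [norm_mul, Complex.norm_real, Real.norm_of_nonneg hx₀]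
  calc ‖Complex.exp (z * x) - 1‖ ≤ ‖z * x‖ * Real.exp ‖z * x‖ := by
        simpa using Complex.norm_exp_sub_sum_le_norm_mul_exp (z * x) 1
    _ ≤ ‖z‖ * x * Real.exp ‖z‖ := by
        rw [hzx]
        gcongr
        exact mul_le_of_le_one_right (norm_nonneg _) hx₁
    _ = _ := by ring

theorem integrable_inv_mul_exp (hα : α < 1) (b : ℝ) :
    Integrable (fun u : ℝ => u⁻¹ * Real.exp (b * u)) (powerLaw α) := by
  refine ((integrable_inv_powerLaw hα).norm.mul_const (Real.exp |b|)).mono'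
    ((integrable_inv_powerLaw hα).1.mul (Continuous.aestronglyMeasurable (by fun_prop)))
    (ae_powerLaw.mono fun u hu => ?_)
  rw [norm_mul, Real.norm_of_nonneg (Real.exp_pos _).le]
  exact mul_le_mul_of_nonneg_left (exp_mul_le hu) (norm_nonneg _)

theorem integrable_complexLevyExponent (hα : α < 1) (z : ℂ) :
    Integrable (fun u : ℝ => (Complex.exp (z * u) - 1) / (u : ℂ) ^ 2) (powerLaw α) := by
  refine ((integrable_inv_powerLaw hα).const_mul (‖z‖ * Real.exp ‖z‖)).mono'
    (Measurable.aestronglyMeasurable (by fun_prop)) (ae_powerLaw.mono fun u hu => ?_)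
  have hu₀ := hu.1
  rw [norm_div, norm_pow, Complex.norm_real, Real.norm_of_nonneg hu₀.le]
  calc _ ≤ ‖z‖ * Real.exp ‖z‖ * u / u ^ 2 := by
        gcongr
        exact norm_exp_mul_sub_one_le z hu₀.le hu.2
    _ = _ := by field_simp

theorem integrable_levyExponent (hα : α < 1) (b : ℝ) :
    Integrable (fun u : ℝ => (Real.exp (b * u) - 1) / u ^ 2) (powerLaw α) := by
  refine (integrable_complexLevyExponent hα b).re.congr (Filter.Eventually.of_forall fun u => ?_)
  simp only [RCLike.re_to_complex]
  norm_cast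

theorem centredExponent_eq (hα : α < 1) (b t : ℝ) :
    centredExponent α b t = complexLevyExponent α (b + t * Complex.I) - levyExponent α b -
      t * Complex.I * levyMean α b := by
  have hmean : Integrable (fun u : ℝ => t * Complex.I * ((u⁻¹ * Real.exp (b * u) : ℝ) : ℂ))
      (powerLaw α) := (integrable_inv_mul_exp hα b).ofReal.const_mul _
  have hdiff : Integrable (fun u : ℝ => (Complex.exp ((b + t * Complex.I) * u) - 1) / (u : ℂ) ^ 2 -
      (Complex.exp (b * u) - 1) / (u : ℂ) ^ 2) (powerLaw α) :=
    (integrable_complexLevyExponent hα _).sub (integrable_complexLevyExponent hα _)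
  rw [← complexLevyExponent_ofReal, complexLevyExponent, complexLevyExponent, levyMean,
    ← integral_complex_ofReal, ← integral_const_mul,
    ← integral_sub (integrable_complexLevyExponent hα _) (integrable_complexLevyExponent hα _),
    ← integral_sub hdiff hmean, centredExponent]
  refine integral_congr_ae (ae_powerLaw.mono fun u hu => ?_)
  have hu₀ : (u : ℂ) ≠ 0 := by exact_mod_cast hu.1.ne'
  have hexp : Complex.exp ((b + t * Complex.I) * u) =
      Complex.exp (b * u) * Complex.exp (Complex.I * (t * u)) := by
    rw [← Complex.exp_add]
    ring_nf
  simp only [centredKernel, hexp]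
  push_cast
  field_simp
  ring

theorem hasDerivAt_integral_powerLaw {G : ℝ → ℝ → ℝ} {w : ℝ → ℝ}
    (hG : ∀ b, Integrable (G b) (powerLaw α)) (hw : Integrable w (powerLaw α))
    (hderiv : ∀ u ∈ Ioc (0 : ℝ) 1, ∀ b, HasDerivAt (G · u) (w u * Real.exp (b * u)) b) (b : ℝ) :
    HasDerivAt (fun b => ∫ u, G b u ∂(powerLaw α))
      (∫ u, w u * Real.exp (b * u) ∂(powerLaw α)) b := by
  refine (hasDerivAt_integral_of_dominated_loc_of_deriv_le (Metric.ball_mem_nhds b one_pos)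
    (Filter.Eventually.of_forall fun x => (hG x).1) (hG b)
    (F' := fun b u => w u * Real.exp (b * u))
    (hw.1.mul (Continuous.aestronglyMeasurable (by fun_prop)))
    (bound := fun u => ‖w u‖ * Real.exp (|b| + 1)) ?_ (hw.norm.mul_const _)
    (ae_powerLaw.mono fun u hu x _ => hderiv u hu x)).2
  refine ae_powerLaw.mono fun u hu x hx => ?_
  rw [norm_mul, Real.norm_of_nonneg (Real.exp_pos _).le]
  refine mul_le_mul_of_nonneg_left ((exp_mul_le hu).trans (Real.exp_le_exp.2 ?_)) (norm_nonneg _)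
  rw [Metric.mem_ball, Real.dist_eq] at hx
  linarith [abs_sub_abs_le_abs_sub x b]

theorem hasDerivAt_exp_mul (u b : ℝ) :
    HasDerivAt (fun b => Real.exp (b * u)) (Real.exp (b * u) * u) b := by
  simpa using ((hasDerivAt_id b).mul_const u).exp

theorem hasDerivAt_levyExponent (hα : α < 1) (b : ℝ) :
    HasDerivAt (levyExponent α) (levyMean α b) b := by
  refine hasDerivAt_integral_powerLaw (integrable_levyExponent hα) (integrable_inv_powerLaw hα)
    (fun u hu b => ?_) b
  have hu₀ := hu.1.ne'
  refine (((hasDerivAt_exp_mul u b).sub_const 1).div_const (u ^ 2)).congr_deriv ?_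
  field_simp

theorem hasDerivAt_powerMoment (hα : α < 2) (n : ℕ) (b : ℝ) :
    HasDerivAt (powerMoment α n) (powerMoment α (n + 1) b) b := by
  refine hasDerivAt_integral_powerLaw (integrable_pow_mul_exp hα n) (w := fun u => u ^ (n + 1))
    (by simpa using integrable_pow_mul_exp hα (n + 1) 0) (fun u _ b => ?_) b
  refine ((hasDerivAt_exp_mul u b).const_mul (u ^ n)).congr_deriv ?_
  ring

theorem hasDerivAt_levyMean (hα : α < 1) (b : ℝ) :
    HasDerivAt (levyMean α) (powerMoment α 0 b) b := by
  have : IsProbabilityMeasure (powerLaw α) := isProbabilityMeasure_powerLaw (by linarith)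
  refine hasDerivAt_integral_powerLaw (w := fun u => u ^ 0) (integrable_inv_mul_exp hα)
    (by simp) (fun u hu b => ?_) b
  have hu₀ := hu.1.ne'
  refine ((hasDerivAt_exp_mul u b).const_mul u⁻¹).congr_deriv ?_
  field_simp

theorem levyMean_zero_add_le (hα : α < 1) (b : ℝ) : levyMean α 0 + b ≤ levyMean α b := by
  have : IsProbabilityMeasure (powerLaw α) := isProbabilityMeasure_powerLaw (by linarith)
  have hzero := integrable_inv_mul_exp hα 0
  calc levyMean α 0 + b = ∫ u, (u⁻¹ * Real.exp (0 * u) + b) ∂(powerLaw α) := by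
        rw [integral_add hzero (integrable_const _)]
        simp [levyMean]
    _ ≤ levyMean α b := by
        refine integral_mono_ae (hzero.add (integrable_const _)) (integrable_inv_mul_exp hα b)
          (ae_powerLaw.mono fun u hu => ?_)
        have hu₀ := hu.1
        calc u⁻¹ * Real.exp (0 * u) + b = u⁻¹ * (b * u + 1) := by
              rw [zero_mul, Real.exp_zero]
              field_simp
              ring
          _ ≤ u⁻¹ * Real.exp (b * u) := by
              gcongr
              exact Real.add_one_le_exp _

theorem tendsto_levyMean_atBot (hα : α < 1) :
    Filter.Tendsto (levyMean α) Filter.atBot (nhds 0) := by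
  suffices h : Filter.Tendsto (levyMean α) Filter.atBot (nhds (∫ _, (0 : ℝ) ∂(powerLaw α))) by
    simpa using h
  refine tendsto_integral_filter_of_dominated_convergence (fun u => ‖u⁻¹‖)
    (Filter.Eventually.of_forall fun b => (integrable_inv_mul_exp hα b).1) ?_
    (integrable_inv_powerLaw hα).norm (ae_powerLaw.mono fun u hu => ?_)
  · filter_upwards [Filter.eventually_le_atBot 0] with b hb
    refine ae_powerLaw.mono fun u hu => ?_
    rw [norm_mul, Real.norm_of_nonneg (Real.exp_pos _).le]
    exact mul_le_of_le_one_right (norm_nonneg _)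
      (Real.exp_le_one_iff.2 (mul_nonpos_of_nonpos_of_nonneg hb hu.1.le))
  · simpa using (Real.tendsto_exp_atBot.comp
      (Filter.tendsto_id.atBot_mul_const hu.1)).const_mul u⁻¹

theorem exists_levyMean_eq (hα : α < 1) {v : ℝ} (hv : 0 < v) : ∃ b, levyMean α b = v := by
  have hcont : Continuous (levyMean α) :=
    continuous_iff_continuousAt.2 fun b => (hasDerivAt_levyMean hα b).continuousAt
  have hzero : 0 ≤ levyMean α 0 := integral_nonneg_of_ae (ae_powerLaw.mono fun u hu =>
    mul_nonneg (inv_nonneg.2 hu.1.le) (Real.exp_pos _).le)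
  refine mem_range_of_exists_le_of_exists_ge hcont ?_ ⟨v, ?_⟩
  · exact ((tendsto_levyMean_atBot hα).eventually_le_const hv).exists
  · linarith [levyMean_zero_add_le hα v]

/-- The cumulant generating function of the normalised noise. -/
noncomputable def noiseCgf (α ρ x : ℝ) : ℝ :=
  ρ ^ 2 * levyExponent α (x / ρ) - x * (ρ * levyMean α 0)

/-- The mean of the normalised noise after tilting with parameter `x`. -/
noncomputable def tiltedMean (α ρ x : ℝ) : ℝ :=
  ρ * (levyMean α (x / ρ) - levyMean α 0)

variable {ρ : ℝ}

theorem hasDerivAt_noiseCgf (hα : α < 1) (hρ : 0 < ρ) (x : ℝ) :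
    HasDerivAt (noiseCgf α ρ) (tiltedMean α ρ x) x := by
  have hexponent := (hasDerivAt_levyExponent hα (x / ρ)).comp x ((hasDerivAt_id x).div_const ρ)
  refine ((hexponent.const_mul (ρ ^ 2)).sub
    ((hasDerivAt_id x).mul_const (ρ * levyMean α 0))).congr_deriv ?_
  rw [tiltedMean]
  field_simp

theorem hasDerivAt_tiltedMean (hα : α < 1) (hρ : 0 < ρ) (x : ℝ) :
    HasDerivAt (tiltedMean α ρ) (powerMoment α 0 (x / ρ)) x := by
  have hmean := (hasDerivAt_levyMean hα (x / ρ)).comp x ((hasDerivAt_id x).div_const ρ)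
  refine ((hmean.sub_const (levyMean α 0)).const_mul ρ).congr_deriv ?_
  field_simp

theorem iteratedDeriv_noiseCgf (hα : α < 1) (hρ : 0 < ρ) (n : ℕ) :
    iteratedDeriv (n + 2) (noiseCgf α ρ) = fun x => powerMoment α n (x / ρ) / ρ ^ n := by
  induction n with
  | zero =>
    rw [iteratedDeriv_succ, iteratedDeriv_one,
      funext fun x => (hasDerivAt_noiseCgf hα hρ x).deriv]
    funext x
    simpa using (hasDerivAt_tiltedMean hα hρ x).deriv
  | succ n ih =>
    rw [iteratedDeriv_succ, ih]
    funext x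
    have hmoment := (hasDerivAt_powerMoment (show α < 2 by linarith) n (x / ρ)).comp x
      ((hasDerivAt_id x).div_const ρ)
    refine ((hmoment.div_const (ρ ^ n)).congr_deriv ?_).deriv
    rw [pow_succ]
    field_simp

theorem tiltedMean_zero : tiltedMean α ρ 0 = 0 := by
  simp [tiltedMean]

theorem strictMono_tiltedMean (hα : α < 1) (hρ : 0 < ρ) : StrictMono (tiltedMean α ρ) :=
  strictMono_of_hasDerivAt_pos (hasDerivAt_tiltedMean hα hρ)
    fun x => powerMoment_zero_pos (by linarith) (x / ρ)

theorem tiltedMean_nonneg_iff (hα : α < 1) (hρ : 0 < ρ) {x : ℝ} :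
    0 ≤ tiltedMean α ρ x ↔ 0 ≤ x := by
  simpa only [tiltedMean_zero] using (strictMono_tiltedMean hα hρ).le_iff_le (a := 0) (b := x)

theorem tiltedMean_nonpos_iff (hα : α < 1) (hρ : 0 < ρ) {x : ℝ} :
    tiltedMean α ρ x ≤ 0 ↔ x ≤ 0 := by
  simpa only [tiltedMean_zero] using (strictMono_tiltedMean hα hρ).le_iff_le (a := x) (b := 0)

theorem exists_tiltedMean_eq (hα : α < 1) (hρ : 0 < ρ) {y : ℝ} (hy : -(ρ * levyMean α 0) < y) :
    ∃ x, tiltedMean α ρ x = y := by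
  have hpos : 0 < y / ρ + levyMean α 0 := by
    rw [← neg_lt_iff_pos_add, lt_div_iff₀ hρ]
    linarith
  obtain ⟨b, hb⟩ := exists_levyMean_eq hα hpos
  refine ⟨ρ * b, ?_⟩
  rw [tiltedMean, mul_div_cancel_left₀ b hρ.ne', hb]
  field_simp
  ring

theorem isMinOn_noiseCgf_sub_iff (hα : α < 1) (hρ : 0 < ρ) {x y : ℝ} :
    IsMinOn (fun x => noiseCgf α ρ x - x * y) univ x ↔ tiltedMean α ρ x = y := by
  have hderiv (x : ℝ) : HasDerivAt (fun x => noiseCgf α ρ x - x * y) (tiltedMean α ρ x - y) x :=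
    ((hasDerivAt_noiseCgf hα hρ x).sub ((hasDerivAt_id x).mul_const y)).congr_deriv (by simp)
  constructor
  · intro hmin
    exact sub_eq_zero.1 ((hmin.isLocalMin Filter.univ_mem).hasDerivAt_eq_zero (hderiv x))
  · rintro rfl
    have hmono := (strictMono_tiltedMean hα hρ).monotone
    refine isMinOn_univ_of_deriv (hderiv x).continuousAt
      (fun z _ => (hderiv z).differentiableAt.differentiableWithinAt)
      (fun z _ => (hderiv z).differentiableAt.differentiableWithinAt)
      (fun z hz => ?_) (fun z hz => ?_)
    · rw [(hderiv z).deriv]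
      exact sub_nonpos.2 (hmono (le_of_lt hz))
    · rw [(hderiv z).deriv]
      exact sub_nonneg.2 (hmono (le_of_lt hz))

end LevyExponent

section Radii

variable {Ω : Type*} {d : ℕ} {Φ : Ω → Set (EuclideanSpace ℝ (Fin d))} {ω : Ω}

theorem count_closedBall_mono {x y : ℝ} (h : x ≤ y) :
    count Φ (Metric.closedBall 0 x) ω ≤ count Φ (Metric.closedBall 0 y) ω :=
  encard_le_encard (inter_subset_inter_right _ (Metric.closedBall_subset_closedBall h))

theorem radius_le {k : ℕ} {x : ℝ} (hx : 0 ≤ x)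
    (hk : (k : ℕ∞) ≤ count Φ (Metric.closedBall 0 x) ω) : radius Φ k ω ≤ x :=
  csInf_le ⟨0, fun _ hy => hy.1⟩ ⟨hx, hk⟩

theorem le_count_closedBall_radius (hfin : ∀ x : ℝ, (Φ ω ∩ Metric.closedBall 0 x).Finite) {k : ℕ}
    (hne : ∃ x : ℝ, 0 ≤ x ∧ (k : ℕ∞) ≤ count Φ (Metric.closedBall 0 x) ω) :
    (k : ℕ∞) ≤ count Φ (Metric.closedBall 0 (radius Φ k ω)) ω := by
  set R := radius Φ k ω
  have houter : (Φ ω ∩ Metric.closedBall 0 (R + 1) ∩ {p | R < ‖p‖}).Finite :=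
    (hfin (R + 1)).subset inter_subset_left
  have hlt : ∀ p ∈ Φ ω ∩ Metric.closedBall 0 (R + 1) ∩ {p | R < ‖p‖}, ∀ᶠ x in nhds R, x < ‖p‖ :=
    fun p hp => Iio_mem_nhds hp.2
  obtain ⟨ε, hε, hgap⟩ :=
    Metric.eventually_nhds_iff.1 ((Filter.eventually_all_finite houter).2 hlt)
  obtain ⟨x, ⟨hx0, hxk⟩, hx⟩ := exists_lt_of_csInf_lt (s := {x : ℝ | 0 ≤ x ∧
    (k : ℕ∞) ≤ count Φ (Metric.closedBall 0 x) ω}) hne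
    (lt_add_of_pos_right R (lt_min hε one_pos))
  obtain ⟨hxε, hx1⟩ : x < R + ε ∧ x < R + 1 := by
    rwa [← lt_min_iff, min_add_add_left]
  have : R ≤ x := radius_le hx0 hxk
  refine hxk.trans (encard_le_encard fun p hp => ⟨hp.1, ?_⟩)
  have hpx := mem_closedBall_zero_iff.1 hp.2
  rw [mem_closedBall_zero_iff]
  by_contra hRp
  exact (hgap (y := x) (by rw [Real.dist_eq, abs_of_nonneg (by linarith)]; linarith) p
    ⟨⟨hp.1, mem_closedBall_zero_iff.2 (by linarith)⟩, not_le.1 hRp⟩).not_ge hpx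

theorem radius_mem_Ioc_iff (hfin : ∀ x : ℝ, (Φ ω ∩ Metric.closedBall 0 x).Finite) {k : ℕ}
    {a b : ℝ} (ha : 0 ≤ a) (hb : 0 ≤ b) :
    radius Φ k ω ∈ Ioc a b ↔ count Φ (Metric.closedBall 0 a) ω < k ∧
      (k : ℕ∞) ≤ count Φ (Metric.closedBall 0 b) ω := by
  constructor
  · rintro ⟨hak, hkb⟩
    have hne : ∃ x : ℝ, 0 ≤ x ∧ (k : ℕ∞) ≤ count Φ (Metric.closedBall 0 x) ω := by
      by_contra! hempty
      have : {x : ℝ | 0 ≤ x ∧ (k : ℕ∞) ≤ count Φ (Metric.closedBall 0 x) ω} = ∅ :=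
        eq_empty_iff_forall_notMem.2 fun x hx => (hempty x hx.1).not_ge hx.2
      rw [radius, this, Real.sInf_empty] at hak
      exact ha.not_gt hak
    exact ⟨not_le.1 fun hk => (radius_le ha hk).not_gt hak,
      (le_count_closedBall_radius hfin hne).trans (count_closedBall_mono hkb)⟩
  · rintro ⟨hak, hkb⟩
    refine ⟨not_le.1 fun hle => hak.not_ge ?_, radius_le hb hkb⟩
    exact (le_count_closedBall_radius hfin ⟨b, hb, hkb⟩).trans (count_closedBall_mono hle)

theorem hasSum_indicator_radius (hfin : ∀ x : ℝ, (Φ ω ∩ Metric.closedBall 0 x).Finite)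
    {a b : ℝ} (ha : 0 ≤ a) (hab : a ≤ b) :
    HasSum (fun k : ℕ => (Ioc a b).indicator (fun _ => (1 : ℝ)) (radius Φ (k + 1) ω))
      ((count Φ (Metric.closedBall 0 b \ Metric.closedBall 0 a) ω).toNat : ℝ) := by
  set m := (Φ ω ∩ Metric.closedBall 0 a).ncard
  set n := (Φ ω ∩ Metric.closedBall 0 b).ncard
  have hcount : (count Φ (Metric.closedBall 0 b \ Metric.closedBall 0 a) ω).toNat = n - m := by
    rw [count, inter_sdiff_distrib_left]
    exact ncard_sdiff (inter_subset_inter_right _ (Metric.closedBall_subset_closedBall hab))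
      (hfin a)
  have hmem : ∀ k : ℕ, radius Φ (k + 1) ω ∈ Ioc a b ↔ k ∈ Finset.Ico m n := fun k => by
    rw [radius_mem_Ioc_iff hfin ha (ha.trans hab), count, count, ← (hfin a).cast_ncard_eq,
      ← (hfin b).cast_ncard_eq, Finset.mem_Ico, Nat.cast_lt, Nat.cast_le]
    omega
  have hsum := hasSum_sum_of_ne_finset_zero (L := SummationFilter.unconditional ℕ)
    (f := fun k : ℕ => (Ioc a b).indicator (fun _ => (1 : ℝ)) (radius Φ (k + 1) ω))
    (s := Finset.Ico m n) (fun k hk => indicator_of_notMem (fun h => hk ((hmem k).1 h)) _)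
  rw [Finset.sum_congr rfl fun k hk => indicator_of_mem ((hmem k).2 hk) _, Finset.sum_const,
    Nat.card_Ico, ← hcount, nsmul_one] at hsum
  exact hsum

end Radii

section Grid

/-- The `i`-th point of the grid of mesh `1 / (m + 1)` that starts at `r`. -/
noncomputable def gridPoint (r : ℝ) (m i : ℕ) : ℝ := r + i / (m + 1)

/-- The step function that approximates `x ↦ x ^ (-γ)` on `(r, ∞)` from below, with the value at the
right end of each grid interval. It is supported on `(r, r + m + 1]`. -/
noncomputable def stepFun (γ r : ℝ) (m : ℕ) (x : ℝ) : ℝ :=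
  ∑ i : Fin ((m + 1) ^ 2), gridPoint r m (i + 1) ^ (-γ) *
    (Ioc (gridPoint r m i) (gridPoint r m (i + 1))).indicator (fun _ => (1 : ℝ)) x

variable {γ r : ℝ} {m : ℕ}

theorem gridPoint_mono : Monotone (gridPoint r m) := fun i j h => by
  unfold gridPoint; gcongr

theorem le_gridPoint (i : ℕ) : r ≤ gridPoint r m i := by
  unfold gridPoint
  have : (0 : ℝ) ≤ i / (m + 1) := by positivity
  linarith

theorem mem_Ioc_gridPoint_iff {i : ℕ} {x : ℝ} :
    x ∈ Ioc (gridPoint r m i) (gridPoint r m (i + 1)) ↔ ⌈(x - r) * (m + 1)⌉₊ = i + 1 := by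
  have hm : (0 : ℝ) < m + 1 := by positivity
  rw [Nat.ceil_eq_iff (by omega), Nat.add_sub_cancel, mem_Ioc, gridPoint, gridPoint,
    ← lt_sub_iff_add_lt', ← sub_le_iff_le_add', div_lt_iff₀ hm, le_div_iff₀ hm]

theorem stepFun_eq (x : ℝ) : stepFun γ r m x =
    if r < x ∧ ⌈(x - r) * (m + 1)⌉₊ ≤ (m + 1) ^ 2 then
      gridPoint r m ⌈(x - r) * (m + 1)⌉₊ ^ (-γ) else 0 := by
  have hpos : r < x ↔ 0 < ⌈(x - r) * (m + 1)⌉₊ := by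
    rw [Nat.ceil_pos, mul_pos_iff_of_pos_right (by positivity), sub_pos]
  simp only [stepFun, indicator_apply, mem_Ioc_gridPoint_iff, hpos]
  generalize ⌈(x - r) * (m + 1)⌉₊ = n
  split_ifs with h
  · rw [Finset.sum_eq_single (⟨n - 1, by omega⟩ : Fin ((m + 1) ^ 2))]
    · simp [Nat.sub_add_cancel h.1]
    · intro i _ hi
      rw [if_neg, mul_zero]
      rintro rfl
      exact hi (Fin.ext (by simp))
    · simp
  · refine Finset.sum_eq_zero fun i _ => ?_
    rw [if_neg, mul_zero]
    rintro rfl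
    exact h ⟨by omega, i.2⟩

theorem le_gridPoint_ceil (x : ℝ) : x ≤ gridPoint r m ⌈(x - r) * (m + 1)⌉₊ := by
  rw [gridPoint, ← sub_le_iff_le_add', le_div_iff₀ (by positivity)]
  exact Nat.le_ceil _

theorem gridPoint_ceil_le {x : ℝ} (hx : r ≤ x) :
    gridPoint r m ⌈(x - r) * (m + 1)⌉₊ ≤ x + 1 / ((m : ℝ) + 1) := by
  have hm : (0 : ℝ) < m + 1 := by positivity
  rw [gridPoint, ← le_sub_iff_add_le', div_le_iff₀ hm]
  refine (Nat.ceil_lt_add_one (mul_nonneg (sub_nonneg.2 hx) hm.le)).le.trans (le_of_eq ?_)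
  field_simp
  ring

theorem tendsto_gridPoint_ceil {x : ℝ} (hx : r ≤ x) :
    Filter.Tendsto (fun m : ℕ => gridPoint r m ⌈(x - r) * (m + 1)⌉₊) Filter.atTop (nhds x) := by
  have hupper : Filter.Tendsto (fun m : ℕ => x + 1 / ((m : ℝ) + 1)) Filter.atTop (nhds x) := by
    simpa using tendsto_const_nhds.add (tendsto_one_div_add_atTop_nhds_zero_nat (𝕜 := ℝ))
  exact tendsto_of_tendsto_of_tendsto_of_le_of_le tendsto_const_nhds hupper
    (fun _ => le_gridPoint_ceil x) (fun _ => gridPoint_ceil_le hx)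

theorem stepFun_nonneg (hr : 0 ≤ r) (x : ℝ) : 0 ≤ stepFun γ r m x := by
  rw [stepFun_eq]
  split_ifs
  · exact Real.rpow_nonneg (hr.trans (le_gridPoint _)) _
  · rfl

theorem stepFun_le (hγ : 0 ≤ γ) (hr : 0 ≤ r) (x : ℝ) :
    stepFun γ r m x ≤ if r < x then x ^ (-γ) else 0 := by
  rw [stepFun_eq]
  by_cases hx : r < x
  · have hx0 : 0 < x := hr.trans_lt hx
    rw [if_pos hx]
    split_ifs
    · exact Real.rpow_le_rpow_of_nonpos hx0 (le_gridPoint_ceil x) (neg_nonpos.2 hγ)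
    · positivity
  · simp [hx]

theorem tendsto_stepFun (hr : 0 ≤ r) (x : ℝ) :
    Filter.Tendsto (fun m => stepFun γ r m x) Filter.atTop
      (nhds (if r < x then x ^ (-γ) else 0)) := by
  by_cases hx : r < x
  · rw [if_pos hx]
    refine ((tendsto_gridPoint_ceil hx.le).rpow_const (Or.inl (hr.trans_lt hx).ne')).congr' ?_
    filter_upwards [Filter.eventually_ge_atTop ⌈x - r⌉₊] with m hm
    have hcovered : ⌈(x - r) * (m + 1)⌉₊ ≤ (m + 1) ^ 2 := by
      have hxm : x - r ≤ m := Nat.ceil_le.1 hm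
      rw [Nat.ceil_le, sq]
      push_cast
      gcongr
      linarith
    rw [stepFun_eq, if_pos ⟨hx, hcovered⟩]
  · simp [stepFun_eq, hx]

theorem measurable_stepFun : Measurable (stepFun γ r m) :=
  Finset.measurable_sum _ fun _ _ =>
    (measurable_const.indicator measurableSet_Ioc).const_mul _

variable {Ω : Type*} {d : ℕ} {Φ : Ω → Set (EuclideanSpace ℝ (Fin d))} {ω : Ω}

/-- The set of points whose norm lies between two consecutive points of the grid. -/
def shell (d : ℕ) (r : ℝ) (m i : ℕ) : Set (EuclideanSpace ℝ (Fin d)) :=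
  Metric.closedBall 0 (gridPoint r m (i + 1)) \ Metric.closedBall 0 (gridPoint r m i)

/-- The tail noise with `x ↦ x ^ (-γ)` replaced by its step function `stepFun`, written through the
numbers of points in the shells so that its law can be read off from the Poisson counts. -/
noncomputable def stepNoise (Φ : Ω → Set (EuclideanSpace ℝ (Fin d))) (γ r : ℝ) (m : ℕ)
    (ω : Ω) : ℝ :=
  ∑ i : Fin ((m + 1) ^ 2), gridPoint r m (i + 1) ^ (-γ) * ((count Φ (shell d r m i) ω).toNat : ℝ)

theorem hasSum_stepFun_radius (hr : 0 ≤ r)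
    (hfin : ∀ x : ℝ, (Φ ω ∩ Metric.closedBall 0 x).Finite) :
    HasSum (fun k : ℕ => stepFun γ r m (radius Φ (k + 1) ω)) (stepNoise Φ γ r m ω) :=
  hasSum_sum fun i _ => (hasSum_indicator_radius hfin (hr.trans (le_gridPoint i))
    (gridPoint_mono (Nat.le_succ _))).mul_left _

theorem stepNoise_nonneg (hr : 0 ≤ r) : 0 ≤ stepNoise Φ γ r m ω :=
  Finset.sum_nonneg fun _ _ => mul_nonneg (Real.rpow_nonneg (hr.trans (le_gridPoint _)) _)
    (Nat.cast_nonneg _)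

theorem tailTerm_nonneg (hr : 0 ≤ r) (k : ℕ) : 0 ≤ tailTerm Φ γ r k ω := by
  unfold tailTerm
  split_ifs with h
  · exact Real.rpow_nonneg (by linarith) _
  · rfl

theorem summable_tailTerm (hr : 0 ≤ r)
    (hfin : ∀ x : ℝ, (Φ ω ∩ Metric.closedBall 0 x).Finite) {M : ℝ}
    (hM : ∃ᶠ m in Filter.atTop, stepNoise Φ γ r m ω ≤ M) :
    Summable (fun k : ℕ => tailTerm Φ γ r (k + 1) ω) := by
  refine summable_of_sum_le (c := M) (fun k => tailTerm_nonneg hr _) fun u => ?_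
  have hlim : Filter.Tendsto (fun m => ∑ k ∈ u, stepFun γ r m (radius Φ (k + 1) ω)) Filter.atTop
      (nhds (∑ k ∈ u, tailTerm Φ γ r (k + 1) ω)) :=
    tendsto_finsetSum _ fun k _ => tendsto_stepFun hr _
  refine le_of_tendsto_of_frequently hlim (hM.mono fun m hm => le_trans ?_ hm)
  exact sum_le_hasSum u (fun k _ => stepFun_nonneg hr _) (hasSum_stepFun_radius hr hfin)

theorem stepNoise_le_tailNoise (hγ : 0 ≤ γ) (hr : 0 ≤ r)
    (hfin : ∀ x : ℝ, (Φ ω ∩ Metric.closedBall 0 x).Finite)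
    (hs : Summable (fun k : ℕ => tailTerm Φ γ r (k + 1) ω)) :
    stepNoise Φ γ r m ω ≤ tailNoise Φ γ r ω :=
  hasSum_le (fun _ => stepFun_le hγ hr _) (hasSum_stepFun_radius hr hfin) hs.hasSum

theorem tendsto_stepNoise (hγ : 0 ≤ γ) (hr : 0 ≤ r)
    (hfin : ∀ x : ℝ, (Φ ω ∩ Metric.closedBall 0 x).Finite)
    (hs : Summable (fun k : ℕ => tailTerm Φ γ r (k + 1) ω)) :
    Filter.Tendsto (fun m => stepNoise Φ γ r m ω) Filter.atTop (nhds (tailNoise Φ γ r ω)) := by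
  have h := tendsto_tsum_of_dominated_convergence
    (f := fun (m : ℕ) (k : ℕ) => stepFun γ r m (radius Φ (k + 1) ω)) (𝓕 := Filter.atTop)
    hs (fun k => tendsto_stepFun hr _) (Filter.Eventually.of_forall fun m k => by
      rw [Real.norm_of_nonneg (stepFun_nonneg hr _)]
      exact stepFun_le hγ hr _)
  refine h.congr fun m => (hasSum_stepFun_radius hr hfin).tsum_eq

end Grid

section Radial

variable {E : Type*} [NormedAddCommGroup E] [NormedSpace ℝ E]

theorem integral_rpow_smul_comp_rpow_neg {γ : ℝ} (hγ : 0 < γ) (α : ℝ) (g : ℝ → E) :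
    ∫ x in Ioi (0 : ℝ), x ^ (α * γ - 1) • g (x ^ (-γ)) =
      γ⁻¹ • ∫ v in Ioi (0 : ℝ), v ^ (-α - 1) • g v := by
  rw [← integral_comp_rpow_Ioi (fun v => v ^ (-α - 1) • g v) (neg_ne_zero.2 hγ.ne'),
    ← integral_smul]
  refine setIntegral_congr_fun measurableSet_Ioi fun x (hx : 0 < x) => ?_
  have hexp : x ^ (-γ - 1) * (x ^ (-γ)) ^ (-α - 1) = x ^ (α * γ - 1) := by
    rw [← Real.rpow_mul hx.le, ← Real.rpow_add hx]
    ring_nf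
  simp only [smul_smul]
  rw [abs_neg, abs_of_pos hγ, ← hexp]
  field_simp

theorem integral_powerLaw_comp_mul {α : ℝ} (hα : α ≤ 2) {c : ℝ} (hc : 0 < c) (g : ℝ → E) :
    ∫ u, (u ^ 2)⁻¹ • g (c * u) ∂(powerLaw α) =
      ((2 - α) * c ^ α) • ∫ v in Ioc 0 c, v ^ (-α - 1) • g v := by
  have hscale := intervalIntegral.smul_integral_comp_mul_left (a := 0) (b := 1)
    (fun v => v ^ (-α - 1) • g v) c
  rw [mul_zero, mul_one, intervalIntegral.integral_of_le zero_le_one,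
    intervalIntegral.integral_of_le hc.le] at hscale
  rw [integral_powerLaw hα, ← hscale, smul_smul, ← integral_smul]
  refine setIntegral_congr_fun measurableSet_Ioc fun u hu => ?_
  have hu₀ := hu.1
  have hpow : u ^ (1 - α) = u ^ 2 * u ^ (-α - 1) := by
    rw [← Real.rpow_natCast, ← Real.rpow_add hu₀]
    congr 1
    push_cast
    ring
  have hcancel : c ^ α * c * c ^ (-α - 1) = 1 := by
    rw [Real.rpow_sub_one hc.ne', Real.rpow_neg hc.le]
    field_simp
  simp only [smul_smul]
  rw [Real.mul_rpow hc.le hu₀.le, hpow]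
  congr 1
  field_simp
  linear_combination -(2 - α) * hcancel

variable {d : ℕ} {γ r : ℝ}

theorem integrable_tail_norm (hd : 1 ≤ d) (hγ : (d : ℝ) < γ) (hr : 0 < r) :
    Integrable (fun p : EuclideanSpace ℝ (Fin d) => if r < ‖p‖ then ‖p‖ ^ (-γ) else 0) := by
  have : Nonempty (Fin d) := ⟨⟨0, hd⟩⟩
  rw [integrable_fun_norm_addHaar volume (f := fun x : ℝ => if r < x then x ^ (-γ) else 0),
    finrank_euclideanSpace_fin]
  have htail : IntegrableOn (fun x : ℝ => x ^ ((d : ℝ) - 1 - γ)) (Ioi r) :=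
    integrableOn_Ioi_rpow_of_lt (by linarith) hr
  refine (htail.integrable_indicator measurableSet_Ioi).integrableOn.congr_fun
    (fun x (hx : 0 < x) => ?_) measurableSet_Ioi
  by_cases hxr : r < x
  · rw [indicator_of_mem (mem_Ioi.2 hxr)]
    simp only [if_pos hxr, smul_eq_mul]
    rw [sub_eq_add_neg, Real.rpow_add hx, ← Real.rpow_natCast, Nat.cast_sub hd, Nat.cast_one]
  · rw [indicator_of_notMem (mt mem_Ioi.1 hxr)]
    simp only [if_neg hxr, smul_zero]

theorem intensity_nonneg (hγ : (d : ℝ) < γ) : 0 ≤ intensity d γ :=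
  div_nonneg (by linarith [(Nat.cast_nonneg d : (0 : ℝ) ≤ d)]) measureReal_nonneg

theorem integral_tail_norm (hd : 1 ≤ d) (hγ : 0 < γ) (hr : 0 < r) (g : ℝ → E) :
    ∫ p : EuclideanSpace ℝ (Fin d), (if r < ‖p‖ then g (‖p‖ ^ (-γ)) else 0) =
      (sphereArea d / γ) • ∫ v in Ioc 0 (r ^ (-γ)), v ^ (-(d / γ) - 1) • g v := by
  have : Nonempty (Fin d) := ⟨⟨0, hd⟩⟩
  have hradial : ∫ x in Ioi (0 : ℝ), x ^ (d - 1) • (if r < x then g (x ^ (-γ)) else 0) =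
      γ⁻¹ • ∫ v in Ioi (0 : ℝ), v ^ (-(d / γ) - 1) • (Iio (r ^ (-γ))).indicator g v := by
    rw [← integral_rpow_smul_comp_rpow_neg hγ]
    refine setIntegral_congr_fun measurableSet_Ioi fun x (hx : 0 < x) => ?_
    have hlt : x ^ (-γ) < r ^ (-γ) ↔ r < x := Real.rpow_lt_rpow_iff_of_neg hx hr (by linarith)
    simp only [indicator_apply, mem_Iio, hlt]
    rw [div_mul_cancel₀ _ hγ.ne', ← Real.rpow_natCast, Nat.cast_sub hd, Nat.cast_one]
  have htrunc : ∫ v in Ioi (0 : ℝ), v ^ (-(d / γ) - 1) • (Iio (r ^ (-γ))).indicator g v =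
      ∫ v in Ioc 0 (r ^ (-γ)), v ^ (-(d / γ) - 1) • g v := by
    simp only [← indicator_smul]
    rw [setIntegral_indicator measurableSet_Iio, Ioi_inter_Iio, integral_Ioc_eq_integral_Ioo]
  rw [integral_fun_norm_addHaar volume (fun x : ℝ => if r < x then g (x ^ (-γ)) else 0),
    finrank_euclideanSpace_fin, hradial, htrunc, sphereArea, Measure.toSphere_real_apply_univ,
    finrank_euclideanSpace_fin, ← Nat.cast_smul_eq_nsmul ℝ, smul_smul, smul_smul,
    div_eq_mul_inv (_ * _)]

theorem sphereArea_pos (hd : 1 ≤ d) : 0 < sphereArea d := by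
  have : Nonempty (Fin d) := ⟨⟨0, hd⟩⟩
  have hball : 0 < volume.real (Metric.ball (0 : EuclideanSpace ℝ (Fin d)) 1) :=
    ENNReal.toReal_pos (Metric.measure_ball_pos _ _ one_pos).ne' measure_ball_lt_top.ne
  rw [sphereArea, Measure.toSphere_real_apply_univ, finrank_euclideanSpace_fin]
  positivity

theorem intensity_smul_integral_tail_norm (hd : 1 ≤ d) (hγ : (d : ℝ) < γ) (hr : 0 < r)
    (g : ℝ → E) :
    intensity d γ • ∫ p : EuclideanSpace ℝ (Fin d), (if r < ‖p‖ then g (‖p‖ ^ (-γ)) else 0) =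
      rho d r ^ 2 • ∫ u, (u ^ 2)⁻¹ • g (r ^ (-γ) * u) ∂(powerLaw (d / γ)) := by
  have hγ₀ : 0 < γ := (Nat.cast_nonneg d).trans_lt hγ
  have hα : d / γ < 1 := (div_lt_one hγ₀).2 hγ
  have hrho : rho d r ^ 2 * (r ^ (-γ)) ^ (d / γ) = 1 := by
    rw [rho, ← Real.rpow_natCast, ← Real.rpow_mul hr.le, ← Real.rpow_mul hr.le,
      ← Real.rpow_add hr, ← Real.rpow_zero r]
    congr 1
    push_cast
    field_simp
    ring
  have hintensity : intensity d γ * (sphereArea d / γ) = 2 - d / γ := by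
    have := (sphereArea_pos hd).ne'
    rw [intensity]
    field_simp
  rw [integral_tail_norm hd hγ₀ hr, integral_powerLaw_comp_mul (by linarith)
    (Real.rpow_pos_of_pos hr _), smul_smul, smul_smul, hintensity]
  congr 1
  linear_combination -(2 - d / γ) * hrho

theorem intensity_mul_integral_exp_sub_one (hd : 1 ≤ d) (hγ : (d : ℝ) < γ) (hr : 0 < r) (z : ℂ) :
    (intensity d γ : ℂ) * ∫ p : EuclideanSpace ℝ (Fin d),
        (Complex.exp (z * ((if r < ‖p‖ then ‖p‖ ^ (-γ) else 0 : ℝ) : ℂ)) - 1) =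
      (rho d r : ℂ) ^ 2 * complexLevyExponent (d / γ) (z * (r ^ (-γ) : ℝ)) := by
  have hmain := intensity_smul_integral_tail_norm hd hγ hr fun x : ℝ => Complex.exp (z * x) - 1
  simp only [Complex.real_smul] at hmain
  push_cast at hmain
  rw [complexLevyExponent]
  convert hmain using 5 with p u
  · split_ifs <;> simp
  · rw [div_eq_inv_mul, mul_assoc z]

end Radial

section Fatou

variable {Ω : Type*} [MeasurableSpace Ω] {P : Measure Ω} {f : ℕ → Ω → ℝ} {c : ℝ}

theorem lintegral_liminf_le_of_tendsto_integral (hmeas : ∀ m, Measurable (f m))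
    (hint : ∀ m, Integrable (f m) P) (hnonneg : ∀ m ω, 0 ≤ f m ω)
    (hlim : Filter.Tendsto (fun m => ∫ ω, f m ω ∂P) Filter.atTop (nhds c)) :
    ∫⁻ ω, Filter.liminf (fun m => ENNReal.ofReal (f m ω)) Filter.atTop ∂P ≤ ENNReal.ofReal c := by
  refine (lintegral_liminf_le fun m => (hmeas m).ennreal_ofReal).trans_eq ?_
  refine ((ENNReal.tendsto_ofReal hlim).congr fun m => ?_).liminf_eq
  exact ofReal_integral_eq_lintegral_ofReal (hint m) (Filter.Eventually.of_forall (hnonneg m))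

theorem ae_frequently_le_of_tendsto_integral (hmeas : ∀ m, Measurable (f m))
    (hint : ∀ m, Integrable (f m) P) (hnonneg : ∀ m ω, 0 ≤ f m ω)
    (hlim : Filter.Tendsto (fun m => ∫ ω, f m ω ∂P) Filter.atTop (nhds c)) :
    ∀ᵐ ω ∂P, ∃ M : ℝ, ∃ᶠ m in Filter.atTop, f m ω ≤ M := by
  have hfin := (lintegral_liminf_le_of_tendsto_integral hmeas hint hnonneg hlim).trans_lt
    ENNReal.ofReal_lt_top
  filter_upwards [ae_lt_top (Measurable.liminf fun m => (hmeas m).ennreal_ofReal) hfin.ne] with ω hω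
  obtain ⟨M, hM, -⟩ := ENNReal.lt_iff_exists_nnreal_btwn.1 hω
  refine ⟨M, (Filter.frequently_lt_of_liminf_lt (by isBoundedDefault) hM).mono fun m hm => ?_⟩
  exact (ENNReal.ofReal_le_ofReal_iff M.coe_nonneg).1 (by simpa using hm.le)

theorem integrable_of_tendsto_integral {g : Ω → ℝ} (hmeas : ∀ m, Measurable (f m))
    (hint : ∀ m, Integrable (f m) P) (hnonneg : ∀ m ω, 0 ≤ f m ω)
    (hlim : Filter.Tendsto (fun m => ∫ ω, f m ω ∂P) Filter.atTop (nhds c))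
    (hg : ∀ᵐ ω ∂P, Filter.Tendsto (fun m => f m ω) Filter.atTop (nhds (g ω))) :
    Integrable g P := by
  refine ⟨aestronglyMeasurable_of_tendsto_ae _ (fun m => (hint m).1) hg, ?_⟩
  have hg_nonneg : 0 ≤ᵐ[P] g := hg.mono fun ω hω =>
    ge_of_tendsto hω (Filter.Eventually.of_forall fun m => hnonneg m ω)
  rw [hasFiniteIntegral_iff_ofReal hg_nonneg]
  calc _ = ∫⁻ ω, Filter.liminf (fun m => ENNReal.ofReal (f m ω)) Filter.atTop ∂P :=
        lintegral_congr_ae (hg.mono fun ω hω => (ENNReal.tendsto_ofReal hω).liminf_eq.symm)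
    _ ≤ ENNReal.ofReal c := lintegral_liminf_le_of_tendsto_integral hmeas hint hnonneg hlim
    _ < ⊤ := ENNReal.ofReal_lt_top

end Fatou

section Poisson

theorem integral_exp_mul_poissonMeasure (s : NNReal) (z : ℂ) :
    ∫ n : ℕ, Complex.exp (z * n) ∂(poissonMeasure s) = Complex.exp (s * (Complex.exp z - 1)) := by
  have hseries := (NormedSpace.expSeries_div_hasSum_exp (s * Complex.exp z : ℂ)).mul_left
    (Complex.exp (-s))
  rw [← Complex.exp_eq_exp_ℂ, ← Complex.exp_add] at hseries
  rw [integral_poissonMeasure, show (s : ℂ) * (Complex.exp z - 1) = -s + s * Complex.exp z by ring,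
    ← hseries.tsum_eq]
  refine tsum_congr fun n => ?_
  rw [mul_pow, ← Complex.exp_nat_mul, Complex.real_smul, mul_comm z]
  push_cast
  ring

variable {Ω : Type*} [MeasurableSpace Ω] {P : Measure Ω} {d : ℕ}
  {Φ : Ω → Set (EuclideanSpace ℝ (Fin d))} {lam : ℝ}

theorem IsHomogeneousPoisson.ae_count_ne_top (h : IsHomogeneousPoisson P Φ lam)
    {B : Set (EuclideanSpace ℝ (Fin d))} (hB : MeasurableSet B) (hvol : volume B ≠ ⊤) :
    ∀ᵐ ω ∂P, count Φ B ω ≠ ⊤ := by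
  refine ae_of_ae_map (p := (· ≠ ⊤)) (h.measurable_count B hB).aemeasurable ?_
  rw [h.law_count B hB hvol, ae_map_iff Measurable.of_discrete.aemeasurable .of_discrete]
  exact Filter.Eventually.of_forall fun n => ENat.natCast_ne_top n

theorem IsHomogeneousPoisson.ae_finite (h : IsHomogeneousPoisson P Φ lam) :
    ∀ᵐ ω ∂P, ∀ x : ℝ, (Φ ω ∩ Metric.closedBall 0 x).Finite := by
  have hball (n : ℕ) : ∀ᵐ ω ∂P, count Φ (Metric.closedBall 0 (n : ℝ)) ω ≠ ⊤ :=
    h.ae_count_ne_top Metric.isClosed_closedBall.measurableSet measure_closedBall_lt_top.ne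
  filter_upwards [ae_all_iff.2 hball] with ω hω x
  obtain ⟨n, hn⟩ := exists_nat_ge x
  exact (encard_ne_top_iff.1 (hω n)).subset
    (inter_subset_inter_right _ (Metric.closedBall_subset_closedBall hn))

theorem IsHomogeneousPoisson.integral_exp_sum_count (h : IsHomogeneousPoisson P Φ lam)
    (hlam : 0 ≤ lam) {n : ℕ} {B : Fin n → Set (EuclideanSpace ℝ (Fin d))}
    (hB : ∀ i, MeasurableSet (B i)) (hdisj : Pairwise fun i j => Disjoint (B i) (B j))
    (hvol : ∀ i, volume (B i) ≠ ⊤) (c : Fin n → ℂ) :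
    ∫ ω, Complex.exp (∑ i, c i * ((count Φ (B i) ω).toNat : ℂ)) ∂P =
      Complex.exp (∑ i, (lam * volume.real (B i) : ℝ) * (Complex.exp (c i) - 1)) := by
  have hcount (i : Fin n) : AEMeasurable (count Φ (B i)) P :=
    (h.measurable_count _ (hB i)).aemeasurable
  have hexp (i : Fin n) : AEStronglyMeasurable
      (fun k : ℕ∞ => Complex.exp (c i * (k.toNat : ℂ))) (P.map (count Φ (B i))) :=
    Measurable.of_discrete.aestronglyMeasurable
  simp only [Complex.exp_sum]
  rw [(h.indep_count n B hB hdisj).integral_fun_prod_comp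
    (f := fun i (k : ℕ∞) => Complex.exp (c i * (k.toNat : ℂ))) hcount hexp]
  refine Finset.prod_congr rfl fun i _ => ?_
  rw [← integral_map (hcount i) (hexp i), h.law_count _ (hB i) (hvol i),
    integral_map .of_discrete Measurable.of_discrete.aestronglyMeasurable]
  simp only [ENat.toNat_natCast]
  rw [integral_exp_mul_poissonMeasure, Real.coe_toNNReal _ (by positivity)]

variable {γ r : ℝ}

theorem measurableSet_shell (m i : ℕ) : MeasurableSet (shell d r m i) :=
  Metric.isClosed_closedBall.measurableSet.diff Metric.isClosed_closedBall.measurableSet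

theorem mem_shell_iff {m i : ℕ} {p : EuclideanSpace ℝ (Fin d)} :
    p ∈ shell d r m i ↔ ‖p‖ ∈ Ioc (gridPoint r m i) (gridPoint r m (i + 1)) := by
  simp [shell, and_comm]

theorem volume_shell_ne_top (m i : ℕ) : volume (shell d r m i) ≠ ⊤ :=
  ((measure_mono sdiff_subset).trans_lt measure_closedBall_lt_top).ne

theorem eq_of_mem_shell {m i j : ℕ} {p : EuclideanSpace ℝ (Fin d)} (hi : p ∈ shell d r m i)
    (hj : p ∈ shell d r m j) : i = j := by
  rw [mem_shell_iff, mem_Ioc_gridPoint_iff] at hi hj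
  omega

theorem pairwise_disjoint_shell (m : ℕ) : Pairwise fun i j : Fin ((m + 1) ^ 2) =>
    Disjoint (shell d r m i) (shell d r m j) :=
  fun _ _ hij => disjoint_left.2 fun _ hi hj => hij (Fin.ext (eq_of_mem_shell hi hj))

theorem stepFun_norm_eq (m : ℕ) (p : EuclideanSpace ℝ (Fin d)) :
    stepFun γ r m ‖p‖ = ∑ i : Fin ((m + 1) ^ 2),
      (shell d r m i).indicator (fun _ => gridPoint r m (i + 1) ^ (-γ)) p := by
  classical
  simp only [stepFun, indicator_apply, mem_shell_iff, mul_ite, mul_one, mul_zero]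

theorem comp_stepFun_norm_sub {E : Type*} [AddCommGroup E] (F : ℝ → E) (m : ℕ)
    (p : EuclideanSpace ℝ (Fin d)) :
    F (stepFun γ r m ‖p‖) - F 0 = ∑ i : Fin ((m + 1) ^ 2),
      (shell d r m i).indicator (fun _ => F (gridPoint r m (i + 1) ^ (-γ)) - F 0) p := by
  rw [stepFun_norm_eq]
  by_cases hp : ∃ i : Fin ((m + 1) ^ 2), p ∈ shell d r m i
  · obtain ⟨i, hi⟩ := hp
    have hother (j : Fin ((m + 1) ^ 2)) (hj : j ≠ i) : p ∉ shell d r m j :=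
      fun hpj => hj (Fin.ext (eq_of_mem_shell hpj hi))
    rw [Fintype.sum_eq_single i fun j hj => indicator_of_notMem (hother j hj) _,
      Fintype.sum_eq_single i fun j hj => indicator_of_notMem (hother j hj) _,
      indicator_of_mem hi, indicator_of_mem hi]
  · push Not at hp
    rw [Finset.sum_eq_zero fun i _ => indicator_of_notMem (hp i) _,
      Finset.sum_eq_zero fun i _ => indicator_of_notMem (hp i) _, sub_self]

theorem integral_comp_stepFun_norm_sub {E : Type*} [NormedAddCommGroup E] [NormedSpace ℝ E]
    [CompleteSpace E] (F : ℝ → E) (m : ℕ) :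
    ∫ p : EuclideanSpace ℝ (Fin d), (F (stepFun γ r m ‖p‖) - F 0) =
      ∑ i : Fin ((m + 1) ^ 2),
        volume.real (shell d r m i) • (F (gridPoint r m (i + 1) ^ (-γ)) - F 0) := by
  have hint (i : Fin ((m + 1) ^ 2)) : Integrable ((shell d r m i).indicator
      fun _ => F (gridPoint r m (i + 1) ^ (-γ)) - F 0) :=
    (integrable_indicator_iff (measurableSet_shell m i)).2
      (integrableOn_const (volume_shell_ne_top m i))
  simp only [comp_stepFun_norm_sub]
  rw [integral_finsetSum _ fun i _ => hint i]
  refine Finset.sum_congr rfl fun i _ => ?_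
  rw [integral_indicator (measurableSet_shell m i), setIntegral_const]

theorem IsHomogeneousPoisson.complexMGF_stepNoise (h : IsHomogeneousPoisson P Φ lam)
    (hlam : 0 ≤ lam) (m : ℕ) (z : ℂ) :
    complexMGF (stepNoise Φ γ r m) P z = Complex.exp (lam *
      ∫ p : EuclideanSpace ℝ (Fin d), (Complex.exp (z * stepFun γ r m ‖p‖) - 1)) := by
  have hcount := h.integral_exp_sum_count hlam (measurableSet_shell (r := r) m ·)
    (pairwise_disjoint_shell m) (volume_shell_ne_top m ·)
    (fun i => z * (gridPoint r m (i + 1) ^ (-γ) : ℝ))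
  have hstep := integral_comp_stepFun_norm_sub (d := d) (γ := γ) (r := r)
    (fun x : ℝ => Complex.exp (z * x)) m
  simp only [Complex.ofReal_zero, mul_zero, Complex.exp_zero] at hstep
  rw [hstep, Finset.mul_sum]
  convert hcount using 3
  · simp only [complexMGF, stepNoise]
    push_cast
    simp only [Finset.mul_sum, mul_assoc]
  · rw [Complex.real_smul]
    push_cast
    ring

theorem IsHomogeneousPoisson.integrable_exp_stepNoise (h : IsHomogeneousPoisson P Φ lam)
    (hlam : 0 ≤ lam) (m : ℕ) (t : ℝ) :
    Integrable (fun ω => Real.exp (t * stepNoise Φ γ r m ω)) P := by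
  refine .of_integral_ne_zero fun hzero => ?_
  have hmgf := h.complexMGF_stepNoise hlam (γ := γ) (r := r) m t
  rw [complexMGF_ofReal, mgf, hzero] at hmgf
  exact Complex.exp_ne_zero _ hmgf.symm

theorem IsHomogeneousPoisson.measurable_stepNoise (h : IsHomogeneousPoisson P Φ lam) (m : ℕ) :
    Measurable (stepNoise Φ γ r m) :=
  Finset.measurable_sum _ fun i _ =>
    ((Measurable.of_discrete (f := fun k : ℕ∞ => (k.toNat : ℝ))).comp
      (h.measurable_count _ (measurableSet_shell m i))).const_mul _

theorem IsHomogeneousPoisson.measurable_exp_stepNoise (h : IsHomogeneousPoisson P Φ lam) (t : ℝ)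
    (m : ℕ) : Measurable fun ω => Real.exp (t * stepNoise Φ γ r m ω) :=
  Real.measurable_exp.comp ((h.measurable_stepNoise m).const_mul t)

theorem tendsto_integral_exp_stepFun (hd : 1 ≤ d) (hγ : (d : ℝ) < γ) (hr : 1 ≤ r) (z : ℂ) :
    Filter.Tendsto (fun m => ∫ p : EuclideanSpace ℝ (Fin d),
        (Complex.exp (z * stepFun γ r m ‖p‖) - 1)) Filter.atTop
      (nhds (∫ p : EuclideanSpace ℝ (Fin d),
        (Complex.exp (z * ((if r < ‖p‖ then ‖p‖ ^ (-γ) else 0 : ℝ) : ℂ)) - 1))) := by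
  have hγ₀ : 0 < γ := (Nat.cast_nonneg d).trans_lt hγ
  have hr₀ : 0 < r := zero_lt_one.trans_le hr
  have htail (x : ℝ) : (if r < x then x ^ (-γ) else 0) ≤ 1 := by
    split_ifs with hx
    · exact Real.rpow_le_one_of_one_le_of_nonpos (hr.trans hx.le) (by linarith)
    · exact zero_le_one
  have hcont : Continuous fun x : ℝ => Complex.exp (z * x) - 1 := by fun_prop
  refine tendsto_integral_of_dominated_convergence
    (fun p : EuclideanSpace ℝ (Fin d) => ‖z‖ * Real.exp ‖z‖ * if r < ‖p‖ then ‖p‖ ^ (-γ) else 0)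
    (fun m => ?_) ((integrable_tail_norm hd hγ hr₀).const_mul _) (fun m => ?_) ?_
  · exact (hcont.measurable.comp (measurable_stepFun.comp measurable_norm)).aestronglyMeasurable
  · refine Filter.Eventually.of_forall fun p => ?_
    have hle := stepFun_le (m := m) hγ₀.le hr₀.le ‖p‖
    exact (norm_exp_mul_sub_one_le z (stepFun_nonneg hr₀.le _) (hle.trans (htail _))).trans
      (mul_le_mul_of_nonneg_left hle (by positivity))
  · exact Filter.Eventually.of_forall fun p => (hcont.tendsto _).comp (tendsto_stepFun hr₀.le ‖p‖)

variable (hd : 1 ≤ d) (hγ : (d : ℝ) < γ) (h : IsHomogeneousPoisson P Φ (intensity d γ))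
  (hr : 1 ≤ r)
include hd hγ h hr

theorem IsHomogeneousPoisson.tendsto_complexMGF_stepNoise (z : ℂ) :
    Filter.Tendsto (fun m => complexMGF (stepNoise Φ γ r m) P z) Filter.atTop
      (nhds (Complex.exp
        ((rho d r : ℂ) ^ 2 * complexLevyExponent (d / γ) (z * (r ^ (-γ) : ℝ))))) := by
  simp only [h.complexMGF_stepNoise (intensity_nonneg hγ)]
  rw [← intensity_mul_integral_exp_sub_one hd hγ (zero_lt_one.trans_le hr)]
  exact (Complex.continuous_exp.tendsto _).comp
    ((tendsto_integral_exp_stepFun hd hγ hr z).const_mul _)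

theorem IsHomogeneousPoisson.exists_tendsto_mgf_stepNoise (t : ℝ) :
    ∃ c, Filter.Tendsto (fun m => mgf (stepNoise Φ γ r m) P t) Filter.atTop (nhds c) := by
  simp only [← re_complexMGF_ofReal]
  exact ⟨_, (Complex.continuous_re.tendsto _).comp (h.tendsto_complexMGF_stepNoise hd hγ hr t)⟩

theorem IsHomogeneousPoisson.ae_summable_tailTerm :
    ∀ᵐ ω ∂P, Summable (fun k : ℕ => tailTerm Φ γ r (k + 1) ω) := by
  obtain ⟨c, hc⟩ := h.exists_tendsto_mgf_stepNoise hd hγ hr 1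
  filter_upwards [h.ae_finite, ae_frequently_le_of_tendsto_integral
    (h.measurable_exp_stepNoise 1) (h.integrable_exp_stepNoise (intensity_nonneg hγ) · 1)
    (fun _ _ => (Real.exp_pos _).le) hc] with ω hfin ⟨M, hM⟩
  refine summable_tailTerm (M := M) (by linarith) hfin (hM.mono fun m hm => ?_)
  rw [one_mul] at hm
  linarith [Real.add_one_le_exp (stepNoise Φ γ r m ω)]

theorem IsHomogeneousPoisson.ae_tendsto_stepNoise :
    ∀ᵐ ω ∂P, Filter.Tendsto (fun m => stepNoise Φ γ r m ω) Filter.atTop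
      (nhds (tailNoise Φ γ r ω)) := by
  filter_upwards [h.ae_finite, h.ae_summable_tailTerm hd hγ hr] with ω hfin hsum
  exact tendsto_stepNoise ((Nat.cast_nonneg d).trans hγ.le) (by linarith) hfin hsum

theorem IsHomogeneousPoisson.aemeasurable_tailNoise : AEMeasurable (tailNoise Φ γ r) P :=
  aemeasurable_of_tendsto_metrizable_ae Filter.atTop
    (fun m => (h.measurable_stepNoise m).aemeasurable) (h.ae_tendsto_stepNoise hd hγ hr)

theorem IsHomogeneousPoisson.integrable_exp_tailNoise (t : ℝ) :
    Integrable (fun ω => Real.exp (t * tailNoise Φ γ r ω)) P := by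
  obtain ⟨c, hc⟩ := h.exists_tendsto_mgf_stepNoise hd hγ hr t
  refine integrable_of_tendsto_integral (h.measurable_exp_stepNoise t)
    (h.integrable_exp_stepNoise (intensity_nonneg hγ) · t) (fun _ _ => (Real.exp_pos _).le) hc ?_
  filter_upwards [h.ae_tendsto_stepNoise hd hγ hr] with ω hω
  exact (Real.continuous_exp.tendsto _).comp (hω.const_mul t)

theorem IsHomogeneousPoisson.complexMGF_tailNoise (z : ℂ) :
    complexMGF (tailNoise Φ γ r) P z =
      Complex.exp ((rho d r : ℂ) ^ 2 * complexLevyExponent (d / γ) (z * (r ^ (-γ) : ℝ))) := by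
  have hcont : Continuous fun x : ℝ => Complex.exp (z * x) := by fun_prop
  refine tendsto_nhds_unique ?_ (h.tendsto_complexMGF_stepNoise hd hγ hr z)
  refine tendsto_integral_of_dominated_convergence (fun ω => Real.exp (‖z‖ * tailNoise Φ γ r ω))
    (fun m => (hcont.measurable.comp (h.measurable_stepNoise m)).aestronglyMeasurable)
    (h.integrable_exp_tailNoise hd hγ hr ‖z‖) (fun m => ?_) ?_
  · filter_upwards [h.ae_finite, h.ae_summable_tailTerm hd hγ hr] with ω hfin hsum
    have hle := stepNoise_le_tailNoise (m := m) ((Nat.cast_nonneg d).trans hγ.le)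
      (by linarith) hfin hsum
    rw [Complex.norm_exp]
    gcongr
    calc _ ≤ ‖z * stepNoise Φ γ r m ω‖ := Complex.re_le_norm _
      _ = ‖z‖ * stepNoise Φ γ r m ω := by
        rw [norm_mul, Complex.norm_real, Real.norm_of_nonneg (stepNoise_nonneg (by linarith))]
      _ ≤ _ := by gcongr
  · filter_upwards [h.ae_tendsto_stepNoise hd hγ hr] with ω hω
    exact (hcont.tendsto _).comp hω

end Poisson

section Tilting

variable {Q : Measure ℝ}

theorem charFun_tilted (ξ t : ℝ) :
    charFun (Q.tilted (ξ * ·)) t = complexMGF id Q (ξ + t * Complex.I) / mgf id Q ξ := by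
  rw [charFun_apply_real, MeasureTheory.integral_tilted, complexMGF, ← integral_div]
  refine integral_congr_ae (Filter.Eventually.of_forall fun x => ?_)
  simp only [Complex.real_smul, id_eq, mgf, Complex.ofReal_div, Complex.ofReal_exp, add_mul,
    Complex.exp_add]
  push_cast
  ring_nf

theorem mgf_tilted (ξ t : ℝ) :
    mgf id (Q.tilted (ξ * ·)) t = mgf id Q (ξ + t) / mgf id Q ξ := by
  simpa only [mgf, id_eq, Pi.add_apply, ← add_mul] using
    integral_exp_tilted (μ := Q) (ξ * ·) (t * ·)

theorem eq_mul_of_tilted_withDensity {f g : ℝ → ℝ} {ξ : ℝ} (hf : Continuous f)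
    (hf₀ : ∀ x, 0 ≤ f x) (hg : Continuous g) (hg₀ : ∀ x, 0 ≤ g x)
    (hfQ : Q = volume.withDensity fun x => ENNReal.ofReal (f x))
    (hgQ : Q.tilted (ξ * ·) = volume.withDensity fun x => ENNReal.ofReal (g x)) (x : ℝ) :
    g x = f x * (Real.exp (ξ * x) / mgf id Q ξ) := by
  have hweight (x : ℝ) : 0 ≤ Real.exp (ξ * x) / mgf id Q ξ :=
    div_nonneg (Real.exp_pos _).le mgf_nonneg
  have htilt : Q.tilted (ξ * ·) = volume.withDensity fun x =>
      ENNReal.ofReal (f x * (Real.exp (ξ * x) / mgf id Q ξ)) := by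
    change Q.withDensity (fun x => ENNReal.ofReal (Real.exp (ξ * x) / mgf id Q ξ)) = _
    nth_rw 1 [hfQ]
    rw [← withDensity_mul _ (by fun_prop) (by fun_prop)]
    congr 1
    ext x
    rw [Pi.mul_apply, ← ENNReal.ofReal_mul (hf₀ x)]
  have hae : (fun x => ENNReal.ofReal (g x)) =ᵐ[volume]
      fun x => ENNReal.ofReal (f x * (Real.exp (ξ * x) / mgf id Q ξ)) := by
    rw [← withDensity_eq_iff_of_sigmaFinite (by fun_prop) (by fun_prop), ← hgQ, htilt]
  have hcont : Continuous fun x => f x * (Real.exp (ξ * x) / mgf id Q ξ) := by fun_prop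
  refine congrFun ((Continuous.ae_eq_iff_eq volume hg hcont).1 (hae.mono fun x hx => ?_)) x
  exact (ENNReal.ofReal_eq_ofReal_iff (hg₀ x) (mul_nonneg (hf₀ x) (hweight x))).1 hx

end Tilting

section Law

/-- `Q` is the law of the normalised noise with parameters `α` and `ρ`: its moment generating
function, on the whole complex plane, is the exponential of `noiseCgf α ρ`. -/
def IsNoiseLaw (α ρ : ℝ) (Q : Measure ℝ) : Prop :=
  ∀ z : ℂ, complexMGF id Q z =
    Complex.exp (ρ ^ 2 * complexLevyExponent α (z / ρ) - z * (ρ * levyMean α 0))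

variable {α ρ : ℝ} {Q : Measure ℝ}

namespace IsNoiseLaw

theorem mgf_eq (h : IsNoiseLaw α ρ Q) (t : ℝ) : mgf id Q t = Real.exp (noiseCgf α ρ t) := by
  have hcomplex := h t
  rw [complexMGF_ofReal, ← Complex.ofReal_div, complexLevyExponent_ofReal] at hcomplex
  rw [noiseCgf]
  exact_mod_cast hcomplex

theorem cgf_eq (h : IsNoiseLaw α ρ Q) : cgf id Q = noiseCgf α ρ := by
  funext t
  rw [cgf, h.mgf_eq, Real.log_exp]

theorem integrable_exp (h : IsNoiseLaw α ρ Q) (t : ℝ) :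
    Integrable (fun x => Real.exp (t * x)) Q :=
  Integrable.of_integral_ne_zero ((h.mgf_eq t).trans_ne (Real.exp_pos _).ne')

theorem mem_interior_integrableExpSet (h : IsNoiseLaw α ρ Q) (t : ℝ) :
    t ∈ interior (integrableExpSet id Q) := by
  have huniv : integrableExpSet id Q = univ := eq_univ_of_forall h.integrable_exp
  rw [huniv, interior_univ]
  trivial

theorem isProbabilityMeasure (h : IsNoiseLaw α ρ Q) : IsProbabilityMeasure Q := by
  have hmass := h.mgf_eq 0
  rw [mgf_zero', noiseCgf, levyExponent] at hmass
  exact isProbabilityMeasure_iff_real.2 (by simpa using hmass)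

theorem isProbabilityMeasure_tilted (h : IsNoiseLaw α ρ Q) (ξ : ℝ) :
    IsProbabilityMeasure (Q.tilted (ξ * ·)) := by
  have := h.isProbabilityMeasure
  exact MeasureTheory.isProbabilityMeasure_tilted (h.integrable_exp ξ)

theorem integral_tilted (h : IsNoiseLaw α ρ Q) (hα : α < 1) (hρ : 0 < ρ) (ξ : ℝ) :
    ∫ x, x ∂(Q.tilted (ξ * ·)) = tiltedMean α ρ ξ := by
  have hmean := integral_tilted_mul_self (h.mem_interior_integrableExpSet ξ)
  rwa [h.cgf_eq, (hasDerivAt_noiseCgf hα hρ ξ).deriv] at hmean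

theorem variance_tilted (h : IsNoiseLaw α ρ Q) (hα : α < 1) (hρ : 0 < ρ) (ξ : ℝ) :
    variance id (Q.tilted (ξ * ·)) = powerMoment α 0 (ξ / ρ) := by
  have hvar := variance_tilted_mul (h.mem_interior_integrableExpSet ξ)
  rw [h.cgf_eq, iteratedDeriv_noiseCgf hα hρ 0] at hvar
  simpa using hvar

theorem tilted_zero_mul (h : IsNoiseLaw α ρ Q) : Q.tilted ((0 : ℝ) * ·) = Q := by
  have := h.isProbabilityMeasure
  simp

theorem integral_eq_zero (h : IsNoiseLaw α ρ Q) (hα : α < 1) (hρ : 0 < ρ) : ∫ x, x ∂Q = 0 := by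
  simpa only [h.tilted_zero_mul, tiltedMean_zero] using h.integral_tilted hα hρ 0

theorem variance_eq_one (h : IsNoiseLaw α ρ Q) (hα : α < 1) (hρ : 0 < ρ) : variance id Q = 1 := by
  have hvar := h.variance_tilted hα hρ 0
  rwa [h.tilted_zero_mul, zero_div, powerMoment_zero_zero (by linarith)] at hvar

theorem cgf_tilted (h : IsNoiseLaw α ρ Q) (ξ t : ℝ) :
    cgf id (Q.tilted (ξ * ·)) t = -noiseCgf α ρ ξ + noiseCgf α ρ (ξ + t) := by
  rw [cgf, mgf_tilted, h.mgf_eq, h.mgf_eq, ← Real.exp_sub, Real.log_exp]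
  ring

theorem iteratedDeriv_cgf_tilted (h : IsNoiseLaw α ρ Q) (hα : α < 1) (hρ : 0 < ρ) (ξ : ℝ) (n : ℕ) :
    iteratedDeriv (n + 2) (cgf id (Q.tilted (ξ * ·))) 0 = powerMoment α n (ξ / ρ) / ρ ^ n := by
  rw [funext (h.cgf_tilted ξ), iteratedDeriv_const_add (by lia), iteratedDeriv_comp_const_add,
    iteratedDeriv_noiseCgf hα hρ]
  simp

theorem charFun_tilted (h : IsNoiseLaw α ρ Q) (hα : α < 1) (hρ : 0 < ρ) (ξ t : ℝ) :
    charFun (Q.tilted (ξ * ·)) t = Complex.exp (t * tiltedMean α ρ ξ * Complex.I) *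
      Complex.exp ((ρ ^ 2 : ℝ) * centredExponent α (ξ / ρ) (ρ⁻¹ * t)) := by
  have hρ' : (ρ : ℂ) ≠ 0 := Complex.ofReal_ne_zero.2 hρ.ne'
  have hpoint : (ξ + t * Complex.I) / ρ = ((ξ / ρ : ℝ) : ℂ) + ((ρ⁻¹ * t : ℝ) : ℂ) * Complex.I := by
    push_cast
    ring
  rw [ShotNoise.charFun_tilted, h, h.mgf_eq, Complex.ofReal_exp, ← Complex.exp_sub,
    ← Complex.exp_add, centredExponent_eq hα, hpoint, tiltedMean, noiseCgf]
  congr 1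
  push_cast
  field_simp
  ring

theorem integrable_charFun_tilted (h : IsNoiseLaw α ρ Q) (hα₀ : 0 < α) (hα : α < 1) (hρ : 0 < ρ)
    (ξ : ℝ) : Integrable (charFun (Q.tilted (ξ * ·))) := by
  have := h.isProbabilityMeasure_tilted ξ
  have hcentred := (integrable_exp_centredExponent hα₀ (by linarith) hρ (ξ / ρ)).comp_mul_left'
    (inv_ne_zero hρ.ne')
  refine hcentred.mono measurable_charFun.aestronglyMeasurable
    (Filter.Eventually.of_forall fun t => ?_)
  rw [h.charFun_tilted hα hρ, norm_mul, ← Complex.ofReal_mul, Complex.norm_exp_ofReal_mul_I,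
    one_mul]

theorem inversionIntegral_tilted (h : IsNoiseLaw α ρ Q) (hα : α < 1) (hρ : 0 < ρ) (ξ : ℝ) :
    inversionIntegral (Q.tilted (ξ * ·)) (tiltedMean α ρ ξ) = centredDensity α (ξ / ρ) ρ := by
  have hcancel (t : ℝ) : charFun (Q.tilted (ξ * ·)) t *
      Complex.exp (-(t * tiltedMean α ρ ξ * Complex.I)) =
        Complex.exp ((ρ ^ 2 : ℝ) * centredExponent α (ξ / ρ) (ρ⁻¹ * t)) := by
    rw [h.charFun_tilted hα hρ, mul_right_comm, ← Complex.exp_add, add_neg_cancel,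
      Complex.exp_zero, one_mul]
  simp only [inversionIntegral, hcancel]
  rw [Measure.integral_comp_mul_left
    (fun t => Complex.exp ((ρ ^ 2 : ℝ) * centredExponent α (ξ / ρ) t)) ρ⁻¹, inv_inv,
    abs_of_pos hρ, Complex.real_smul, centredDensity]
  push_cast
  ring

theorem exists_density (h : IsNoiseLaw α ρ Q) (hα₀ : 0 < α) (hα : α < 1) (hρ : 0 < ρ) :
    ∃ f : ℝ → ℝ, Continuous f ∧ (∀ x, 0 ≤ f x) ∧
      Q = volume.withDensity (fun x => ENNReal.ofReal (f x)) ∧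
      ∀ ξ, ∃ g : ℝ, (g : ℂ) = centredDensity α (ξ / ρ) ρ ∧
        f (tiltedMean α ρ ξ) =
          g * Real.exp (-ξ * tiltedMean α ρ ξ) * Real.exp (noiseCgf α ρ ξ) := by
  have htilted (ξ : ℝ) : ∃ g : ℝ → ℝ, Continuous g ∧ (∀ x, 0 ≤ g x) ∧
      Q.tilted (ξ * ·) = volume.withDensity (fun x => ENNReal.ofReal (g x)) ∧
      ∀ x, (g x : ℂ) = inversionIntegral (Q.tilted (ξ * ·)) x :=
    have := h.isProbabilityMeasure_tilted ξ
    exists_continuous_density (h.integrable_charFun_tilted hα₀ hα hρ ξ)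
  obtain ⟨f, hf, hf₀, hfQ, -⟩ := htilted 0
  rw [h.tilted_zero_mul] at hfQ
  refine ⟨f, hf, hf₀, hfQ, fun ξ => ?_⟩
  obtain ⟨g, hg, hg₀, hgQ, hgx⟩ := htilted ξ
  refine ⟨g (tiltedMean α ρ ξ), (hgx _).trans (h.inversionIntegral_tilted hα hρ ξ), ?_⟩
  rw [eq_mul_of_tilted_withDensity hf hf₀ hg hg₀ hfQ hgQ, h.mgf_eq, neg_mul, Real.exp_neg]
  field_simp

end IsNoiseLaw

end Law

section NormalisedNoise

theorem rho_pos (d : ℕ) {r : ℝ} (hr : 1 ≤ r) : 0 < rho d r :=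
  Real.rpow_pos_of_pos (zero_lt_one.trans_le hr) _

theorem one_le_rho (d : ℕ) {r : ℝ} (hr : 1 ≤ r) : 1 ≤ rho d r :=
  Real.one_le_rpow hr (by positivity)

theorem div_lt_one_of_lt {d : ℕ} {γ : ℝ} (hγ : (d : ℝ) < γ) : (d : ℝ) / γ < 1 := by
  rwa [div_lt_one (lt_of_le_of_lt (Nat.cast_nonneg _) hγ)]

theorem tkappa_add_two {d : ℕ} {γ : ℝ} (hα : (d : ℝ) / γ ≤ 2) (r ξ : ℝ) (m : ℕ) :
    tkappa d γ r ξ (m + 2) = powerMoment (d / γ) m (ξ / rho d r) := by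
  rw [tkappa, dOne, powerMoment, integral_powerLaw hα,
    intervalIntegral.integral_of_le zero_le_one, ← integral_const_mul]
  refine setIntegral_congr_fun measurableSet_Ioc fun u hu => ?_
  have hexponent : ((m + 2 : ℕ) : ℝ) - 1 - d / γ = (1 - d / γ) + m := by
    push_cast
    ring
  simp only [smul_eq_mul]
  rw [hexponent, Real.rpow_add_natCast hu.1.ne', div_mul_eq_mul_div]
  ring

variable {Ω : Type*} [MeasurableSpace Ω] {P : Measure Ω} {d : ℕ}
  {Φ : Ω → Set (EuclideanSpace ℝ (Fin d))} {γ r : ℝ}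
  (hd : 1 ≤ d) (hγ : (d : ℝ) < γ) (h : IsHomogeneousPoisson P Φ (intensity d γ)) (hr : 1 ≤ r)
include hd hγ h hr

theorem IsHomogeneousPoisson.memLp_tailNoise : MemLp (tailNoise Φ γ r) 2 P := by
  have huniv : integrableExpSet (tailNoise Φ γ r) P = univ :=
    eq_univ_of_forall (h.integrable_exp_tailNoise hd hγ hr)
  exact memLp_of_mem_interior_integrableExpSet (by simp [huniv]) 2

theorem IsHomogeneousPoisson.isNoiseLaw_map_affine :
    IsNoiseLaw (d / γ) (rho d r) (P.map fun ω =>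
      tailNoise Φ γ r ω / (rho d r * r ^ (-γ)) - rho d r * levyMean (d / γ) 0) := by
  intro z
  have hρ : (rho d r : ℂ) ≠ 0 := Complex.ofReal_ne_zero.2 (rho_pos d hr).ne'
  have hc : ((r ^ (-γ) : ℝ) : ℂ) ≠ 0 :=
    Complex.ofReal_ne_zero.2 (Real.rpow_pos_of_pos (zero_lt_one.trans_le hr) _).ne'
  have hscale : z / (rho d r * (r ^ (-γ) : ℝ)) * (r ^ (-γ) : ℝ) = z / rho d r := by field_simp
  have htail := h.complexMGF_tailNoise hd hγ hr (z / (rho d r * (r ^ (-γ) : ℝ)))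
  rw [complexMGF_id_map (((h.aemeasurable_tailNoise hd hγ hr).div_const _).sub_const _),
    Complex.exp_sub, ← hscale, ← htail, complexMGF, complexMGF, ← integral_div]
  congr with ω
  rw [← Complex.exp_sub]
  push_cast
  ring_nf

variable [IsProbabilityMeasure P]

theorem IsHomogeneousPoisson.noiseMean_eq : noiseMean P Φ γ r =
    rho d r * levyMean (d / γ) 0 * (rho d r * r ^ (-γ)) := by
  have hscale : 0 < rho d r * r ^ (-γ) :=
    mul_pos (rho_pos d hr) (Real.rpow_pos_of_pos (zero_lt_one.trans_le hr) _)
  have hint : Integrable (tailNoise Φ γ r) P :=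
    (h.memLp_tailNoise hd hγ hr).integrable one_le_two
  have hmean := (h.isNoiseLaw_map_affine hd hγ hr).integral_eq_zero (div_lt_one_of_lt hγ)
    (rho_pos d hr)
  rw [integral_map (((h.aemeasurable_tailNoise hd hγ hr).div_const _).sub_const _)
    (Continuous.aestronglyMeasurable (by fun_prop)),
    integral_sub (hint.div_const _) (integrable_const _), integral_div, integral_const,
    probReal_univ, one_smul, sub_eq_zero, div_eq_iff hscale.ne'] at hmean
  exact hmean

theorem IsHomogeneousPoisson.noiseStd_eq : noiseStd P Φ γ r = rho d r * r ^ (-γ) := by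
  have hscale : 0 < rho d r * r ^ (-γ) :=
    mul_pos (rho_pos d hr) (Real.rpow_pos_of_pos (zero_lt_one.trans_le hr) _)
  have hX := h.aemeasurable_tailNoise hd hγ hr
  have hvar := (h.isNoiseLaw_map_affine hd hγ hr).variance_eq_one (div_lt_one_of_lt hγ)
    (rho_pos d hr)
  rw [variance_id_map ((hX.div_const _).sub_const _),
    variance_sub_const (hX.div_const _).aestronglyMeasurable] at hvar
  simp only [div_eq_mul_inv] at hvar
  rw [variance_mul_const, inv_pow, mul_inv_eq_one₀ (by positivity)] at hvar
  rw [noiseStd, hvar, Real.sqrt_sq hscale.le]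

theorem IsHomogeneousPoisson.noiseStd_pos : 0 < noiseStd P Φ γ r := by
  rw [h.noiseStd_eq hd hγ hr]
  exact mul_pos (rho_pos d hr) (Real.rpow_pos_of_pos (zero_lt_one.trans_le hr) _)

theorem IsHomogeneousPoisson.noiseMean_div_noiseStd :
    noiseMean P Φ γ r / noiseStd P Φ γ r = rho d r * levyMean (d / γ) 0 := by
  rw [div_eq_iff (h.noiseStd_pos hd hγ hr).ne', h.noiseStd_eq hd hγ hr, h.noiseMean_eq hd hγ hr]

theorem IsHomogeneousPoisson.isNoiseLaw :
    IsNoiseLaw (d / γ) (rho d r) (P.map (normNoise P Φ γ r)) := by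
  have haffine : normNoise P Φ γ r = fun ω =>
      tailNoise Φ γ r ω / (rho d r * r ^ (-γ)) - rho d r * levyMean (d / γ) 0 := by
    funext ω
    rw [normNoise, sub_div, h.noiseMean_div_noiseStd hd hγ hr, h.noiseStd_eq hd hγ hr]
  rw [haffine]
  exact h.isNoiseLaw_map_affine hd hγ hr

omit [IsProbabilityMeasure P] in
theorem IsHomogeneousPoisson.aemeasurable_normNoise : AEMeasurable (normNoise P Φ γ r) P :=
  ((h.aemeasurable_tailNoise hd hγ hr).sub_const _).div_const _

theorem IsHomogeneousPoisson.integrable_exp_normNoise (t : ℝ) :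
    Integrable (fun ω => Real.exp (t * normNoise P Φ γ r ω)) P :=
  (integrable_map_measure (Continuous.aestronglyMeasurable (by fun_prop))
    (h.aemeasurable_normNoise hd hγ hr)).1 ((h.isNoiseLaw hd hγ hr).integrable_exp t)

theorem IsHomogeneousPoisson.laplace_normNoise (x : ℝ) :
    laplace P (normNoise P Φ γ r) (-x) = Real.exp (noiseCgf (d / γ) (rho d r) x) := by
  rw [← (h.isNoiseLaw hd hγ hr).mgf_eq, mgf_id_map (h.aemeasurable_normNoise hd hγ hr), mgf,
    laplace, neg_neg]

theorem IsHomogeneousPoisson.isMinOn_exp_mul_laplace_iff {x y : ℝ} :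
    IsMinOn (fun x => Real.exp (-x * y) * laplace P (normNoise P Φ γ r) (-x)) univ x ↔
      tiltedMean (d / γ) (rho d r) x = y := by
  have hexp (x : ℝ) : Real.exp (-x * y) * laplace P (normNoise P Φ γ r) (-x) =
      Real.exp (noiseCgf (d / γ) (rho d r) x - x * y) := by
    rw [h.laplace_normNoise hd hγ hr, ← Real.exp_add]
    ring_nf
  rw [← isMinOn_noiseCgf_sub_iff (div_lt_one_of_lt hγ) (rho_pos d hr)]
  simp only [hexp, isMinOn_univ_iff, Real.exp_le_exp]

end NormalisedNoise

section RelativeError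

theorem exists_eq_edgeworthTerm_mul {κ : ℕ → ℝ} {ρ δ g : ℝ} {k : ℕ} (hκ : 0 < κ 2)
    (hfactor : |edgeworthFactor κ ρ k - 1| ≤ 1 / 2)
    (hg : ‖((Real.sqrt (κ 2) * Real.sqrt (2 * Real.pi) : ℝ) : ℂ) * g - edgeworthFactor κ ρ k‖ ≤ δ) :
    ∃ ε : ℝ, g = edgeworthTerm κ ρ k * (1 + ε) ∧ |ε| ≤ 2 * δ := by
  set s := Real.sqrt (κ 2) * Real.sqrt (2 * Real.pi) with hs
  set E := edgeworthFactor κ ρ k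
  have hs₀ : 0 < s := mul_pos (Real.sqrt_pos.2 hκ) (Real.sqrt_pos.2 (by positivity))
  have hE : 1 / 2 ≤ E := by linarith [(abs_le.1 hfactor).1]
  have hE₀ : 0 < E := by linarith
  have hδ : |s * g - E| ≤ δ := by
    rwa [← Complex.ofReal_mul, ← Complex.ofReal_sub, Complex.norm_real] at hg
  refine ⟨(s * g - E) / E, ?_, ?_⟩
  · rw [edgeworthTerm_eq, ← hs]
    field_simp
    ring
  · rw [abs_div, abs_of_pos hE₀, div_le_iff₀ hE₀]
    nlinarith [(abs_nonneg _).trans hδ]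

theorem exists_saddlepoint_expansion_nonneg {α : ℝ} (hα₀ : 0 < α) (hα : α < 2) :
    ∃ C D C' : ℝ, 0 < C ∧ 0 < D ∧ 0 < C' ∧ ∀ (κ : ℕ → ℝ) (ρ b g : ℝ), 1 ≤ ρ → 0 ≤ b →
      (∀ m, κ (m + 2) = powerMoment α m b) → (g : ℂ) = centredDensity α b ρ →
      ∀ k : ℕ, C' * Real.sqrt k ≤ ρ → ∃ ε, g = edgeworthTerm κ ρ k * (1 + ε) ∧
        |ε| ≤ C * D ^ k * (k : ℝ) ^ ((k : ℝ) / 2) / (Real.sqrt (κ 2) * ρ) ^ (k + 1) := by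
  obtain ⟨C, D, C', hC, hD, hC', hexpand⟩ := exists_edgeworth_of_tilt_nonneg hα₀ hα
  refine ⟨2 * C, D, C', by positivity, hD, hC', fun κ ρ b g hρ hb hκ hg k hk => ?_⟩
  obtain ⟨hfactor, herr⟩ := hexpand κ ρ b hρ hb hκ k hk
  obtain ⟨ε, hε, hbound⟩ :=
    exists_eq_edgeworthTerm_mul (hκ 0 ▸ powerMoment_zero_pos hα b) hfactor (hg ▸ herr)
  exact ⟨ε, hε, hbound.trans_eq (by ring)⟩

theorem exists_saddlepoint_expansion_nonpos {α : ℝ} (hα₀ : 0 < α) (hα : α < 2) :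
    ∃ C D C' : ℝ, 0 < C ∧ 0 < D ∧ 0 < C' ∧ ∀ (κ : ℕ → ℝ) (ρ b g : ℝ), 1 ≤ ρ → b ≤ 0 →
      (∀ m, κ (m + 2) = powerMoment α m b) → (g : ℂ) = centredDensity α b ρ →
      ∀ k : ℕ, C' * Real.sqrt k ≤ ρ → ∃ ε, g = edgeworthTerm κ ρ k * (1 + ε) ∧
        |ε| ≤ C * D ^ k * (k : ℝ) ^ ((k : ℝ) / 2) *
          (κ 2 ^ (1 / (2 - α) - 1 / 2) / ρ) ^ (k + 1) := by
  obtain ⟨C, D, C', hC, hD, hC', hexpand⟩ := exists_edgeworth_of_tilt_nonpos hα₀ hα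
  refine ⟨2 * C, D, C', by positivity, hD, hC', fun κ ρ b g hρ hb hκ hg k hk => ?_⟩
  obtain ⟨hfactor, herr⟩ := hexpand κ ρ b hρ hb hκ k hk
  obtain ⟨ε, hε, hbound⟩ :=
    exists_eq_edgeworthTerm_mul (hκ 0 ▸ powerMoment_zero_pos hα b) hfactor (hg ▸ herr)
  exact ⟨ε, hε, hbound.trans_eq (by ring)⟩

theorem div_sqrt_mul_pow_le_div_pow {α b c ρ : ℝ} (hα : α < 2) (hb : 0 ≤ b) (hc : 0 ≤ c)
    (hρ : 0 < ρ) (n : ℕ) :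
    c / (Real.sqrt (powerMoment α 0 b) * ρ) ^ n ≤ c / ρ ^ n := by
  have hsqrt : 1 ≤ Real.sqrt (powerMoment α 0 b) := by
    rw [Real.one_le_sqrt, ← powerMoment_zero_zero hα]
    exact powerMoment_zero_mono hα hb
  gcongr
  exact le_mul_of_one_le_left hρ.le hsqrt

theorem mul_rpow_div_pow_le_div_pow {α b c ρ : ℝ} (hα₀ : 0 ≤ α) (hα : α < 2) (hb : b ≤ 0)
    (hc : 0 ≤ c) (hρ : 0 < ρ) (n : ℕ) :
    c * (powerMoment α 0 b ^ (1 / (2 - α) - 1 / 2) / ρ) ^ n ≤ c / ρ ^ n := by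
  have hmoment := powerMoment_nonneg (α := α) 0 b
  rw [div_eq_mul_one_div c, ← one_div_pow]
  gcongr
  exact powerMoment_zero_rpow_le_one hα₀ hα hb

theorem exists_saddlepoint_expansion {α : ℝ} (hα₀ : 0 < α) (hα : α < 2) :
    ∃ C D C' : ℝ, 0 < C ∧ 0 < D ∧ 0 < C' ∧ ∀ (κ : ℕ → ℝ) (ρ b g : ℝ), 1 ≤ ρ →
      (∀ m, κ (m + 2) = powerMoment α m b) → (g : ℂ) = centredDensity α b ρ →
      ∀ k : ℕ, C' * Real.sqrt k ≤ ρ →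
        (0 ≤ b → ∃ ε, g = edgeworthTerm κ ρ k * (1 + ε) ∧
          |ε| ≤ C * D ^ k * (k : ℝ) ^ ((k : ℝ) / 2) / (Real.sqrt (κ 2) * ρ) ^ (k + 1) ∧
          C * D ^ k * (k : ℝ) ^ ((k : ℝ) / 2) / (Real.sqrt (κ 2) * ρ) ^ (k + 1) ≤
            C * D ^ k * (k : ℝ) ^ ((k : ℝ) / 2) / ρ ^ (k + 1)) ∧
        (b ≤ 0 → ∃ ε, g = edgeworthTerm κ ρ k * (1 + ε) ∧
          |ε| ≤ C * D ^ k * (k : ℝ) ^ ((k : ℝ) / 2) *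
            (κ 2 ^ (1 / (2 - α) - 1 / 2) / ρ) ^ (k + 1) ∧
          C * D ^ k * (k : ℝ) ^ ((k : ℝ) / 2) * (κ 2 ^ (1 / (2 - α) - 1 / 2) / ρ) ^ (k + 1) ≤
            C * D ^ k * (k : ℝ) ^ ((k : ℝ) / 2) / ρ ^ (k + 1)) := by
  obtain ⟨A, B, A', hA, hB, hA', hnonneg⟩ := exists_saddlepoint_expansion_nonneg hα₀ hα
  obtain ⟨C, D, C', -, hD, -, hnonpos⟩ := exists_saddlepoint_expansion_nonpos hα₀ hα
  refine ⟨max A C, max B D, max A' C', by positivity, by positivity, by positivity,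
    fun κ ρ b g hρ hκ hg k hk => ⟨fun hb => ?_, fun hb => ?_⟩⟩
  · obtain ⟨ε, hgε, hε⟩ := hnonneg κ ρ b g hρ hb hκ hg k (le_trans (by gcongr; simp) hk)
    refine ⟨ε, hgε, hε.trans ?_, ?_⟩
    · gcongr <;> exact le_max_left _ _
    · rw [hκ 0]
      exact div_sqrt_mul_pow_le_div_pow hα hb (by positivity) (by positivity) _
  · obtain ⟨ε, hgε, hε⟩ := hnonpos κ ρ b g hρ hb hκ hg k (le_trans (by gcongr; simp) hk)
    have hκ₂ : 0 ≤ κ 2 := hκ 0 ▸ powerMoment_nonneg 0 b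
    refine ⟨ε, hgε, hε.trans ?_, ?_⟩
    · gcongr <;> exact le_max_right _ _
    · rw [hκ 0]
      exact mul_rpow_div_pow_le_div_pow hα₀.le hα hb (by positivity) (by positivity) _

end RelativeError

end ShotNoise

theorem theorem1_general (d : ℕ) (hd : 1 ≤ d) (γ : ℝ) (hγ : (d : ℝ) < γ) :
    ∃ C₂ C₃ C₄ : ℝ, 0 < C₂ ∧ 0 < C₃ ∧ 0 < C₄ ∧
      ∀ (Ω : Type*) [MeasurableSpace Ω] (P : Measure Ω) [IsProbabilityMeasure P]
        (Φ : Ω → Set (EuclideanSpace ℝ (Fin d))),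
        ShotNoise.IsHomogeneousPoisson P Φ (ShotNoise.intensity d γ) →
      ∀ r : ℝ, 1 ≤ r →
        (∀ᵐ ω ∂P, Summable (fun k : ℕ => ShotNoise.tailTerm Φ γ r (k + 1) ω)) ∧
        MemLp (ShotNoise.tailNoise Φ γ r) 2 P ∧
        0 < ShotNoise.noiseStd P Φ γ r ∧
        (∀ t : ℝ, Integrable (fun ω => Real.exp (-t * ShotNoise.normNoise P Φ γ r ω)) P) ∧
        ∃ f : ℝ → ℝ, Continuous f ∧ (∀ z, 0 ≤ f z) ∧
          P.map (ShotNoise.normNoise P Φ γ r) =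
            (volume : Measure ℝ).withDensity (fun z => ENNReal.ofReal (f z)) ∧
          ∀ y : ℝ, -(ShotNoise.noiseMean P Φ γ r / ShotNoise.noiseStd P Φ γ r) < y →
            ∃ ξ : ℝ, (∀ ξ' : ℝ, IsMinOn (fun x : ℝ => Real.exp (-x * y) *
                ShotNoise.laplace P (ShotNoise.normNoise P Φ γ r) (-x)) univ ξ' ↔ ξ' = ξ) ∧
              (∫ z, z ∂(ShotNoise.tiltedLaw P (ShotNoise.normNoise P Φ γ r) ξ) = y) ∧
              variance id (ShotNoise.tiltedLaw P (ShotNoise.normNoise P Φ γ r) ξ) =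
                ShotNoise.tkappa d γ r ξ 2 ∧
              (∀ n : ℕ, 2 ≤ n →
                iteratedDeriv n
                    (cgf id (ShotNoise.tiltedLaw P (ShotNoise.normNoise P Φ γ r) ξ)) 0 =
                  ShotNoise.tkappa d γ r ξ n / ShotNoise.rho d r ^ (n - 2)) ∧
              (∀ k : ℕ, 0 ≤ y → C₄ * Real.sqrt k ≤ ShotNoise.rho d r →
                ∃ ε : ℝ,
                  f y = ShotNoise.edgeworthTerm (ShotNoise.tkappa d γ r ξ)
                      (ShotNoise.rho d r) k * Real.exp (-ξ * y) *
                    ShotNoise.laplace P (ShotNoise.normNoise P Φ γ r) (-ξ) * (1 + ε) ∧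
                  |ε| ≤ C₂ * C₃ ^ k * (k : ℝ) ^ ((k : ℝ) / 2) /
                    (Real.sqrt (ShotNoise.tkappa d γ r ξ 2) * ShotNoise.rho d r) ^ (k + 1) ∧
                  C₂ * C₃ ^ k * (k : ℝ) ^ ((k : ℝ) / 2) /
                      (Real.sqrt (ShotNoise.tkappa d γ r ξ 2) * ShotNoise.rho d r) ^ (k + 1) ≤
                    C₂ * C₃ ^ k * (k : ℝ) ^ ((k : ℝ) / 2) / ShotNoise.rho d r ^ (k + 1)) ∧
              (∀ k : ℕ, y ≤ 0 → C₄ * Real.sqrt k ≤ ShotNoise.rho d r →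
                ∃ ε : ℝ,
                  f y = ShotNoise.edgeworthTerm (ShotNoise.tkappa d γ r ξ)
                      (ShotNoise.rho d r) k * Real.exp (-ξ * y) *
                    ShotNoise.laplace P (ShotNoise.normNoise P Φ γ r) (-ξ) * (1 + ε) ∧
                  |ε| ≤ C₂ * C₃ ^ k * (k : ℝ) ^ ((k : ℝ) / 2) *
                    (ShotNoise.tkappa d γ r ξ 2 ^ (1 / ShotNoise.dOne d γ - 1 / 2) /
                      ShotNoise.rho d r) ^ (k + 1) ∧
                  C₂ * C₃ ^ k * (k : ℝ) ^ ((k : ℝ) / 2) *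
                      (ShotNoise.tkappa d γ r ξ 2 ^ (1 / ShotNoise.dOne d γ - 1 / 2) /
                        ShotNoise.rho d r) ^ (k + 1) ≤
                    C₂ * C₃ ^ k * (k : ℝ) ^ ((k : ℝ) / 2) / ShotNoise.rho d r ^ (k + 1)) := by
  have hα : (d : ℝ) / γ < 1 := ShotNoise.div_lt_one_of_lt hγ
  have hα₀ : (0 : ℝ) < d / γ :=
    div_pos (Nat.cast_pos.2 hd) ((Nat.cast_nonneg d).trans_lt hγ)
  obtain ⟨C₂, C₃, C₄, hC₂, hC₃, hC₄, hexpand⟩ :=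
    ShotNoise.exists_saddlepoint_expansion hα₀ (by linarith)
  refine ⟨C₂, C₃, C₄, hC₂, hC₃, hC₄, fun Ω _ P _ Φ h r hr => ?_⟩
  have hρ := ShotNoise.rho_pos d hr
  have hlaw := h.isNoiseLaw hd hγ hr
  obtain ⟨f, hf, hf₀, hdensity, hfξ⟩ := hlaw.exists_density hα₀ hα hρ
  refine ⟨h.ae_summable_tailTerm hd hγ hr, h.memLp_tailNoise hd hγ hr, h.noiseStd_pos hd hγ hr,
    fun t => h.integrable_exp_normNoise hd hγ hr (-t), f, hf, hf₀, hdensity, fun y hy => ?_⟩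
  rw [h.noiseMean_div_noiseStd hd hγ hr] at hy
  obtain ⟨ξ, rfl⟩ := ShotNoise.exists_tiltedMean_eq hα hρ hy
  obtain ⟨g, hg, hfg⟩ := hfξ ξ
  have hκ := ShotNoise.tkappa_add_two (γ := γ) (d := d) (by linarith) r ξ
  have hexpand := hexpand _ _ _ g (ShotNoise.one_le_rho d hr) hκ hg
  rw [← h.laplace_normNoise hd hγ hr] at hfg
  refine ⟨ξ, fun ξ' => (h.isMinOn_exp_mul_laplace_iff hd hγ hr).trans
      (ShotNoise.strictMono_tiltedMean hα hρ).injective.eq_iff, hlaw.integral_tilted hα hρ ξ,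
    (hlaw.variance_tilted hα hρ ξ).trans (hκ 0).symm, fun n hn => ?_, fun k hy hk => ?_,
    fun k hy hk => ?_⟩
  · obtain ⟨m, rfl⟩ := Nat.exists_eq_add_of_le' hn
    rw [hκ, Nat.add_sub_cancel]
    exact hlaw.iteratedDeriv_cgf_tilted hα hρ ξ m
  · have hξ := (ShotNoise.tiltedMean_nonneg_iff hα hρ).1 hy
    obtain ⟨ε, hε, hbound⟩ := (hexpand k hk).1 (div_nonneg hξ hρ.le)
    exact ⟨ε, by rw [hfg, hε]; ring, hbound⟩
  · have hξ := (ShotNoise.tiltedMean_nonpos_iff hα hρ).1 hy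
    obtain ⟨ε, hε, hbound⟩ := (hexpand k hk).2 (div_nonpos_of_nonpos_of_nonneg hξ hρ.le)
    exact ⟨ε, by rw [hfg, hε]; ring, hbound⟩

theorem theorem1 (d : ℕ) (hd : 1 ≤ d) (γ : ℝ) (hγ : (d : ℝ) < γ) :
    ∃ C₂ C₃ C₄ : ℝ, 0 < C₂ ∧ 0 < C₃ ∧ 0 < C₄ ∧
      ∀ (Ω : Type*) [MeasurableSpace Ω] (P : Measure Ω) [IsProbabilityMeasure P]
        (Φ : Ω → Set (EuclideanSpace ℝ (Fin d))),
        ShotNoise.IsHomogeneousPoisson P Φ (ShotNoise.intensity d γ) →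
      ∀ r : ℝ, 1 ≤ r →
        -- the objects of the statement are well defined
        (∀ᵐ ω ∂P, Summable (fun k : ℕ => ShotNoise.tailTerm Φ γ r (k + 1) ω)) ∧
        MemLp (ShotNoise.tailNoise Φ γ r) 2 P ∧
        0 < ShotNoise.noiseStd P Φ γ r ∧
        (∀ t : ℝ, Integrable (fun ω => Real.exp (-t * ShotNoise.normNoise P Φ γ r ω)) P) ∧
        -- the (unique) continuous density of the normalised tail shot noise
        ∃ f : ℝ → ℝ, Continuous f ∧ (∀ z, 0 ≤ f z) ∧
          P.map (ShotNoise.normNoise P Φ γ r) =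
            (volume : Measure ℝ).withDensity (fun z => ENNReal.ofReal (f z)) ∧
          ∀ y : ℝ, -(ShotNoise.noiseMean P Φ γ r / ShotNoise.noiseStd P Φ γ r) < y →
            -- the tilting parameter is the unique minimiser
            ∃ ξ : ℝ, (∀ ξ' : ℝ, IsMinOn (fun x : ℝ => Real.exp (-x * y) *
                ShotNoise.laplace P (ShotNoise.normNoise P Φ γ r) (-x)) univ ξ' ↔ ξ' = ξ) ∧
              -- mean, variance and cumulants of the tilted law
              (∫ z, z ∂(ShotNoise.tiltedLaw P (ShotNoise.normNoise P Φ γ r) ξ) = y) ∧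
              variance id (ShotNoise.tiltedLaw P (ShotNoise.normNoise P Φ γ r) ξ) =
                ShotNoise.tkappa d γ r ξ 2 ∧
              (∀ n : ℕ, 2 ≤ n →
                iteratedDeriv n
                    (cgf id (ShotNoise.tiltedLaw P (ShotNoise.normNoise P Φ γ r) ξ)) 0 =
                  ShotNoise.tkappa d γ r ξ n / ShotNoise.rho d r ^ (n - 2)) ∧
              -- the upper tail
              (∀ k : ℕ, 0 ≤ y → C₄ * Real.sqrt k ≤ ShotNoise.rho d r →
                ∃ ε : ℝ,
                  f y = ShotNoise.edgeworthTerm (ShotNoise.tkappa d γ r ξ)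
                      (ShotNoise.rho d r) k * Real.exp (-ξ * y) *
                    ShotNoise.laplace P (ShotNoise.normNoise P Φ γ r) (-ξ) * (1 + ε) ∧
                  |ε| ≤ C₂ * C₃ ^ k * (k : ℝ) ^ ((k : ℝ) / 2) /
                    (Real.sqrt (ShotNoise.tkappa d γ r ξ 2) * ShotNoise.rho d r) ^ (k + 1) ∧
                  C₂ * C₃ ^ k * (k : ℝ) ^ ((k : ℝ) / 2) /
                      (Real.sqrt (ShotNoise.tkappa d γ r ξ 2) * ShotNoise.rho d r) ^ (k + 1) ≤
                    C₂ * C₃ ^ k * (k : ℝ) ^ ((k : ℝ) / 2) / ShotNoise.rho d r ^ (k + 1)) ∧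
              -- the lower tail
              (∀ k : ℕ, y ≤ 0 → max (C₄ * Real.sqrt k) (k : ℝ) ≤ ShotNoise.rho d r →
                ∃ ε : ℝ,
                  f y = ShotNoise.edgeworthTerm (ShotNoise.tkappa d γ r ξ)
                      (ShotNoise.rho d r) k * Real.exp (-ξ * y) *
                    ShotNoise.laplace P (ShotNoise.normNoise P Φ γ r) (-ξ) * (1 + ε) ∧
                  |ε| ≤ C₂ * C₃ ^ k * (k : ℝ) ^ ((k : ℝ) / 2) *
                    (ShotNoise.tkappa d γ r ξ 2 ^ (1 / ShotNoise.dOne d γ - 1 / 2) /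
                      ShotNoise.rho d r) ^ (k + 1) ∧
                  C₂ * C₃ ^ k * (k : ℝ) ^ ((k : ℝ) / 2) *
                      (ShotNoise.tkappa d γ r ξ 2 ^ (1 / ShotNoise.dOne d γ - 1 / 2) /
                        ShotNoise.rho d r) ^ (k + 1) ≤
                    C₂ * C₃ ^ k * (k : ℝ) ^ ((k : ℝ) / 2) / ShotNoise.rho d r ^ (k + 1)) := by
  peel theorem1_general d hd γ hγ
  exact fun hk => this ((le_max_left _ _).trans hk)
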